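/- Let $r\ge 0$, $n\ge 1$, $s\ge 0$ be integers with $N:=n+s\ge 3$, and let $\Delta=(v_{n+1},\dots,v_N)$ be a tuple of vectors in $\mathbb Z^r\setminus\{0\}$ with $v_{n+1}+\dots+v_N=0$. Put $v_1=\dots=v_n=0$. Let $\mathcal M_{0,N,\mathrm{trop}}$ be the set of isomorphism classes of rational tropical curves $(\Gamma,x_1,\dots,x_N)$, i.e. connected metric graphs $\Gamma$ of genus $0$ with all vertices of valence at least $3$, bounded edges of positive finite length, and exactly $N$ unbounded edges (ends), labeled $x_1,\dots,x_N$. Let $\mathcal M^{\mathrm{lab}}_{0,n,\mathrm{trop}}(\mathbb R^r,\Delta)$ be the set of isomorphism classes of tuples $(\Gamma,x_1,\dots,x_N,h)$ where $(\Gamma,x_1,\dots,x_N)$ is such a curve and $h:\Gamma\to\mathbb R^r$ is a continuous map that is affine with an integral direction vector on each edge, satisfies the balancing condition at each vertex (the outgoing direction vectors of the adjacent edges sum to $0$), and has direction $v_i$ on the end $x_i$ for $i=1,\dots,N$. It carries the topology of a polyhedral complex: the closed cells (lengths $\ge 0$ of the bounded edges together with a compatible map of the vertices to $\mathbb R^r$)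 of all combinatorial types are glued by contracting edges of length $0$. Let $\psi(\Gamma,x_1,\dots,x_N,h)=(\Gamma,x_1,\dots,x_N)$ and $\mathrm{ev}_1(\Gamma,x_1,\dots,x_N,h)=h(x_1)\in\mathbb R^r$. Let $Q_N$ be the quotient of $\mathbb R^{\binom N2}$ by the image of $\mathbb R^N\to\mathbb R^{\binom N2}$, $a\mapsto(a_i+a_j)_{\{i,j\}}$, and let $\varphi_N:\mathcal M_{0,N,\mathrm{trop}}\to Q_N$ send a curve to the class of the vector of the distances between $x_i$ and $x_j$ (the sum of the lengths of the bounded edges on the path from $x_i$ to $x_j$). Let $\Lambda_N\subset Q_N$ be the subgroup generated by the vectors $\varphi_N(C)$ for the curves $C$ with exactly one bounded edge, of length $1$. Consider $\varphi_N(\mathcal M_{0,N,\mathrm{trop}})$ as the weighted fan whose cones $\sigma$ are the closed cells of the combinatorial types, the weight of a maximal cone $\sigma$ being the index in $\Lambda_N\cap\langle\sigma\rangle_{\mathbb R}$ of the subgroup generated by those of these vectors that lie in $\sigma$. Then the map $$\mathcal M^{\mathrm{lab}}_{0,n,\mathrm{trop}}(\mathbb R^r,\Delta)\to Q_N\times\mathbb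 R^r,\qquad C\mapsto(\varphi_N(\psi(C)),\mathrm{ev}_1(C))$$ is a topological embedding. Its image is $\varphi_N(\mathcal M_{0,N,\mathrm{trop}})\times\mathbb R^r$, which is the support of the product of the weighted fan $\varphi_N(\mathcal M_{0,N,\mathrm{trop}})$ with the one-cone fan $\mathbb R^r$ of weight $1$. This product is a tropical fan (a fan of pure dimension with positive integral weights that satisfies the balancing condition at each cone of codimension one) with respect to the lattice $\Lambda_N\times\mathbb Z^r$, and it has dimension $r+N-3=r+n+s-3$. -/

import Mathlib

open Set Topology

noncomputable section

namespace TropModuli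

/-! ## Cones, fans and tropical fans

`V` is a real vector space and `Λ` a lattice in it. -/

section Fans

variable {V : Type*} [AddCommGroup V] [Module ℝ V]

/-- `Λ` is a lattice of full rank in `V`: the set of integral combinations of a real basis,
so that `V = Λ ⊗ ℝ` with `Λ` free of finite rank. -/
def IsLattice (Λ : AddSubgroup V) : Prop :=
  ∃ (d : ℕ) (b : Module.Basis (Fin d) ℝ V), Λ = AddSubgroup.closure (range b)

/-- The linear form `f` lies in the dual lattice of `Λ`. -/
def IsIntegral (Λ : AddSubgroup V) (f : V →ₗ[ℝ] ℝ) : Prop :=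
  ∀ x ∈ Λ, ∃ k : ℤ, f x = k

/-- The solution set of finitely many equalities `f i = 0` and inequalities `0 ≤ g j`. -/
def solutionSet {p m : ℕ} (f : Fin p → V →ₗ[ℝ] ℝ) (g : Fin m → V →ₗ[ℝ] ℝ) : Set V :=
  {x | (∀ i, f i x = 0) ∧ ∀ j, 0 ≤ g j x}

/-- Cones: sets given by finitely many integral linear equalities and non-strict inequalities. -/
def IsCone (Λ : AddSubgroup V) (σ : Set V) : Prop :=
  ∃ (p m : ℕ) (f : Fin p → V →ₗ[ℝ] ℝ) (g : Fin m → V →ₗ[ℝ] ℝ),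
    (∀ i, IsIntegral Λ (f i)) ∧ (∀ j, IsIntegral Λ (g j)) ∧ σ = solutionSet f g

/-- `τ` is a face of the cone `σ`: it is obtained by changing some of the inequalities
describing `σ` (those with index in `J`) into equalities. -/
def IsFace (Λ : AddSubgroup V) (τ σ : Set V) : Prop :=
  ∃ (p m : ℕ) (f : Fin p → V →ₗ[ℝ] ℝ) (g : Fin m → V →ₗ[ℝ] ℝ) (J : Set (Fin m)),
    (∀ i, IsIntegral Λ (f i)) ∧ (∀ j, IsIntegral Λ (g j)) ∧ σ = solutionSet f g ∧
      τ = {x | x ∈ solutionSet f g ∧ ∀ j ∈ J, g j x = 0}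

/-- The dimension of a cone is the dimension of its linear span. -/
def coneDim (σ : Set V) : ℕ := Module.finrank ℝ (Submodule.span ℝ σ)

/-- The lattice `Λ_σ = Λ ∩ V_σ` of a cone, where `V_σ` is the linear span of `σ`. -/
def coneLattice (Λ : AddSubgroup V) (σ : Set V) : AddSubgroup V :=
  Λ ⊓ (Submodule.span ℝ σ).toAddSubgroup

/-- `u` represents the primitive normal vector of `σ` relative to its face `τ` of codimension
one: its class generates `Λ_σ / Λ_τ`, and it lies on the same side of `V_τ` as `σ`. -/
def IsNormalVector (Λ : AddSubgroup V) (τ σ : Set V) (u : V) : Prop :=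
  u ∈ coneLattice Λ σ ∧
  (∀ x ∈ coneLattice Λ σ, ∃ k : ℤ, x - k • u ∈ coneLattice Λ τ) ∧
  ∃ g : V →ₗ[ℝ] ℝ, IsIntegral Λ g ∧ (∀ x ∈ τ, g x = 0) ∧ (∀ x ∈ σ, 0 ≤ g x) ∧ 0 < g u

/-- Fans: finite sets of cones that are closed under taking faces and in which any two cones
meet in a common face. -/
structure IsFan (Λ : AddSubgroup V) (X : Set (Set V)) : Prop where
  finite : X.Finite
  isCone : ∀ σ ∈ X, IsCone Λ σ
  face_mem : ∀ σ ∈ X, ∀ τ, IsFace Λ τ σ → τ ∈ X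
  inter_face : ∀ σ ∈ X, ∀ σ' ∈ X, IsFace Λ (σ ∩ σ') σ ∧ IsFace Λ (σ ∩ σ') σ'

end Fans

/-- A set of cones together with weights. Only the weights of the cones of maximal dimension
are relevant. -/
structure WeightedFan (V : Type*) where
  cones : Set (Set V)
  weight : Set V → ℕ

namespace WeightedFan

variable {V W : Type*} [AddCommGroup V] [Module ℝ V] [AddCommGroup W] [Module ℝ W]

/-- The union `|X|` of all cones. -/
def support (X : WeightedFan V) : Set V := ⋃₀ X.cones

/-- `X` is a tropical fan of dimension `k` in `V` with lattice `Λ`: a non-empty fan, of pure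
dimension `k`, with positive weights on the `k`-dimensional cones, such that for every cone `τ`
of dimension `k - 1` the weighted sum of the normal vectors `u_{σ/τ}` over the
`k`-dimensional cones `σ > τ` is zero in `V / V_τ`. -/
structure IsTropical (Λ : AddSubgroup V) (X : WeightedFan V) (k : ℕ) : Prop where
  isLattice : IsLattice Λ
  isFan : IsFan Λ X.cones
  nonempty : X.cones.Nonempty
  pure : ∀ σ ∈ X.cones, (∀ σ' ∈ X.cones, σ ⊆ σ' → σ' = σ) → coneDim σ = k
  weight_pos : ∀ σ ∈ X.cones, coneDim σ = k → 0 < X.weight σ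
  balanced : ∀ τ ∈ X.cones, coneDim τ + 1 = k →
    ∃ u : Set V → V,
      (∀ σ ∈ X.cones, coneDim σ = k → IsFace Λ τ σ → IsNormalVector Λ τ σ (u σ)) ∧
      ∑ᶠ σ ∈ {σ | σ ∈ X.cones ∧ coneDim σ = k ∧ IsFace Λ τ σ}, X.weight σ • u σ
        ∈ Submodule.span ℝ τ

/-- The product of two weighted fans: the cones are the products `σ × σ'`, with weight
`ω(σ) ω(σ')` (the factors of `σ × σ'` are recovered as its projections). -/
def prod (X : WeightedFan V) (Y : WeightedFan W) : WeightedFan (V × W) where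
  cones := {P | ∃ σ ∈ X.cones, ∃ σ' ∈ Y.cones, P = σ ×ˢ σ'}
  weight P := X.weight (Prod.fst '' P) * Y.weight (Prod.snd '' P)

/-- The fan `{V}` with the single cone `V`, of weight one. -/
def whole (V : Type*) : WeightedFan V where
  cones := {univ}
  weight _ := 1

/-- The weighted fan given by a set of simplicial cones and a set `M` containing one lattice
vector on each ray. The weight of `σ` is the index in `Λ_σ` of the subgroup generated by the
marking vectors of the rays of `σ`, i.e. by the marking vectors that lie in `σ`. -/
def ofMarking (Λ : AddSubgroup V) (cones : Set (Set V)) (M : Set V) : WeightedFan V where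
  cones := cones
  weight σ := (AddSubgroup.closure (M ∩ σ)).relIndex (coneLattice Λ σ)

end WeightedFan

/-! ## Abstract rational tropical curves

A connected graph of genus zero has no loops or multiple edges, so that its vertices and bounded
edges form a tree in the sense of simple graphs; the unbounded edges are recorded by the
vertices to which they are attached. -/

/-- Combinatorial types of rational tropical curves with exactly `N` ends, all of them marked:
finite trees with `N` labeled ends attached to the vertices, such that each vertex has valence
at least three. -/
structure TreeType (N : ℕ) : Type 1 where
  /-- vertices -/
  V : Type
  finite : Finite V
  /-- the graph of bounded edges -/
  G : SimpleGraph V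
  isTree : G.IsTree
  /-- the vertex to which the `i`-th end is attached -/
  leg : Fin N → V
  stable : ∀ v, 3 ≤ (G.neighborSet v).ncard + {i | leg i = v}.ncard

attribute [instance] TreeType.finite

namespace TreeType

variable {N : ℕ} (T : TreeType N)

/-- The unique path between two vertices. -/
def path (u v : T.V) : T.G.Walk u v := (T.isTree.existsUnique_path u v).choose

lemma path_isPath (u v : T.V) : (T.path u v).IsPath :=
  (T.isTree.existsUnique_path u v).choose_spec.1

lemma eq_path {u v : T.V} (p : T.G.Walk u v) (hp : p.IsPath) : p = T.path u v :=
  (T.isTree.existsUnique_path u v).choose_spec.2 p hp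

/-- The distance between the ends `i` and `j` if the bounded edges have lengths `l`: the sum of
the lengths of the edges on the path from one to the other. -/
def legDist (l : T.G.edgeSet → ℝ) (i j : Fin N) : ℝ :=
  ∑ᶠ (e : T.G.edgeSet) (_ : e.1 ∈ (T.path (T.leg i) (T.leg j)).edges), l e

end TreeType

/-- Rational tropical curves with exactly `N` ends `x_1, …, x_N`: the bounded edges carry
positive lengths. -/
structure AbsCurve (N : ℕ) : Type 1 extends TreeType N where
  length : G.edgeSet → ℝ
  length_pos : ∀ e, 0 < length e

/-- Isomorphism of marked curves: a graph isomorphism that respects the marked ends and the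
lengths. -/
def AbsCurve.Isom {N : ℕ} (C D : AbsCurve N) : Prop :=
  ∃ f : C.G ≃g D.G, (∀ i, f (C.leg i) = D.leg i) ∧
    ∀ e, D.length (f.mapEdgeSet e) = C.length e

lemma mapEdgeSet_trans {A B C : Type} {G : SimpleGraph A} {H : SimpleGraph B} {K : SimpleGraph C}
    (f : G ≃g H) (g : H ≃g K) (e : G.edgeSet) :
    SimpleGraph.Iso.mapEdgeSet (f.trans g) e = g.mapEdgeSet (f.mapEdgeSet e) := by
  obtain ⟨e, he⟩ := e
  induction e with
  | _ a b => rfl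

lemma mapEdgeSet_refl {A : Type} {G : SimpleGraph A} (e : G.edgeSet) :
    (SimpleGraph.Iso.refl : G ≃g G).mapEdgeSet e = e := by
  obtain ⟨e, he⟩ := e
  induction e with
  | _ a b => rfl

lemma mapEdgeSet_symm {A B : Type} {G : SimpleGraph A} {H : SimpleGraph B}
    (f : G ≃g H) (e : H.edgeSet) : f.mapEdgeSet (f.symm.mapEdgeSet e) = e :=
  f.mapEdgeSet.apply_symm_apply e

instance AbsCurve.setoid (N : ℕ) : Setoid (AbsCurve N) where
  r := AbsCurve.Isom
  iseqv :=
    { refl := fun _ => ⟨SimpleGraph.Iso.refl, fun _ => rfl, fun e => by rw [mapEdgeSet_refl]⟩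
      symm := by
        rintro C D ⟨f, hf, hl⟩
        refine ⟨f.symm, fun i => by rw [← hf]; exact f.symm_apply_apply _, fun e => ?_⟩
        rw [← hl, mapEdgeSet_symm]
      trans := by
        rintro C D E ⟨f, hf, hl⟩ ⟨g, hg, hm⟩
        refine ⟨f.trans g, fun i => ?_, fun e => ?_⟩
        · rw [← hg, ← hf]; rfl
        · rw [mapEdgeSet_trans, hm, hl] }

/-- The space of rational tropical curves with exactly `N` ends, all of them marked, modulo
isomorphism. -/
def M0 (N : ℕ) : Type 1 := Quotient (AbsCurve.setoid N)

/-- The two-element subsets `{i < j}` of the set of labels. -/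
abbrev Pairs (N : ℕ) : Type := {t : Fin N × Fin N // t.1 < t.2}

/-- The linear map `a ↦ (a_i + a_j)_{i < j}`. -/
def Phi (N : ℕ) : (Fin N → ℝ) →ₗ[ℝ] (Pairs N → ℝ) where
  toFun a t := a t.1.1 + a t.1.2
  map_add' a b := by ext t; simp only [Pi.add_apply]; ring
  map_smul' c a := by ext t; simp only [Pi.smul_apply, smul_eq_mul, RingHom.id_apply]; ring

/-- The space `Q_N` of dimension `N (N - 1) / 2 - N`, with the quotient topology. -/
abbrev Q (N : ℕ) : Type := (Pairs N → ℝ) ⧸ LinearMap.range (Phi N)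

/-- The class in `Q_N` of the vector of distances of the ends of the tree `T` with
edge lengths `l`. -/
def TreeType.distClass {N : ℕ} (T : TreeType N) (l : T.G.edgeSet → ℝ) : Q N :=
  Submodule.Quotient.mk fun t => T.legDist l t.1.1 t.1.2

lemma AbsCurve.legDist_eq {N : ℕ} {C D : AbsCurve N} (h : C.Isom D) (i j : Fin N) :
    C.legDist C.length i j = D.legDist D.length i j := by
  obtain ⟨f, hf, hl⟩ := h
  have key : ∀ (u v : D.V) (hu : f (C.leg i) = u) (hv : f (C.leg j) = v) (e : C.G.edgeSet),
      e.1 ∈ (C.path (C.leg i) (C.leg j)).edges ↔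
        (f.mapEdgeSet e).1 ∈ (D.path u v).edges := by
    rintro u v rfl rfl e
    have h1 : ((C.path (C.leg i) (C.leg j)).map f.toHom) = D.path _ _ :=
      D.eq_path _ ((SimpleGraph.Walk.isPath_map_iff_of_injective f.injective).2 (C.path_isPath _ _))
    have h2 : (D.path (f (C.leg i)) (f (C.leg j))).edges =
        (C.path (C.leg i) (C.leg j)).edges.map (Sym2.map f) := by
      exact (congrArg SimpleGraph.Walk.edges h1.symm).trans (SimpleGraph.Walk.edges_map f.toHom _)
    rw [h2]
    exact (List.mem_map_of_injective (Sym2.map.injective f.injective)).symm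
  unfold TreeType.legDist
  refine finsum_eq_of_bijective f.mapEdgeSet f.mapEdgeSet.bijective fun e => ?_
  rw [hl e]
  exact finsum_congr_Prop (propext (key _ _ (hf i) (hf j) e)) fun _ => rfl

/-- The map `φ_N` from the moduli space to `Q_N`. -/
def phi (N : ℕ) : M0 N → Q N :=
  Quotient.lift (fun C => C.distClass C.length) fun C D h => by
    unfold TreeType.distClass
    congr 1
    funext t
    exact AbsCurve.legDist_eq h _ _

/-- The vectors `v_I`: the images under `φ_N` of the curves with exactly one bounded edge, of
length one. -/
def splitVectors (N : ℕ) : Set (Q N) :=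
  {x | ∃ C : AbsCurve N, Nat.card C.G.edgeSet = 1 ∧ (∀ e, C.length e = 1) ∧ phi N ⟦C⟧ = x}

/-- The lattice `Λ_N` generated by the vectors `v_I`. -/
def latticeQ (N : ℕ) : AddSubgroup (Q N) := AddSubgroup.closure (splitVectors N)

/-- The closed cell of the combinatorial type `T` in `Q_N`. -/
def TreeType.cone {N : ℕ} (T : TreeType N) : Set (Q N) :=
  T.distClass '' {l | ∀ e, 0 ≤ l e}

/-- The weighted fan `φ_N(M_{0,N,trop})`: its cones are the closed cells of the combinatorial
types, and it is marked by the vectors `v_I`. -/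
def m0Fan (N : ℕ) : WeightedFan (Q N) :=
  WeightedFan.ofMarking (latticeQ N) (range TreeType.cone) (splitVectors N)

/-! ## Labeled tropical curves in `ℝ^r` -/

section Labeled

variable {r s : ℕ}

/-- The directions of the `n + s` ends of a labeled `n`-marked curve of degree `Δ`: the first `n`
ends are contracted, and the others have the directions prescribed by `Δ`. -/
def endDir (n : ℕ) (Δ : Fin s → Fin r → ℤ) : Fin (n + s) → Fin r → ℤ :=
  Fin.append (fun _ => 0) Δ

/-- Combinatorial types of labeled `n`-marked curves of degree `Δ` in `ℝ^r`: `dir d` is the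
direction `v(E, V)` of the bounded edge `E` at its boundary vertex `V`, where the dart `d` is `E`
oriented so that it starts at `V`. The directions satisfy the balancing condition at each
vertex. -/
structure LabType (n : ℕ) (Δ : Fin s → Fin r → ℤ) : Type 1 extends TreeType (n + s) where
  dir : G.Dart → Fin r → ℤ
  dir_symm : ∀ d, dir d.symm = - dir d
  balanced : ∀ v : V, (∑ᶠ (d : G.Dart) (_ : d.fst = v), dir d) +
    (∑ᶠ (i : Fin (n + s)) (_ : leg i = v), endDir n Δ i) = 0

/-- The closed cell of a combinatorial type: edge lengths `l ≥ 0` and vertex positions `p` in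
`ℝ^r` with `p(W) = p(V) + l(E) v(E, V)` for each bounded edge `E` from `V` to `W`. -/
def LabType.closedCell {n : ℕ} {Δ : Fin s → Fin r → ℤ} (α : LabType n Δ) :
    Set ((α.G.edgeSet → ℝ) × (α.V → Fin r → ℝ)) :=
  {x | (∀ e, 0 ≤ x.1 e) ∧ ∀ d : α.G.Dart,
    x.2 d.snd = x.2 d.fst + x.1 ⟨d.edge, d.edge_mem⟩ • fun k => (α.dir d k : ℝ)}

/-- Labeled `n`-marked tropical curves of degree `Δ` in `ℝ^r`. A continuous map `h` from the
curve to `ℝ^r` that has the form `h(t) = a + t v` on each edge is given by the images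
`pos` of the vertices and by the directions of the edges, subject to the condition
`h(W) = h(V) + l(E) v(E, V)` for each bounded edge `E` from `V` to `W`. The directions of the
ends are `endDir n Δ`. -/
structure LabCurve (n : ℕ) (Δ : Fin s → Fin r → ℤ) : Type 1 extends LabType n Δ where
  length : G.edgeSet → ℝ
  length_pos : ∀ e, 0 < length e
  pos : V → Fin r → ℝ
  pos_snd : ∀ d : G.Dart,
    pos d.snd = pos d.fst + length ⟨d.edge, d.edge_mem⟩ • fun k => (dir d k : ℝ)

variable {n : ℕ} {Δ : Fin s → Fin r → ℤ}

/-- The underlying abstract curve `(Γ, x_1, …, x_N)`. -/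
def LabCurve.toAbsCurve (C : LabCurve n Δ) : AbsCurve (n + s) where
  toTreeType := C.toTreeType
  length := C.length
  length_pos := C.length_pos

/-- Isomorphism of labeled curves: an isomorphism of the underlying abstract curves that is
compatible with the maps to `ℝ^r`. (It suffices to compare the maps at the vertices: the
directions of the ends are fixed by `Δ`, and on the bounded edges the maps are affine.) -/
def LabCurve.Isom (C D : LabCurve n Δ) : Prop :=
  ∃ f : C.G ≃g D.G, (∀ i, f (C.leg i) = D.leg i) ∧
    (∀ e, D.length (f.mapEdgeSet e) = C.length e) ∧ ∀ v, D.pos (f v) = C.pos v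

instance LabCurve.setoid (n : ℕ) (Δ : Fin s → Fin r → ℤ) : Setoid (LabCurve n Δ) where
  r := LabCurve.Isom
  iseqv :=
    { refl := fun _ => ⟨SimpleGraph.Iso.refl, fun _ => rfl, fun e => by rw [mapEdgeSet_refl],
        fun _ => rfl⟩
      symm := by
        rintro C D ⟨f, hf, hl, hp⟩
        refine ⟨f.symm, fun i => by rw [← hf]; exact f.symm_apply_apply _, fun e => ?_,
          fun v => ?_⟩
        · rw [← hl, mapEdgeSet_symm]
        · rw [← hp]; exact congrArg D.pos (f.apply_symm_apply v)
      trans := by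
        rintro C D E ⟨f, hf, hl, hp⟩ ⟨g, hg, hm, hq⟩
        refine ⟨f.trans g, fun i => ?_, fun e => ?_, fun v => ?_⟩
        · rw [← hg, ← hf]; rfl
        · rw [mapEdgeSet_trans, hm, hl]
        · rw [← hp, ← hq]; rfl }

/-- The moduli space of labeled `n`-marked tropical curves of degree `Δ` in `ℝ^r`. -/
def MLab (n : ℕ) (Δ : Fin s → Fin r → ℤ) : Type 1 := Quotient (LabCurve.setoid n Δ)

/-- The forgetful map `ψ`, which keeps the underlying abstract curve with all of its ends. -/
def psi : MLab n Δ → M0 (n + s) :=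
  Quotient.map LabCurve.toAbsCurve fun _ _ ⟨f, hf, hl, _⟩ => ⟨f, hf, hl⟩

/-- The evaluation map `ev_i` at the `i`-th contracted end. -/
def ev (i : Fin n) : MLab n Δ → Fin r → ℝ :=
  Quotient.lift (fun C => C.pos (C.leg (Fin.castAdd s i))) fun C D ⟨f, hf, _, hp⟩ => by
    rw [← hf, hp]

/-- The graph of the edges of length zero. -/
def zeroGraph {N : ℕ} (T : TreeType N) (l : T.G.edgeSet → ℝ) : SimpleGraph T.V where
  Adj u v := ∃ e : T.G.edgeSet, e.1 = s(u, v) ∧ l e = 0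
  symm := ⟨by rintro u v ⟨e, he, h0⟩; exact ⟨e, by rw [he, Sym2.eq_swap], h0⟩⟩
  loopless := ⟨by
    rintro v ⟨⟨e, hm⟩, he, -⟩
    subst he
    exact T.G.loopless.irrefl v hm⟩

/-- The labeled curve `C` is obtained from the point `(l, p)` of the closed cell of `α` by
contracting all edges of length zero. Here `π` maps each vertex to its image in `C`. -/
def IsContraction (α : LabType n Δ) (l : α.G.edgeSet → ℝ) (p : α.V → Fin r → ℝ)
    (C : LabCurve n Δ) : Prop :=
  ∃ π : α.V → C.V, Function.Surjective π ∧
    (∀ u v, π u = π v ↔ (zeroGraph α.toTreeType l).Reachable u v) ∧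
    (∀ e, 0 < l e → ∃ e' : C.G.edgeSet, e'.1 = Sym2.map π e.1 ∧ C.length e' = l e) ∧
    (∀ e' : C.G.edgeSet, ∃ e : α.G.edgeSet, e'.1 = Sym2.map π e.1) ∧
    (∀ i, C.leg i = π (α.leg i)) ∧
    ∀ v, C.pos (π v) = p v

/-- The points of the closed cell of `α`, each together with the (unique) point of the moduli
space that it represents, i.e. the graph of the characteristic map of this cell. -/
def LabType.cellGraph (α : LabType n Δ) :
    Set (((α.G.edgeSet → ℝ) × (α.V → Fin r → ℝ)) × MLab n Δ) :=
  {x | x.1 ∈ α.closedCell ∧ ∃ C, IsContraction α x.1.1 x.1.2 C ∧ x.2 = ⟦C⟧}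

/-- The topology of the moduli space as a polyhedral complex: the closed cells of all
combinatorial types are glued by contracting the edges of length zero, and a set is open if and
only if its preimage in each closed cell is open. -/
instance (n : ℕ) (Δ : Fin s → Fin r → ℤ) : TopologicalSpace (MLab n Δ) :=
  ⨆ α : LabType n Δ,
    TopologicalSpace.coinduced (fun x : α.cellGraph => x.1.2)
      (TopologicalSpace.induced (fun x : α.cellGraph => x.1.1) inferInstance)

end Labeled

/-- The lattice `ℤ^r` in `ℝ^r`. -/
def intLattice (r : ℕ) : AddSubgroup (Fin r → ℝ) :=
  AddSubgroup.pi univ fun _ => (Int.castAddHom ℝ).range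

end TropModuli

end

/-! Root every tree at a fixed end `o`. A bounded edge is then recorded by its cluster, the set of
labels that it separates from `o`. By stability, distinct edges have distinct clusters, with at
least two labels inside and outside, and any two clusters are nested or disjoint. Conversely,
inclusions among the clusters recover the tree (`TreeType.exists_iso`), and every such hierarchy
comes from a tree (`exists_treeType`). So a curve amounts to a function `c ≥ 0` on clusters whose
support is a hierarchy, and its class in `Q N` is `∑ c A • splitVector A`, the decomposition of a
tree metric into cut metrics (`distClass_eq`).

The linear algebra rests on Gromov products at `o`. Their differences descend to `Q N` and are
integral on the vectors `splitVector A`, and suitable triples of labels isolate a single cluster.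
Hence the metric determines `c`, even across different hierarchies (`eq_of_combination_eq`). The
vectors of a hierarchy have integral dual forms (`IsHierarchy.exists_dual`), so that all cones are
simplicial and unimodular and all weights are one. The vectors of the pairs away from `o`, with one
pair left out, form a basis of the lattice.

Purity and balancing come from a count: the numbers of children minus two, summed over the vertices,
give `N - 3` minus the number of clusters. So a hierarchy with fewer than `N - 3` clusters can be
enlarged, and one with `N - 4` clusters has a single four-valent vertex and exactly three
extensions. Their vectors add up to an element of the span of the smaller cone
(`splitVector_union`).

For maps to `ℝ^r`, summing the balancing condition over a subtree forces the direction of each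
bounded edge (`LabType.dir_eq`), and the forced directions are always balanced because the ends sum
to zero. So `h` is determined by the abstract curve and the image of `o`, which is arbitrary; taking
`x_1` for `o` gives injectivity and the image. On each closed cell the map is linear and injective,
hence closed, and finitely many cells suffice (`isClosedMap_evalMap`). -/

noncomputable section

namespace TropModuli

/-! ### Trees rooted at the end `o`. -/

namespace TreeType

variable {N : ℕ} (T : TreeType N) (o : Fin N)

/-- `u` lies on the path from the end `o` to the vertex `v`. -/
def IsAnc (u v : T.V) : Prop := u ∈ (T.path (T.leg o) v).support

/-- The next vertex on the way from `v` to the end `o`. -/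
def par (v : T.V) : T.V := (T.path (T.leg o) v).penultimate

/-- The number of bounded edges between `v` and the end `o`. -/
def depth (v : T.V) : ℕ := (T.path (T.leg o) v).length

open Classical in
/-- The labels of the ends that are separated from the end `o` by the vertex `v`. -/
def below (v : T.V) : Finset (Fin N) := Finset.univ.filter fun i => T.IsAnc o v (T.leg i)

lemma path_self (u : T.V) : T.path u u = SimpleGraph.Walk.nil :=
  (T.eq_path _ SimpleGraph.Walk.IsPath.nil).symm

lemma isAnc_root_iff {u : T.V} : T.IsAnc o u (T.leg o) ↔ u = T.leg o := by
  simp [IsAnc, path_self]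

lemma root_isAnc (v : T.V) : T.IsAnc o (T.leg o) v := SimpleGraph.Walk.start_mem_support _

lemma isAnc_refl (v : T.V) : T.IsAnc o v v := SimpleGraph.Walk.end_mem_support _

lemma path_concat {u v : T.V} (h : T.G.Adj u v) (hv : ¬ T.IsAnc o v u) :
    T.path (T.leg o) v = (T.path (T.leg o) u).concat h :=
  (T.eq_path _ ((T.path_isPath _ _).concat hv h)).symm

lemma not_nil_path {v : T.V} (hv : v ≠ T.leg o) : ¬ (T.path (T.leg o) v).Nil := fun h =>
  hv h.eq.symm

lemma adj_par {v : T.V} (hv : v ≠ T.leg o) : T.G.Adj (T.par o v) v :=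
  SimpleGraph.Walk.adj_penultimate (T.not_nil_path o hv)

lemma path_eq_concat_par {v : T.V} (hv : v ≠ T.leg o) :
    T.path (T.leg o) v = (T.path (T.leg o) (T.par o v)).concat (T.adj_par o hv) := by
  have h : (T.path (T.leg o) v).dropLast = T.path (T.leg o) (T.par o v) :=
    T.eq_path _ (T.path_isPath (T.leg o) v).dropLast
  rw [← h]
  exact (SimpleGraph.Walk.concat_dropLast _).symm

lemma isAnc_iff {u v : T.V} (hv : v ≠ T.leg o) :
    T.IsAnc o u v ↔ T.IsAnc o u (T.par o v) ∨ u = v := by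
  rw [IsAnc, T.path_eq_concat_par o hv, SimpleGraph.Walk.support_concat]
  simp [IsAnc]

lemma depth_par {v : T.V} (hv : v ≠ T.leg o) : T.depth o v = T.depth o (T.par o v) + 1 := by
  rw [depth, T.path_eq_concat_par o hv, SimpleGraph.Walk.length_concat]
  rfl

lemma par_induction {P : T.V → Prop} (root : P (T.leg o))
    (step : ∀ v, v ≠ T.leg o → P (T.par o v) → P v) (v : T.V) : P v := by
  induction h : T.depth o v generalizing v with
  | zero =>
    by_cases hv : v = T.leg o
    · exact hv ▸ root
    · have := T.depth_par o hv
      omega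
  | succ k ih =>
    by_cases hv : v = T.leg o
    · exact hv ▸ root
    · have := T.depth_par o hv
      exact step v hv (ih _ (by omega))

lemma par_of_adj {u v : T.V} (h : T.G.Adj u v) (hv : ¬ T.IsAnc o v u) : T.par o v = u := by
  rw [par, T.path_concat o h hv, SimpleGraph.Walk.penultimate_concat]

variable {T o}

lemma IsAnc.trans {u v w : T.V} (h : T.IsAnc o u v) (h' : T.IsAnc o v w) : T.IsAnc o u w := by
  induction w using T.par_induction o with
  | root => rw [isAnc_root_iff] at h'; exact h' ▸ h
  | step w hw ih =>
    rw [isAnc_iff T o hw] at h'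
    rcases h' with h' | rfl
    · exact (isAnc_iff T o hw).2 (Or.inl (ih h'))
    · exact h

/-- The ancestors of `w` all lie on one path, hence form a chain. This is what makes the label sets
nested or disjoint. -/
lemma IsAnc.total {u v w : T.V} (h : T.IsAnc o u w) (h' : T.IsAnc o v w) :
    T.IsAnc o u v ∨ T.IsAnc o v u := by
  induction w using T.par_induction o with
  | root =>
    rw [isAnc_root_iff] at h h'
    exact h ▸ h' ▸ Or.inl (isAnc_refl _ _ _)
  | step w hw ih =>
    rcases (isAnc_iff T o hw).1 h with h1 | rfl
    · rcases (isAnc_iff T o hw).1 h' with h2 | rfl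
      · exact ih h1 h2
      · exact Or.inl h
    · exact Or.inr h'

lemma IsAnc.eq_or_depth_lt {u v : T.V} (h : T.IsAnc o u v) :
    u = v ∨ T.depth o u < T.depth o v := by
  induction v using T.par_induction o with
  | root => exact Or.inl ((isAnc_root_iff T o).1 h)
  | step v hv ih =>
    have := T.depth_par o hv
    rcases (isAnc_iff T o hv).1 h with h1 | rfl
    · rcases ih h1 with rfl | h2
      · right; omega
      · right; omega
    · exact Or.inl rfl

lemma IsAnc.antisymm {u v : T.V} (h : T.IsAnc o u v) (h' : T.IsAnc o v u) : u = v := by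
  rcases h.eq_or_depth_lt with h1 | h1
  · exact h1
  · rcases h'.eq_or_depth_lt with h2 | h2
    · exact h2.symm
    · omega

lemma par_isAnc {v : T.V} (hv : v ≠ T.leg o) : T.IsAnc o (T.par o v) v :=
  (isAnc_iff T o hv).2 (Or.inl (isAnc_refl _ _ _))

lemma not_isAnc_par {v : T.V} (hv : v ≠ T.leg o) : ¬ T.IsAnc o v (T.par o v) := fun h =>
  (T.adj_par o hv).ne (h.antisymm (par_isAnc hv)).symm

/-- If `v` is not on the path to `u`, that path extended by the edge is the path to `v`, so `u` is
the parent of `v`; otherwise the roles are exchanged. The tree is thereby encoded by its parent map.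
-/
lemma adj_iff {u v : T.V} :
    T.G.Adj u v ↔ (v ≠ T.leg o ∧ T.par o v = u) ∨ (u ≠ T.leg o ∧ T.par o u = v) := by
  constructor
  · intro h
    by_cases hv : T.IsAnc o v u
    · have hu : ¬ T.IsAnc o u v := fun hu => h.ne (hu.antisymm hv)
      refine Or.inr ⟨?_, T.par_of_adj o h.symm hu⟩
      rintro rfl
      exact hu (T.root_isAnc o v)
    · refine Or.inl ⟨?_, T.par_of_adj o h hv⟩
      rintro rfl
      exact hv (T.root_isAnc o u)
  · rintro (⟨hv, rfl⟩ | ⟨hv, rfl⟩)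
    · exact T.adj_par o hv
    · exact (T.adj_par o hv).symm

/-- The bounded edge at the vertex `v` that leads towards the end `o`. -/
def parEdge (v : {v : T.V // v ≠ T.leg o}) : T.G.edgeSet := ⟨s(T.par o v, v), T.adj_par o v.2⟩

lemma parEdge_bijective : Function.Bijective (parEdge : {v : T.V // v ≠ T.leg o} → _) := by
  constructor
  · rintro ⟨v, hv⟩ ⟨w, hw⟩ h
    have h1 : s(T.par o v, v) = s(T.par o w, w) := congrArg Subtype.val h
    rw [Sym2.eq_iff] at h1
    rcases h1 with ⟨-, h1⟩ | ⟨h1, h2⟩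
    · exact Subtype.ext h1
    · have h3 := T.depth_par o hv
      have h4 := T.depth_par o hw
      rw [h1] at h3; rw [← h2] at h4
      omega
  · rintro ⟨e, he⟩
    induction e with
    | _ a b =>
      rcases (adj_iff (T := T) (u := a) (v := b) (o := o)).1 he with ⟨h, h'⟩ | ⟨h, h'⟩
      · exact ⟨⟨b, h⟩, Subtype.ext (show s(T.par o b, b) = s(a, b) by rw [h'])⟩
      · exact ⟨⟨a, h⟩, Subtype.ext (show s(T.par o a, a) = s(a, b) by rw [h', Sym2.eq_swap])⟩

variable (T o) in
/-- The bounded edges correspond to the vertices away from the end `o`. -/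
def edgeEquiv : {v : T.V // v ≠ T.leg o} ≃ T.G.edgeSet :=
  Equiv.ofBijective parEdge parEdge_bijective

@[simp] lemma edgeEquiv_coe (v : {v : T.V // v ≠ T.leg o}) :
    (T.edgeEquiv o v : Sym2 T.V) = s(T.par o v, v) := rfl

/-- A predicate on the vertices that is false at the root and changes exactly across the edge
below `v` is given by `IsAnc v`. -/
lemma isAnc_iff_of_forall {v : T.V} (P : T.V → Prop) (h0 : ¬ P (T.leg o))
    (hv : v ≠ T.leg o) (h1 : ¬ (P (T.par o v) ↔ P v))
    (h2 : ∀ w, w ≠ T.leg o → w ≠ v → (P (T.par o w) ↔ P w)) (u : T.V) :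
    P u ↔ T.IsAnc o v u := by
  induction u using T.par_induction o with
  | root => rw [isAnc_root_iff]; exact iff_of_false h0 hv
  | step u hu ih =>
    rw [isAnc_iff T o hu]
    by_cases huv : u = v
    · subst huv
      have := not_isAnc_par hu
      tauto
    · rw [← h2 u hu huv, ih]
      simp [Ne.symm huv]

/-! ### Which edges a path crosses. -/

lemma isAnc_iff_of_adj {x y : T.V} (h : T.G.Adj x y) {v : T.V}
    (hxy : s(x, y) ≠ s(T.par o v, v)) : T.IsAnc o v x ↔ T.IsAnc o v y := by
  rcases (adj_iff (o := o)).1 h with ⟨h', rfl⟩ | ⟨h', rfl⟩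
  · rw [isAnc_iff T o h']
    refine ⟨Or.inl, ?_⟩
    rintro (h1 | rfl)
    · exact h1
    · exact absurd rfl hxy
  · rw [isAnc_iff T o h']
    refine ⟨?_, Or.inl⟩
    rintro (h1 | rfl)
    · exact h1
    · exact absurd Sym2.eq_swap hxy

lemma isAnc_iff_of_walk {x y : T.V} (p : T.G.Walk x y) {v : T.V}
    (hp : s(T.par o v, v) ∉ p.edges) : T.IsAnc o v x ↔ T.IsAnc o v y := by
  induction p with
  | nil => rfl
  | cons h p ih =>
    rw [SimpleGraph.Walk.edges_cons, List.mem_cons, not_or] at hp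
    rw [isAnc_iff_of_adj h (Ne.symm hp.1), ih hp.2]

lemma exists_walk_of_not_isAnc {u v : T.V} (hv : v ≠ T.leg o) (h : ¬ T.IsAnc o v u) :
    ∃ p : T.G.Walk (T.leg o) u, s(T.par o v, v) ∉ p.edges := by
  induction u using T.par_induction o with
  | root => exact ⟨.nil, by simp⟩
  | step u hu ih =>
    rw [isAnc_iff T o hu, not_or] at h
    obtain ⟨p, hp⟩ := ih h.1
    refine ⟨p.concat (T.adj_par o hu), ?_⟩
    rw [SimpleGraph.Walk.edges_concat, List.concat_eq_append, List.mem_append, not_or]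
    refine ⟨hp, fun h1 => h.2 ?_⟩
    rw [List.mem_singleton] at h1
    exact congrArg Subtype.val ((edgeEquiv T o).injective
      (a₁ := ⟨v, hv⟩) (a₂ := ⟨u, hu⟩) (Subtype.ext h1))

lemma exists_walk_of_isAnc {u v : T.V} (hv : v ≠ T.leg o) (h : T.IsAnc o v u) :
    ∃ p : T.G.Walk v u, s(T.par o v, v) ∉ p.edges := by
  induction u using T.par_induction o with
  | root => rw [isAnc_root_iff] at h; exact absurd h hv
  | step u hu ih =>
    rcases (isAnc_iff T o hu).1 h with h1 | rfl
    · obtain ⟨p, hp⟩ := ih h1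
      refine ⟨p.concat (T.adj_par o hu), ?_⟩
      rw [SimpleGraph.Walk.edges_concat, List.concat_eq_append, List.mem_append, not_or]
      refine ⟨hp, fun h2 => ?_⟩
      rw [List.mem_singleton] at h2
      have : v = u := congrArg Subtype.val ((edgeEquiv T o).injective
        (a₁ := ⟨v, hv⟩) (a₂ := ⟨u, hu⟩) (Subtype.ext h2))
      subst this
      exact not_isAnc_par hu h1
    · exact ⟨.nil, by simp⟩

/-- Deleting the edge from `v` to its parent separates the descendants of `v` from the rest. Two
vertices on the same side are joined by a walk avoiding this edge, through `v` or through the root,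
and the path is a shortening of it; conversely a walk avoiding the edge cannot change sides. -/
lemma mem_edges_path_iff {u w : T.V} (v : {v : T.V // v ≠ T.leg o}) :
    (T.edgeEquiv o v : Sym2 T.V) ∈ (T.path u w).edges ↔
      ¬ (T.IsAnc o v u ↔ T.IsAnc o v w) := by
  classical
  obtain ⟨v, hv⟩ := v
  constructor
  · intro h h'
    have key : ∀ p : T.G.Walk u w, s(T.par o v, v) ∈ p.edges := fun p => by
      refine p.edges_bypass_subset_edges ?_
      rw [T.eq_path _ p.bypass_isPath]
      exact h
    by_cases h1 : T.IsAnc o v u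
    · obtain ⟨p, hp⟩ := exists_walk_of_isAnc hv h1
      obtain ⟨q, hq⟩ := exists_walk_of_isAnc hv (h'.1 h1)
      have := key (p.reverse.append q)
      simp [hp, hq] at this
    · obtain ⟨p, hp⟩ := exists_walk_of_not_isAnc hv h1
      obtain ⟨q, hq⟩ := exists_walk_of_not_isAnc hv (fun h2 => h1 (h'.2 h2))
      have := key (p.reverse.append q)
      simp [hp, hq] at this
  · intro h
    by_contra h'
    exact h (isAnc_iff_of_walk _ h')

/-! ### The sets of labels below the vertices -/

@[simp] lemma mem_below {v : T.V} {i : Fin N} : i ∈ T.below o v ↔ T.IsAnc o v (T.leg i) := by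
  simp [below]

lemma below_root : T.below o (T.leg o) = Finset.univ := by
  ext i; simp [root_isAnc]

lemma below_anti {u v : T.V} (h : T.IsAnc o u v) : T.below o v ⊆ T.below o u := fun _ hi =>
  mem_below.2 (h.trans (mem_below.1 hi))

lemma notMem_below {v : T.V} (hv : v ≠ T.leg o) : o ∉ T.below o v := by
  rw [mem_below, isAnc_root_iff]
  exact hv

/-- Of the edges and ends at a vertex, at least one is different from two given ones. -/
lemma exists_third (v : T.V) (x y : T.V ⊕ Fin N) :
    (∃ u, T.G.Adj v u ∧ .inl u ≠ x ∧ .inl u ≠ y) ∨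
      ∃ i, T.leg i = v ∧ .inr i ≠ x ∧ .inr i ≠ y := by
  by_contra! h
  have h3 := T.stable v
  have h1 : Sum.inl '' (T.G.neighborSet v) ∪ Sum.inr '' {i | T.leg i = v} ⊆ {x, y} := by
    rintro z (⟨u, hu, rfl⟩ | ⟨i, hi, rfl⟩)
    · by_cases hx : .inl u = x
      · exact Or.inl hx
      · exact Or.inr (h.1 u hu hx)
    · by_cases hx : .inr i = x
      · exact Or.inl hx
      · exact Or.inr (h.2 i hi hx)
  have h2 := Set.ncard_le_ncard h1 (Set.toFinite _)
  rw [Set.ncard_union_eq (by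
      rw [Set.disjoint_left]; rintro z ⟨u, -, rfl⟩ ⟨_, -, hi⟩; simp at hi) (Set.toFinite _)
      (Set.toFinite _),
    Set.ncard_image_of_injective _ Sum.inl_injective,
    Set.ncard_image_of_injective _ Sum.inr_injective] at h2
  have := Set.ncard_insert_le x {y}
  rw [Set.ncard_singleton] at this
  omega

lemma isAnc_of_adj {u v : T.V} (h : T.G.Adj v u) (hv : v ≠ T.leg o → u ≠ T.par o v) :
    u ≠ T.leg o ∧ T.par o u = v := by
  rcases (adj_iff (o := o)).1 h with h1 | ⟨h1, h2⟩
  · exact h1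
  · exact absurd h2.symm (hv h1)

lemma card_le_depth (v : T.V) : T.depth o v < Nat.card T.V := by
  have := Fintype.ofFinite T.V
  rw [Nat.card_eq_fintype_card]
  exact (T.path_isPath _ _).length_lt

/-- Apart from the parent edge, stability provides an end at `v` or a child. The descent to children
stops because the depth is bounded by the number of vertices. -/
lemma below_nonempty (v : T.V) : (T.below o v).Nonempty := by
  induction h : Nat.card T.V - T.depth o v using Nat.strong_induction_on generalizing v with
  | _ k ih =>
    rcases T.exists_third v (.inl (T.par o v)) (.inl (T.par o v)) with ⟨u, hu, h1, -⟩ | ⟨i, hi, -⟩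
    · obtain ⟨h2, h3⟩ := isAnc_of_adj (o := o) hu fun _ h4 => h1 (by rw [h4])
      have h4 := T.depth_par o h2
      have h5 := card_le_depth (o := o) u
      rw [h3] at h4
      exact (ih _ (by omega) u rfl).mono (below_anti (h3 ▸ par_isAnc h2))
    · exact ⟨i, by rw [mem_below, hi]; exact isAnc_refl _ _ _⟩

/-- Besides the edge to `u` and the parent edge (or the end `o`, at the root) there is a third edge
or end at `v`. A further child has a label below it, and different children share no labels. -/
lemma exists_mem_below_notMem {u v : T.V} (hu : u ≠ T.leg o) (h : T.par o u = v) :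
    ∃ i ∈ T.below o v, i ∉ T.below o u ∧ (v = T.leg o → i ≠ o) := by
  have hchild : ∀ c, c ≠ u → c ≠ T.leg o → T.par o c = v →
      ∃ i ∈ T.below o v, i ∉ T.below o u ∧ (v = T.leg o → i ≠ o) := by
    intro c hcu hc hcv
    obtain ⟨i, hi⟩ := below_nonempty (o := o) c
    refine ⟨i, below_anti (hcv ▸ par_isAnc hc) hi, fun hi' => ?_, ?_⟩
    · rcases (mem_below.1 hi).total (mem_below.1 hi') with h1 | h1
      · rcases (isAnc_iff T o hu).1 h1 with h2 | h2
        · rw [h, ← hcv] at h2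
          exact not_isAnc_par hc h2
        · exact hcu h2
      · rcases (isAnc_iff T o hc).1 h1 with h2 | h2
        · rw [hcv, ← h] at h2
          exact not_isAnc_par hu h2
        · exact hcu h2.symm
    · rintro - rfl
      exact notMem_below hc hi
  have hleg : ∀ i, T.leg i = v → i ∈ T.below o v ∧ i ∉ T.below o u := fun i hi => by
    rw [mem_below, mem_below, hi]
    exact ⟨isAnc_refl _ _ _, h ▸ not_isAnc_par hu⟩
  by_cases hv : v = T.leg o
  · rcases T.exists_third v (.inl u) (.inr o) with ⟨c, hc, h1, -⟩ | ⟨i, hi, -, h2⟩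
    · obtain ⟨h2, h3⟩ := isAnc_of_adj (o := o) hc fun h => absurd hv h
      exact hchild c (fun h => h1 (by rw [h])) h2 h3
    · exact ⟨i, (hleg i hi).1, (hleg i hi).2, fun _ h => h2 (by rw [h])⟩
  · rcases T.exists_third v (.inl u) (.inl (T.par o v)) with ⟨c, hc, h1, h2⟩ | ⟨i, hi, -⟩
    · obtain ⟨h2, h3⟩ := isAnc_of_adj (o := o) hc fun _ h => h2 (by rw [h])
      exact hchild c (fun h => h1 (by rw [h])) h2 h3
    · exact ⟨i, (hleg i hi).1, (hleg i hi).2, fun h => absurd h hv⟩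

lemma below_ssubset_par {v : T.V} (hv : v ≠ T.leg o) : T.below o v ⊂ T.below o (T.par o v) := by
  obtain ⟨i, h1, h2, -⟩ := exists_mem_below_notMem hv rfl
  exact (Finset.ssubset_iff_of_subset (below_anti (par_isAnc hv))).2 ⟨i, h1, h2⟩

lemma below_ssubset {u v : T.V} (h : T.IsAnc o u v) (huv : u ≠ v) :
    T.below o v ⊂ T.below o u := by
  have hv : v ≠ T.leg o := by
    rintro rfl
    exact huv ((isAnc_root_iff T o).1 h)
  rcases (isAnc_iff T o hv).1 h with h1 | h1
  · exact (below_ssubset_par hv).trans_subset (below_anti h1)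
  · exact absurd h1 huv

lemma isAnc_total_of_mem {u v : T.V} {i : Fin N} (hu : i ∈ T.below o u) (hv : i ∈ T.below o v) :
    T.IsAnc o u v ∨ T.IsAnc o v u :=
  (mem_below.1 hu).total (mem_below.1 hv)

/-- A common label makes `u` and `v` comparable, and the wrong order is excluded because label sets
shrink strictly on the way down. From here on vertices can be replaced by their label sets. -/
lemma isAnc_iff_below_subset {u v : T.V} : T.IsAnc o u v ↔ T.below o v ⊆ T.below o u := by
  refine ⟨below_anti, fun h => ?_⟩
  obtain ⟨i, hi⟩ := below_nonempty (o := o) v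
  rcases isAnc_total_of_mem (h hi) hi with h1 | h1
  · exact h1
  · by_cases huv : v = u
    · exact huv ▸ isAnc_refl _ _ _
    · exact absurd h (below_ssubset h1 huv).not_subset

lemma below_injective : Function.Injective (T.below o) := fun _ _ h =>
  (isAnc_iff_below_subset.2 h.ge).antisymm (isAnc_iff_below_subset.2 h.le)

lemma below_eq_univ_iff {v : T.V} : T.below o v = Finset.univ ↔ v = T.leg o := by
  rw [← below_root (T := T) (o := o), below_injective.eq_iff]

lemma below_laminar (u v : T.V) :
    T.below o u ⊆ T.below o v ∨ T.below o v ⊆ T.below o u ∨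
      Disjoint (T.below o u) (T.below o v) := by
  by_cases h : Disjoint (T.below o u) (T.below o v)
  · exact Or.inr (Or.inr h)
  · obtain ⟨i, hu, hv⟩ := Finset.not_disjoint_iff.1 h
    rcases isAnc_total_of_mem hu hv with h1 | h1
    · exact Or.inr (Or.inl (below_anti h1))
    · exact Or.inl (below_anti h1)

/-- A child has a strictly smaller non-empty set. Without children the parent edge is the only
bounded edge at `v`, so at least two ends are attached there. -/
lemma two_le_card_below {v : T.V} (hv : v ≠ T.leg o) : 2 ≤ (T.below o v).card := by
  by_cases hc : ∃ c, c ≠ T.leg o ∧ T.par o c = v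
  · obtain ⟨c, hc, rfl⟩ := hc
    have h1 := Finset.card_lt_card (below_ssubset_par hc)
    have h2 := (below_nonempty (T := T) (o := o) c).card_pos
    omega
  · have hn : ∀ u, T.G.Adj v u → u = T.par o v := fun u hu => by
      by_contra h
      exact hc ⟨u, isAnc_of_adj hu fun _ => h⟩
    have hex : ∀ x, ∃ i, T.leg i = v ∧ Sum.inr i ≠ x := fun x => by
      rcases T.exists_third v (.inl (T.par o v)) x with ⟨u, hu, h1, -⟩ | ⟨i, hi, -, h2⟩
      · exact absurd (by rw [hn u hu]) h1
      · exact ⟨i, hi, h2⟩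
    obtain ⟨i, hi, -⟩ := hex (.inl v)
    obtain ⟨j, hj, hij⟩ := hex (.inr i)
    refine Finset.one_lt_card.2 ⟨i, ?_, j, ?_, fun h => hij (by rw [h])⟩
    · rw [mem_below, hi]; exact isAnc_refl _ _ _
    · rw [mem_below, hj]; exact isAnc_refl _ _ _

lemma card_below_add_two_le {v : T.V} (hv : v ≠ T.leg o) : (T.below o v).card + 2 ≤ N := by
  induction v using T.par_induction o with
  | root => exact absurd rfl hv
  | step v _ ih =>
    by_cases hp : T.par o v = T.leg o
    · obtain ⟨i, -, h2, h3⟩ := exists_mem_below_notMem hv hp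
      have h4 : T.below o v ⊆ (Finset.univ.erase o).erase i := fun j hj => by
        simp only [Finset.mem_erase, Finset.mem_univ, and_true]
        exact ⟨fun h => h2 (h ▸ hj), fun h => notMem_below hv (h ▸ hj)⟩
      have h5 := Finset.card_le_card h4
      rw [Finset.card_erase_of_mem (by simp [h3 rfl]), Finset.card_erase_of_mem (by simp),
        Finset.card_univ, Fintype.card_fin] at h5
      have h6 := two_le_card_below hv
      omega
    · have := Finset.card_le_card (below_ssubset_par hv).subset
      have := ih hp
      omega

/-- The vertex at which the end `i` is attached is the lowest vertex above `i`. -/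
lemma eq_leg_iff {v : T.V} {i : Fin N} :
    v = T.leg i ↔ i ∈ T.below o v ∧ ∀ u, i ∈ T.below o u → T.below o v ⊆ T.below o u := by
  constructor
  · rintro rfl
    exact ⟨mem_below.2 (isAnc_refl _ _ _), fun u hu => below_anti (mem_below.1 hu)⟩
  · rintro ⟨h1, h2⟩
    exact (mem_below.1 h1).antisymm
      (isAnc_iff_below_subset.2 (h2 _ (mem_below.2 (isAnc_refl _ _ _))))

/-- Adjacency in terms of inclusions alone; together with `eq_leg_iff` this allows the tree to be
recovered from its clusters. -/
lemma eq_par_iff {u v : T.V} (hv : v ≠ T.leg o) :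
    u = T.par o v ↔ T.below o v ⊂ T.below o u ∧
      ∀ w, T.below o v ⊂ T.below o w → T.below o u ⊆ T.below o w := by
  constructor
  · rintro rfl
    refine ⟨below_ssubset_par hv, fun w hw => ?_⟩
    rcases (isAnc_iff T o hv).1 (isAnc_iff_below_subset.2 hw.subset) with h | rfl
    · exact below_anti h
    · exact absurd rfl hw.ne
  · rintro ⟨h1, h2⟩
    apply below_injective (o := o)
    apply (h2 _ (below_ssubset_par hv)).antisymm
    rcases (isAnc_iff T o hv).1 (isAnc_iff_below_subset.2 h1.subset) with h | rfl
    · exact below_anti h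
    · exact absurd rfl h1.ne

end TreeType

end TropModuli

end

noncomputable section

namespace TropModuli

/-! ### Hierarchies of clusters -/

variable {N : ℕ} {o : Fin N}

/-- A set of labels that does not contain `o`, and that has at least two elements and a complement
with at least two elements. -/
structure IsCluster (o : Fin N) (A : Finset (Fin N)) : Prop where
  notMem : o ∉ A
  two_le : 2 ≤ A.card
  card_le : A.card + 2 ≤ N

/-- The two sets are nested or disjoint. -/
def Compat (A B : Finset (Fin N)) : Prop := A ⊆ B ∨ B ⊆ A ∨ Disjoint A B

lemma Compat.symm {A B : Finset (Fin N)} (h : Compat A B) : Compat B A := by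
  rcases h with h | h | h
  · exact Or.inr (Or.inl h)
  · exact Or.inl h
  · exact Or.inr (Or.inr h.symm)

lemma Compat.refl (A : Finset (Fin N)) : Compat A A := Or.inl subset_rfl

/-- A set of pairwise nested or disjoint clusters. -/
structure IsHierarchy (o : Fin N) (L : Finset (Finset (Fin N))) : Prop where
  isCluster : ∀ A ∈ L, IsCluster o A
  compat : ∀ A ∈ L, ∀ B ∈ L, Compat A B

lemma IsHierarchy.mono {L L' : Finset (Finset (Fin N))} (h : IsHierarchy o L) (h' : L' ⊆ L) :
    IsHierarchy o L' :=
  ⟨fun A hA => h.isCluster A (h' hA), fun A hA B hB => h.compat A (h' hA) B (h' hB)⟩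

lemma isHierarchy_empty : IsHierarchy o ∅ := ⟨by simp, by simp⟩

lemma IsHierarchy.insert_cluster {L : Finset (Finset (Fin N))} (h : IsHierarchy o L)
    {S : Finset (Fin N)} (hS : IsCluster o S) (hc : ∀ A ∈ L, Compat S A) :
    IsHierarchy o (insert S L) := by
  refine ⟨fun A hA => ?_, fun A hA B hB => ?_⟩
  · rcases Finset.mem_insert.1 hA with rfl | hA
    · exact hS
    · exact h.isCluster A hA
  · rcases Finset.mem_insert.1 hA with rfl | hA'
    · rcases Finset.mem_insert.1 hB with rfl | hB'
      · exact Compat.refl _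
      · exact hc B hB'
    · rcases Finset.mem_insert.1 hB with rfl | hB'
      · exact (hc A hA').symm
      · exact h.compat A hA' B hB'

/-- The smallest member of `L ∪ {univ}` that strictly contains `A`. -/
def up (L : Finset (Finset (Fin N))) (A : Finset (Fin N)) : Finset (Fin N) :=
  ((insert Finset.univ L).filter (A ⊂ ·)).inf id

variable (o) in
/-- The hierarchy `L` together with the set of all labels and the singletons other than `{o}`. -/
def full (L : Finset (Finset (Fin N))) : Finset (Finset (Fin N)) :=
  insert Finset.univ L ∪ (Finset.univ.erase o).image singleton

variable (o) in
/-- The maximal members of `full o L` that are strictly contained in `A`. -/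
def children (L : Finset (Finset (Fin N))) (A : Finset (Fin N)) : Finset (Finset (Fin N)) :=
  ((full o L).erase Finset.univ).filter (up L · = A)

namespace IsHierarchy

variable {L : Finset (Finset (Fin N))} (hL : IsHierarchy o L)
include hL

lemma compat_univ {A B : Finset (Fin N)} (hA : A ∈ insert Finset.univ L)
    (hB : B ∈ insert Finset.univ L) : Compat A B := by
  rcases Finset.mem_insert.1 hA with rfl | hA
  · exact Or.inr (Or.inl (Finset.subset_univ _))
  · rcases Finset.mem_insert.1 hB with rfl | hB
    · exact Or.inl (Finset.subset_univ _)
    · exact hL.compat A hA B hB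

/-- The members strictly containing `A` share the points of `A`, so they are pairwise nested and one
of least cardinality lies in all others. The infimum defining `up` is therefore attained. -/
lemma up_spec {A : Finset (Fin N)} (hA : A.Nonempty) (hA' : A ≠ Finset.univ) :
    up L A ∈ insert Finset.univ L ∧ A ⊂ up L A ∧
      ∀ B ∈ insert Finset.univ L, A ⊂ B → up L A ⊆ B := by
  obtain ⟨M, hM, hmin⟩ := Finset.exists_min_image ((insert Finset.univ L).filter (A ⊂ ·))
    Finset.card ⟨Finset.univ, by
      rw [Finset.mem_filter]
      exact ⟨Finset.mem_insert_self _ _, Finset.ssubset_univ_iff.2 hA'⟩⟩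
  have hM' := Finset.mem_filter.1 hM
  have key : ∀ B ∈ (insert Finset.univ L).filter (A ⊂ ·), M ⊆ B := fun B hB => by
    have hB' := Finset.mem_filter.1 hB
    rcases hL.compat_univ hM'.1 hB'.1 with h | h | h
    · exact h
    · exact (Finset.eq_of_subset_of_card_le h (hmin B hB)).ge
    · obtain ⟨i, hi⟩ := hA
      exact absurd h (Finset.not_disjoint_iff.2 ⟨i, hM'.2.subset hi, hB'.2.subset hi⟩)
  have : up L A = M := le_antisymm (Finset.inf_le (f := id) hM) (Finset.le_inf key)
  rw [this]
  exact ⟨hM'.1, hM'.2, fun B hB h => key B (Finset.mem_filter.2 ⟨hB, h⟩)⟩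

omit hL in
lemma mem_full {A : Finset (Fin N)} :
    A ∈ full o L ↔ A = Finset.univ ∨ A ∈ L ∨ ∃ i, i ≠ o ∧ A = {i} := by
  simp [full, eq_comm]

omit hL in
lemma mem_full_of_mem {A : Finset (Fin N)} (h : A ∈ insert Finset.univ L) : A ∈ full o L :=
  Finset.mem_union_left _ h

lemma nonempty_of_mem_full {A : Finset (Fin N)} (h : A ∈ full o L) : A.Nonempty := by
  rcases mem_full.1 h with rfl | h | ⟨i, -, rfl⟩
  · exact ⟨o, Finset.mem_univ _⟩
  · have := (hL.isCluster A h).two_le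
    exact Finset.card_pos.1 (by omega)
  · simp

lemma notMem_of_mem_full {A : Finset (Fin N)} (h : A ∈ full o L) (hA : A ≠ Finset.univ) :
    o ∉ A := by
  rcases mem_full.1 h with rfl | h | ⟨i, hi, rfl⟩
  · exact absurd rfl hA
  · exact (hL.isCluster A h).notMem
  · simpa using hi.symm

lemma compat_full {A B : Finset (Fin N)} (hA : A ∈ full o L) (hB : B ∈ full o L) :
    Compat A B := by
  have hs : ∀ (i : Fin N) (C : Finset (Fin N)), Compat {i} C := fun i C => by
    by_cases h : i ∈ C
    · exact Or.inl (by simpa using h)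
    · exact Or.inr (Or.inr (by simpa using h))
  rcases Finset.mem_union.1 hA with hA' | hA'
  · rcases Finset.mem_union.1 hB with hB' | hB'
    · exact hL.compat_univ hA' hB'
    · obtain ⟨i, -, rfl⟩ := Finset.mem_image.1 hB'
      exact (hs i A).symm
  · obtain ⟨i, -, rfl⟩ := Finset.mem_image.1 hA'
    exact hs i B

omit hL in
lemma mem_insert_of_ssubset {A B : Finset (Fin N)} (hA : A.Nonempty) (hB : B ∈ full o L)
    (h : A ⊂ B) : B ∈ insert Finset.univ L := by
  rcases mem_full.1 hB with rfl | hB | ⟨i, -, rfl⟩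
  · exact Finset.mem_insert_self _ _
  · exact Finset.mem_insert_of_mem hB
  · rw [Finset.ssubset_singleton_iff] at h
    exact absurd h hA.ne_empty

omit hL in
lemma mem_children {A B : Finset (Fin N)} :
    B ∈ children o L A ↔ B ∈ full o L ∧ B ≠ Finset.univ ∧ up L B = A := by
  simp only [children, Finset.mem_filter, Finset.mem_erase]
  tauto

lemma child_ssubset {A B : Finset (Fin N)} (h : B ∈ children o L A) : B ⊂ A := by
  obtain ⟨h1, h2, rfl⟩ := mem_children.1 h
  exact (hL.up_spec (hL.nonempty_of_mem_full h1) h2).2.1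

/-- A member of the hierarchy that strictly contains a child of `A` contains `A`. -/
lemma subset_of_child_ssubset {A B C : Finset (Fin N)} (h : B ∈ children o L A)
    (hC : C ∈ full o L) (hBC : B ⊂ C) : A ⊆ C := by
  obtain ⟨h1, h2, rfl⟩ := mem_children.1 h
  exact (hL.up_spec (hL.nonempty_of_mem_full h1) h2).2.2 C
    (mem_insert_of_ssubset (hL.nonempty_of_mem_full h1) hC hBC) hBC

lemma children_disjoint {A B C : Finset (Fin N)} (hB : B ∈ children o L A)
    (hC : C ∈ children o L A) (h : B ≠ C) : Disjoint B C := by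
  rcases hL.compat_full (mem_children.1 hB).1 (mem_children.1 hC).1 with h1 | h1 | h1
  · exact absurd (hL.subset_of_child_ssubset hB (mem_children.1 hC).1 (h1.ssubset_of_ne h))
      (hL.child_ssubset hC).not_subset
  · exact absurd (hL.subset_of_child_ssubset hC (mem_children.1 hB).1 (h1.ssubset_of_ne h.symm))
      (hL.child_ssubset hB).not_subset
  · exact h1

variable (hN : 3 ≤ N)
include hN

lemma card_add_two_le {A : Finset (Fin N)} (h : A ∈ full o L) (hA : A ≠ Finset.univ) :
    A.card + 2 ≤ N := by
  rcases mem_full.1 h with rfl | h | ⟨i, hi, rfl⟩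
  · exact absurd rfl hA
  · exact (hL.isCluster A h).card_le
  · simpa using hN

omit hN in
lemma exists_mem_notMem_of_card {A B : Finset (Fin N)} (hA : A ∈ insert Finset.univ L)
    (hB : B.card + 2 ≤ N) (hAB : B ⊂ A) : ∃ j ∈ A, j ≠ o ∧ j ∉ B := by
  rcases Finset.mem_insert.1 hA with rfl | hA
  · have : (insert o B).card < (Finset.univ : Finset (Fin N)).card := by
      have := Finset.card_insert_le o B
      rw [Finset.card_univ, Fintype.card_fin]
      omega
    obtain ⟨j, hj, hj'⟩ := Finset.exists_mem_notMem_of_card_lt_card this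
    rw [Finset.mem_insert, not_or] at hj'
    exact ⟨j, hj, hj'.1, hj'.2⟩
  · obtain ⟨j, hj, hj'⟩ := Finset.exists_of_ssubset hAB
    exact ⟨j, hj, fun h => (hL.isCluster A hA).notMem (h ▸ hj), hj'⟩

lemma exists_mem_notMem {A B : Finset (Fin N)} (hA : A ∈ insert Finset.univ L)
    (hB : B ∈ full o L) (hAB : B ⊂ A) : ∃ j ∈ A, j ≠ o ∧ j ∉ B := by
  refine hL.exists_mem_notMem_of_card hA (hL.card_add_two_le hN hB ?_) hAB
  rintro rfl
  exact hAB.not_subset (Finset.subset_univ _)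

/-- A largest member of `full o L` strictly inside `A` and containing `i` is a child; the singletons
in `full` ensure that there is one. With `children_disjoint`, the children partition `A` without
`o`. -/
lemma exists_child {A : Finset (Fin N)} (hA : A ∈ insert Finset.univ L) {i : Fin N} (hi : i ∈ A)
    (hio : i ≠ o) : ∃ B ∈ children o L A, i ∈ B := by
  have h2 : 2 ≤ A.card := by
    rcases Finset.mem_insert.1 hA with rfl | hA
    · rw [Finset.card_univ, Fintype.card_fin]; omega
    · exact (hL.isCluster A hA).two_le
  obtain ⟨M, hM, hmax⟩ := Finset.exists_max_image
    ((full o L).filter fun B => i ∈ B ∧ B ⊂ A) Finset.card ⟨{i}, by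
      simp only [Finset.mem_filter, Finset.mem_singleton, true_and]
      refine ⟨mem_full.2 (Or.inr (Or.inr ⟨i, hio, rfl⟩)), ?_⟩
      refine Finset.ssubset_of_subset_of_ssubset subset_rfl
        ((Finset.singleton_subset_iff.2 hi).ssubset_of_ne ?_)
      rintro rfl
      simp at h2⟩
  simp only [Finset.mem_filter] at hM hmax
  obtain ⟨hMf, hiM, hMA⟩ := hM
  have hMu : M ≠ Finset.univ := by
    rintro rfl
    exact hMA.not_subset (Finset.subset_univ _)
  obtain ⟨u1, u2, u3⟩ := hL.up_spec ⟨i, hiM⟩ hMu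
  refine ⟨M, mem_children.2 ⟨hMf, hMu, ?_⟩, hiM⟩
  by_contra hne
  have := hmax (up L M) ⟨mem_full_of_mem u1, u2.subset hiM,
    (u3 A hA hMA).ssubset_of_ne hne⟩
  have := Finset.card_lt_card u2
  omega

lemma exists_two_children {A : Finset (Fin N)} (hA : A ∈ insert Finset.univ L) :
    ∃ B ∈ children o L A, ∃ C ∈ children o L A, B ≠ C := by
  obtain ⟨i, hi, hio, -⟩ : ∃ j ∈ A, j ≠ o ∧ j ∉ (∅ : Finset (Fin N)) := by
    refine hL.exists_mem_notMem_of_card hA (by simp; omega) ?_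
    exact (hL.nonempty_of_mem_full (mem_full_of_mem hA)).empty_ssubset
  obtain ⟨B, hB, hiB⟩ := hL.exists_child hN hA hi hio
  obtain ⟨j, hj, hjo, hjB⟩ := hL.exists_mem_notMem hN hA (mem_children.1 hB).1
    (hL.child_ssubset hB)
  obtain ⟨C, hC, hjC⟩ := hL.exists_child hN hA hj hjo
  exact ⟨B, hB, C, hC, fun h => hjB (h ▸ hjC)⟩

lemma two_le_card_children {A : Finset (Fin N)} (hA : A ∈ insert Finset.univ L) :
    2 ≤ (children o L A).card := by
  obtain ⟨B, hB, C, hC, h⟩ := hL.exists_two_children hN hA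
  exact Finset.one_lt_card.2 ⟨B, hB, C, hC, h⟩

omit hN in
lemma univ_notMem : Finset.univ ∉ L := fun h => by
  have := (hL.isCluster _ h).card_le
  rw [Finset.card_univ, Fintype.card_fin] at this
  omega

/-! ### Counting children: the dimension of hierarchies and their extensions. -/

lemma card_full_erase : ((full o L).erase Finset.univ).card + 1 = L.card + N := by
  have h1 : (full o L).erase Finset.univ = L ∪ (Finset.univ.erase o).image singleton := by
    ext A
    simp only [Finset.mem_erase, full, Finset.mem_union, Finset.mem_insert]
    constructor
    · tauto
    · rintro (h | h)
      · exact ⟨fun h' => hL.univ_notMem (h' ▸ h), Or.inl (Or.inr h)⟩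
      · refine ⟨?_, Or.inr h⟩
        rintro rfl
        obtain ⟨i, -, hi⟩ := Finset.mem_image.1 h
        have := congrArg Finset.card hi
        rw [Finset.card_singleton, Finset.card_univ, Fintype.card_fin] at this
        omega
  rw [h1, Finset.card_union_of_disjoint, Finset.card_image_of_injective _
    Finset.singleton_injective, Finset.card_erase_of_mem (Finset.mem_univ _), Finset.card_univ,
    Fintype.card_fin]
  · omega
  · rw [Finset.disjoint_left]
    intro A hA hA'
    obtain ⟨i, -, rfl⟩ := Finset.mem_image.1 hA'
    have := (hL.isCluster _ hA).two_le
    simp at this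

lemma sum_card_children :
    ∑ A ∈ insert Finset.univ L, (children o L A).card + 1 = L.card + N := by
  rw [← hL.card_full_erase hN, Finset.card_eq_sum_card_fiberwise (f := up L)
    (t := insert Finset.univ L)]
  · rfl
  · intro A hA
    have hA := Finset.mem_erase.1 (Finset.mem_coe.1 hA)
    exact (hL.up_spec (hL.nonempty_of_mem_full hA.2) hA.1).1

/-- The vertex of `A` has one edge or end more than it has children, so each summand is the excess
of its valence over three. The total excess is `N - 3` minus the number of bounded edges. -/
lemma sum_card_children_sub :
    ∑ A ∈ insert Finset.univ L, ((children o L A).card - 2) + (L.card + 3) = N := by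
  have h1 := hL.sum_card_children hN
  have h2 : ∑ A ∈ insert Finset.univ L, (children o L A).card =
      ∑ A ∈ insert Finset.univ L, ((children o L A).card - 2) + (L.card + 1) * 2 := by
    rw [← Finset.card_insert_of_notMem (hL.univ_notMem), ← smul_eq_mul, ← Finset.sum_const,
      ← Finset.sum_add_distrib]
    refine Finset.sum_congr rfl fun A hA => ?_
    have := hL.two_le_card_children hN hA
    omega
  omega

/-- A hierarchy has at most `N - 3` members. -/
lemma card_add_three_le : L.card + 3 ≤ N := by
  have := hL.sum_card_children_sub hN
  omega

omit hN in
/-- The union of two out of at least three children can be added to the hierarchy. -/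
lemma insert_union {A B C D : Finset (Fin N)} (hB : B ∈ children o L A)
    (hC : C ∈ children o L A) (hD : D ∈ children o L A) (hBC : B ≠ C) (hBD : B ≠ D)
    (hCD : C ≠ D) : B ∪ C ∉ L ∧ IsHierarchy o (insert (B ∪ C) L) := by
  have dBC := hL.children_disjoint hB hC hBC
  have dD : Disjoint (B ∪ C) D := Finset.disjoint_union_left.2
    ⟨hL.children_disjoint hB hD hBD, hL.children_disjoint hC hD hCD⟩
  have nB := hL.nonempty_of_mem_full (mem_children.1 hB).1
  have nC := hL.nonempty_of_mem_full (mem_children.1 hC).1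
  have nD := hL.nonempty_of_mem_full (mem_children.1 hD).1
  have oB := hL.notMem_of_mem_full (mem_children.1 hB).1 (mem_children.1 hB).2.1
  have oC := hL.notMem_of_mem_full (mem_children.1 hC).1 (mem_children.1 hC).2.1
  have oD := hL.notMem_of_mem_full (mem_children.1 hD).1 (mem_children.1 hD).2.1
  have sB := hL.child_ssubset hB
  have sC := hL.child_ssubset hC
  have sD := hL.child_ssubset hD
  constructor
  · intro h
    have h1 : A ⊆ B ∪ C := by
      refine hL.subset_of_child_ssubset hB (mem_full.2 (Or.inr (Or.inl h)))
        (Finset.subset_union_left.ssubset_of_ne fun h2 => ?_)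
      obtain ⟨i, hi⟩ := nC
      exact Finset.disjoint_left.1 dBC (h2 ▸ Finset.mem_union_right _ hi) hi
    obtain ⟨i, hi⟩ := nD
    exact Finset.disjoint_left.1 dD (h1 (sD.subset hi)) hi
  · refine hL.insert_cluster ⟨by simp [oB, oC], ?_, ?_⟩ fun E hE => ?_
    · rw [Finset.card_union_of_disjoint dBC]
      have := nB.card_pos
      have := nC.card_pos
      omega
    -- The end `o` and a label of the third child `D` are the two labels required outside `B ∪ C`.
    · have h1 : (insert o ((B ∪ C) ∪ D)).card ≤ N := by
        have := Finset.card_le_univ (insert o ((B ∪ C) ∪ D))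
        rwa [Fintype.card_fin] at this
      rw [Finset.card_insert_of_notMem (by simp [oB, oC, oD]),
        Finset.card_union_of_disjoint dD] at h1
      have := nD.card_pos
      omega
    · have hE' : E ∈ full o L := mem_full.2 (Or.inr (Or.inl hE))
      have key : ∀ F ∈ children o L A, B ∪ C ⊆ E ∨ E ⊆ F ∨ Disjoint F E := fun F hF => by
        rcases hL.compat_full (mem_children.1 hF).1 hE' with h | h | h
        · by_cases h' : F = E
          · exact Or.inr (Or.inl h'.ge)
          · exact Or.inl ((Finset.union_subset sB.subset sC.subset).trans
              (hL.subset_of_child_ssubset hF hE' (h.ssubset_of_ne h')))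
        · exact Or.inr (Or.inl h)
        · exact Or.inr (Or.inr h)
      rcases key B hB with h | h | h
      · exact Or.inl h
      · exact Or.inr (Or.inl (h.trans Finset.subset_union_left))
      · rcases key C hC with h' | h' | h'
        · exact Or.inl h'
        · exact Or.inr (Or.inl (h'.trans Finset.subset_union_right))
        · exact Or.inr (Or.inr (Finset.disjoint_union_left.2 ⟨h, h'⟩))

/-- A hierarchy with fewer than `N - 3` members can be extended. -/
lemma exists_insert (h : L.card + 3 < N) : ∃ S ∉ L, IsHierarchy o (insert S L) := by
  have h1 := hL.sum_card_children_sub hN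
  obtain ⟨A, hA, hA'⟩ : ∃ A ∈ insert Finset.univ L, (children o L A).card - 2 ≠ 0 := by
    by_contra! h2
    rw [Finset.sum_eq_zero h2] at h1
    omega
  obtain ⟨B, C, D, hB, hC, hD, hBC, hBD, hCD⟩ :=
    Finset.two_lt_card_iff.1 (show 2 < (children o L A).card by omega)
  exact ⟨_, hL.insert_union hB hC hD hBC hBD hCD⟩

omit hN in
/-- A cluster that can be added to the hierarchy is a union of children of a member. -/
lemma child_subset_or_disjoint {S : Finset (Fin N)} (hS : S ∉ L)
    (h : IsHierarchy o (insert S L)) {B : Finset (Fin N)}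
    (hB : B ∈ children o L (up L S)) : B ⊆ S ∨ Disjoint B S := by
  have hSc := h.isCluster S (Finset.mem_insert_self _ _)
  have hSn : S.Nonempty := Finset.card_pos.1 (by have := hSc.two_le; omega)
  have hSu : S ≠ Finset.univ := by
    rintro rfl
    exact hSc.notMem (Finset.mem_univ _)
  have hBf := (mem_children.1 hB).1
  have hBf' : B ∈ full o (insert S L) := by
    rw [mem_full] at hBf ⊢
    rcases hBf with h | h | h
    · exact Or.inl h
    · exact Or.inr (Or.inl (Finset.mem_insert_of_mem h))
    · exact Or.inr (Or.inr h)
  rcases h.compat_full hBf' (mem_full.2 (Or.inr (Or.inl (Finset.mem_insert_self _ _))))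
    with h1 | h1 | h1
  · exact Or.inl h1
  · have h2 : S ≠ B := by
      rintro rfl
      rcases mem_full.1 hBf with h2 | h2 | ⟨i, -, h2⟩
      · exact hSu h2
      · exact hS h2
      · have := hSc.two_le
        rw [h2] at this
        simp at this
    have h3 := h1.ssubset_of_ne h2
    exact absurd ((hL.up_spec hSn hSu).2.2 B (mem_insert_of_ssubset hSn hBf h3) h3)
      (hL.child_ssubset hB).not_subset
  · exact Or.inr h1

/-- A hierarchy with `N - 4` members can be extended in exactly three ways. -/
lemma exists_three (h : L.card + 4 = N) :
    ∃ A ∈ insert Finset.univ L, ∃ B C D : Finset (Fin N),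
      B ∈ full o L ∧ C ∈ full o L ∧ D ∈ full o L ∧
      B ≠ Finset.univ ∧ C ≠ Finset.univ ∧ D ≠ Finset.univ ∧
      Disjoint B C ∧ Disjoint B D ∧ Disjoint C D ∧ A.erase o = B ∪ C ∪ D ∧
      B ∪ C ≠ B ∪ D ∧ B ∪ C ≠ C ∪ D ∧ B ∪ D ≠ C ∪ D ∧
      ∀ S, (S ∉ L ∧ IsHierarchy o (insert S L)) ↔
        S ∈ ({B ∪ C, B ∪ D, C ∪ D} : Finset (Finset (Fin N))) := by
  have h1 := hL.sum_card_children_sub hN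
  have h2 : ∑ A ∈ insert Finset.univ L, ((children o L A).card - 2) = 1 := by omega
  -- The total excess is one: exactly one vertex `A` is four-valent, and all others are trivalent.
  obtain ⟨A, hA, hA1, hA2⟩ : ∃ A ∈ insert Finset.univ L, (children o L A).card = 3 ∧
      ∀ A' ∈ insert Finset.univ L, A' ≠ A → (children o L A').card = 2 := by
    obtain ⟨A, hA, hA'⟩ : ∃ A ∈ insert Finset.univ L, (children o L A).card - 2 ≠ 0 := by
      by_contra! h2
      rw [Finset.sum_eq_zero h2] at h1
      omega
    rw [← Finset.add_sum_erase _ _ hA] at h2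
    refine ⟨A, hA, by omega, fun A' hA' hne => ?_⟩
    have h3 := Finset.sum_eq_zero_iff.1 (show ∑ A' ∈ (insert Finset.univ L).erase A,
      ((children o L A').card - 2) = 0 by omega) A' (Finset.mem_erase.2 ⟨hne, hA'⟩)
    have := hL.two_le_card_children hN hA'
    omega
  obtain ⟨B, C, D, hBC, hBD, hCD, hch⟩ := Finset.card_eq_three.1 hA1
  have hB : B ∈ children o L A := by simp [hch]
  have hC : C ∈ children o L A := by simp [hch]
  have hD : D ∈ children o L A := by simp [hch]
  have dBC := hL.children_disjoint hB hC hBC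
  have dBD := hL.children_disjoint hB hD hBD
  have dCD := hL.children_disjoint hC hD hCD
  obtain ⟨b, hb⟩ := hL.nonempty_of_mem_full (mem_children.1 hB).1
  obtain ⟨c, hc⟩ := hL.nonempty_of_mem_full (mem_children.1 hC).1
  obtain ⟨d, hd⟩ := hL.nonempty_of_mem_full (mem_children.1 hD).1
  have hcov : ∀ i ∈ A, i ≠ o → i ∈ B ∨ i ∈ C ∨ i ∈ D := fun i hi hio => by
    obtain ⟨E, hE, hiE⟩ := hL.exists_child hN hA hi hio
    rw [hch] at hE
    simp only [Finset.mem_insert, Finset.mem_singleton] at hE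
    rcases hE with rfl | rfl | rfl <;> tauto
  have hbC := Finset.disjoint_left.1 dBC hb
  have hbD := Finset.disjoint_left.1 dBD hb
  have hcD := Finset.disjoint_left.1 dCD hc
  have hcB := Finset.disjoint_right.1 dBC hc
  have hdB := Finset.disjoint_right.1 dBD hd
  have hdC := Finset.disjoint_right.1 dCD hd
  refine ⟨A, hA, B, C, D, (mem_children.1 hB).1, (mem_children.1 hC).1, (mem_children.1 hD).1,
    (mem_children.1 hB).2.1, (mem_children.1 hC).2.1, (mem_children.1 hD).2.1,
    dBC, dBD, dCD, ?_, ?_, ?_, ?_, fun S => ⟨?_, ?_⟩⟩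
  · ext i
    simp only [Finset.mem_erase, Finset.mem_union]
    constructor
    · rintro ⟨h3, h4⟩
      have := hcov i h4 h3
      tauto
    · have key : ∀ E ∈ children o L A, i ∈ E → i ≠ o ∧ i ∈ A := fun E hE hi => by
        refine ⟨?_, (hL.child_ssubset hE).subset hi⟩
        rintro rfl
        exact hL.notMem_of_mem_full (mem_children.1 hE).1 (mem_children.1 hE).2.1 hi
      rintro ((h | h) | h)
      · exact key B hB h
      · exact key C hC h
      · exact key D hD h
  · intro h
    have : c ∈ B ∪ D := h ▸ Finset.mem_union_right _ hc
    simp [hcB, hcD] at this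
  · intro h
    have : b ∈ C ∪ D := h ▸ Finset.mem_union_left _ hb
    simp [hbC, hbD] at this
  · intro h
    have : b ∈ C ∪ D := h ▸ Finset.mem_union_left _ hb
    simp [hbC, hbD] at this
  · rintro ⟨hS, hSL⟩
    have hSc := hSL.isCluster S (Finset.mem_insert_self _ _)
    have hSn : S.Nonempty := Finset.card_pos.1 (by have := hSc.two_le; omega)
    have hSu : S ≠ Finset.univ := by
      rintro rfl
      exact hSc.notMem (Finset.mem_univ _)
    obtain ⟨u1, u2, u3⟩ := hL.up_spec hSn hSu
    obtain ⟨i, hi⟩ := hSn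
    have hio : i ≠ o := fun h => hSc.notMem (h ▸ hi)
    -- `S` is a union of children of `up L S`. It contains two of them, `E` and `F`, and misses a
    -- third, `G`; since only `A` has three children, `up L S = A` and `S = E ∪ F`.
    have hcs := fun E (hE : E ∈ children o L (up L S)) =>
      hL.child_subset_or_disjoint hS hSL hE
    obtain ⟨E, hE, hiE⟩ := hL.exists_child hN u1 (u2.subset hi) hio
    have hES : E ⊆ S := (hcs E hE).resolve_right fun h => Finset.disjoint_left.1 h hiE hi
    have hES' : E ≠ S := by
      rintro rfl
      rcases mem_full.1 (mem_children.1 hE).1 with h3 | h3 | ⟨i, -, h3⟩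
      · exact hSu h3
      · exact hS h3
      · have := hSc.two_le
        rw [h3] at this
        simp at this
    obtain ⟨j, hj, hjE⟩ := Finset.exists_of_ssubset (hES.ssubset_of_ne hES')
    have hjo : j ≠ o := fun h => hSc.notMem (h ▸ hj)
    obtain ⟨F, hF, hjF⟩ := hL.exists_child hN u1 (u2.subset hj) hjo
    have hFS : F ⊆ S := (hcs F hF).resolve_right fun h => Finset.disjoint_left.1 h hjF hj
    obtain ⟨k, hk, hko, hkS⟩ := hL.exists_mem_notMem_of_card u1 hSc.card_le u2
    obtain ⟨G, hG, hkG⟩ := hL.exists_child hN u1 hk hko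
    have hGS : Disjoint G S := (hcs G hG).resolve_left fun h => hkS (h hkG)
    have hEF : E ≠ F := fun h => hjE (h ▸ hjF)
    have hEG : E ≠ G := fun h => hkS (hES (h ▸ hkG))
    have hFG : F ≠ G := fun h => hkS (hFS (h ▸ hkG))
    have hAS : up L S = A := by
      by_contra hne
      have h3 := hA2 _ u1 hne
      have h4 := Finset.two_lt_card_iff.2 ⟨E, F, G, hE, hF, hG, hEF, hEG, hFG⟩
      omega
    rw [hAS] at hE hF hG
    have hSEF : S = E ∪ F := by
      refine (Finset.union_subset hES hFS).antisymm' fun x hx => ?_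
      have hxo : x ≠ o := fun h => hSc.notMem (h ▸ hx)
      obtain ⟨K, hK, hxK⟩ := hL.exists_child hN hA (hAS ▸ u2.subset hx) hxo
      have hKG : K ≠ G := fun h => Finset.disjoint_left.1 hGS (h ▸ hxK) hx
      rw [Finset.mem_union]
      by_cases hKE : K = E
      · exact Or.inl (hKE ▸ hxK)
      · right
        by_contra hxF
        have hKF : K ≠ F := fun h => hxF (h ▸ hxK)
        have : ({E, F, G, K} : Finset (Finset (Fin N))) ⊆ children o L A := by
          intro Z hZ
          simp only [Finset.mem_insert, Finset.mem_singleton] at hZ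
          rcases hZ with rfl | rfl | rfl | rfl <;> assumption
        have h5 := Finset.card_le_card this
        rw [hA1, Finset.card_insert_of_notMem (by simp [hEF, hEG, Ne.symm hKE]),
          Finset.card_insert_of_notMem (by simp [hFG, Ne.symm hKF]),
          Finset.card_insert_of_notMem (by simp [Ne.symm hKG]), Finset.card_singleton] at h5
        omega
    rw [hch] at hE hF
    simp only [Finset.mem_insert, Finset.mem_singleton] at hE hF ⊢
    rcases hE with rfl | rfl | rfl <;> rcases hF with rfl | rfl | rfl <;>
      first | exact absurd rfl hEF | (rw [hSEF]; simp [Finset.union_comm])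
  · intro hS
    simp only [Finset.mem_insert, Finset.mem_singleton] at hS
    rcases hS with rfl | rfl | rfl
    · exact hL.insert_union hB hC hD hBC hBD hCD
    · exact hL.insert_union hB hD hC hBD hBC hCD.symm
    · exact hL.insert_union hC hD hB hCD hBC.symm hBD.symm

/-- Three labels that are told apart by only one member of the hierarchy. -/
lemma exists_separating {A : Finset (Fin N)} (hA : A ∈ L) :
    ∃ i j k, i ∈ A ∧ j ∈ A ∧ k ∉ A ∧ i ≠ o ∧ j ≠ o ∧ k ≠ o ∧ i ≠ j ∧
      (∀ B ∈ L, B ≠ A → i ∈ B → (j ∈ B ↔ k ∈ B)) := by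
  have hA' : A ∈ insert Finset.univ L := Finset.mem_insert_of_mem hA
  have hAc := hL.isCluster A hA
  have hAn := hL.nonempty_of_mem_full (mem_full_of_mem hA')
  have hAu : A ≠ Finset.univ := by
    rintro rfl
    exact hAc.notMem (Finset.mem_univ _)
  obtain ⟨i, hi⟩ := hAn
  have hio : i ≠ o := fun h => hAc.notMem (h ▸ hi)
  -- `i` and `j` are taken from different children of `A`, and `k` from the parent of `A` outside
  -- `A`. A member other than `A` that contains `i` either strictly contains `A`, hence also `j` and
  -- `k`, or lies in the child of `i` and misses both.
  obtain ⟨C, hC, hiC⟩ := hL.exists_child hN hA' hi hio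
  obtain ⟨j, hj, hjo, hjC⟩ := hL.exists_mem_notMem hN hA' (mem_children.1 hC).1
    (hL.child_ssubset hC)
  obtain ⟨u1, u2, u3⟩ := hL.up_spec ⟨i, hi⟩ hAu
  obtain ⟨k, hk, hko, hkA⟩ := hL.exists_mem_notMem hN u1 (mem_full_of_mem hA') u2
  refine ⟨i, j, k, hi, hj, hkA, hio, hjo, hko, fun h => hjC (h ▸ hiC), fun B hB hBA hiB => ?_⟩
  have hB' : B ∈ insert Finset.univ L := Finset.mem_insert_of_mem hB
  rcases hL.compat A hA B hB with h | h | h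
  · exact iff_of_true (h hj) (u3 B hB' (h.ssubset_of_ne hBA.symm) hk)
  · refine iff_of_false (fun hjB => ?_) fun hkB => hkA (h hkB)
    rcases hL.compat_full (mem_children.1 hC).1 (mem_full_of_mem hB') with h1 | h1 | h1
    · by_cases hCB : C = B
      · exact hjC (hCB ▸ hjB)
      · exact hBA (h.antisymm (hL.subset_of_child_ssubset hC (mem_full_of_mem hB')
          (h1.ssubset_of_ne hCB)))
    · exact hjC (h1 hjB)
    · exact Finset.disjoint_left.1 h1 hiC hiB
  · exact absurd hiB (Finset.disjoint_left.1 h hi)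

end IsHierarchy

end TropModuli

end

noncomputable section

namespace TropModuli

namespace TreeType

variable {N : ℕ} {o : Fin N}

/-! ### The lengths of the bounded edges as a function of clusters -/

section Coef

variable (T : TreeType N)

variable (o) in
open Classical in
/-- The length of the bounded edge that separates the labels in `A` from the others, or zero if
there is none. -/
def coef (l : T.G.edgeSet → ℝ) (A : Finset (Fin N)) : ℝ :=
  if h : ∃ v : {v : T.V // v ≠ T.leg o}, T.below o v = A then l (T.edgeEquiv o h.choose) else 0

variable (o) in
open Classical in
/-- The clusters cut out by the bounded edges. -/
def clusters : Finset (Finset (Fin N)) :=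
  Finset.univ.filter fun A => ∃ v, v ≠ T.leg o ∧ T.below o v = A

/-- One if exactly one of the labels `i` and `j` lies in `A`, and zero otherwise. -/
def _root_.TropModuli.cut (A : Finset (Fin N)) (i j : Fin N) : ℝ := if i ∈ A ↔ j ∈ A then 0 else 1

variable {T}

@[simp] lemma mem_clusters {A : Finset (Fin N)} :
    A ∈ T.clusters o ↔ ∃ v, v ≠ T.leg o ∧ T.below o v = A := by
  simp [clusters]

lemma coef_below (l : T.G.edgeSet → ℝ) (v : {v : T.V // v ≠ T.leg o}) :
    T.coef o l (T.below o v) = l (T.edgeEquiv o v) := by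
  have h : ∃ w : {v : T.V // v ≠ T.leg o}, T.below o w = T.below o v := ⟨v, rfl⟩
  rw [coef, dif_pos h]
  congr 2
  exact Subtype.ext (below_injective h.choose_spec)

lemma coef_eq_zero {l : T.G.edgeSet → ℝ} {A : Finset (Fin N)} (h : A ∉ T.clusters o) :
    T.coef o l A = 0 := by
  rw [coef, dif_neg]
  rintro ⟨v, hv⟩
  exact h (mem_clusters.2 ⟨v, v.2, hv⟩)

lemma coef_nonneg {l : T.G.edgeSet → ℝ} (hl : ∀ e, 0 ≤ l e) (A : Finset (Fin N)) :
    0 ≤ T.coef o l A := by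
  unfold coef
  split_ifs
  · exact hl _
  · exact le_rfl

lemma coef_pos_iff {l : T.G.edgeSet → ℝ} (hl : ∀ e, 0 < l e) {A : Finset (Fin N)} :
    0 < T.coef o l A ↔ A ∈ T.clusters o := by
  constructor
  · intro h
    by_contra h'
    rw [coef_eq_zero h'] at h
    exact lt_irrefl _ h
  · rw [mem_clusters]
    rintro ⟨v, hv, rfl⟩
    rw [coef_below l ⟨v, hv⟩]
    exact hl _

lemma isHierarchy_clusters : IsHierarchy o (T.clusters o) := by
  constructor
  · intro A hA
    obtain ⟨v, hv, rfl⟩ := mem_clusters.1 hA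
    exact ⟨notMem_below hv, two_le_card_below hv, card_below_add_two_le hv⟩
  · intro A hA B hB
    obtain ⟨v, hv, rfl⟩ := mem_clusters.1 hA
    obtain ⟨w, hw, rfl⟩ := mem_clusters.1 hB
    exact below_laminar v w

lemma below_mem_insert_clusters (v : T.V) :
    T.below o v ∈ insert Finset.univ (T.clusters o) := by
  by_cases hv : v = T.leg o
  · rw [hv, below_root]
    exact Finset.mem_insert_self _ _
  · exact Finset.mem_insert_of_mem (mem_clusters.2 ⟨v, hv, rfl⟩)

lemma exists_below_eq {A : Finset (Fin N)} (h : A ∈ insert Finset.univ (T.clusters o)) :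
    ∃ v, T.below o v = A := by
  rcases Finset.mem_insert.1 h with rfl | h
  · exact ⟨_, below_root⟩
  · obtain ⟨v, -, hv⟩ := mem_clusters.1 h
    exact ⟨v, hv⟩

/-- The path between two ends crosses an edge exactly when its cluster contains one of the two
labels (`mem_edges_path_iff`). So a tree metric is the sum of the cut metrics of its edges, weighted
by the lengths. -/
lemma legDist_eq_sum (l : T.G.edgeSet → ℝ) (i j : Fin N) :
    T.legDist l i j = ∑ A, T.coef o l A * cut A i j := by
  classical
  have : Fintype T.V := Fintype.ofFinite _
  rw [legDist, ← finsum_comp_equiv (T.edgeEquiv o), finsum_eq_sum_of_fintype]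
  refine Finset.sum_of_injOn (fun v => T.below o v)
    (fun v _ w _ h => Subtype.ext (below_injective h)) (by simp) ?_ ?_
  · intro A _ hA
    rw [coef_eq_zero, zero_mul]
    intro h
    obtain ⟨v, hv, rfl⟩ := mem_clusters.1 h
    exact hA ⟨⟨v, hv⟩, by simp, rfl⟩
  · intro v _
    rw [coef_below, finsum_eq_if, cut]
    simp only [mem_edges_path_iff, mem_below]
    split_ifs <;> simp_all

/-- The lowest vertex above a non-empty set of labels. -/
lemma exists_lowest (T : TreeType N) {A : Finset (Fin N)} (hA : A.Nonempty) :
    ∃ w : T.V, A ⊆ T.below o w ∧ ∀ w', A ⊆ T.below o w' → T.below o w ⊆ T.below o w' := by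
  classical
  have : Fintype T.V := Fintype.ofFinite _
  obtain ⟨w, hw, hmin⟩ := Finset.exists_min_image
    (Finset.univ.filter fun w : T.V => A ⊆ T.below o w) (fun w => (T.below o w).card)
    ⟨T.leg o, by simp [below_root]⟩
  simp only [Finset.mem_filter, Finset.mem_univ, true_and] at hw hmin
  refine ⟨w, hw, fun w' hw' => ?_⟩
  rcases below_laminar (o := o) w w' with h | h | h
  · exact h
  · exact (Finset.eq_of_subset_of_card_le h (hmin w' hw')).ge
  · obtain ⟨i, hi⟩ := hA
    exact absurd h (Finset.not_disjoint_iff.2 ⟨i, hw hi, hw' hi⟩)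

end Coef

/-! ### Trees with the same clusters are isomorphic -/

/-- Match vertices with equal label sets. Parents and attached ends are characterised by inclusions
among these sets (`eq_par_iff`, `eq_leg_iff`), so they are respected. -/
lemma exists_iso {T T' : TreeType N} (h : T.clusters o = T'.clusters o) :
    ∃ f : T.G ≃g T'.G, (∀ i, f (T.leg i) = T'.leg i) ∧
      (∀ v, T'.below o (f v) = T.below o v) := by
  have h1 : ∀ v : T.V, ∃ w : T'.V, T'.below o w = T.below o v := fun v =>
    exists_below_eq (h ▸ below_mem_insert_clusters v)
  have h2 : ∀ w : T'.V, ∃ v : T.V, T.below o v = T'.below o w := fun w =>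
    exists_below_eq (h ▸ below_mem_insert_clusters w)
  choose f hf using h1
  choose g hg using h2
  have hroot : ∀ v, f v = T'.leg o ↔ v = T.leg o := fun v => by
    rw [← below_eq_univ_iff, hf, below_eq_univ_iff]
  -- The characterisations quantify over all vertices; as both trees have the same label sets, the
  -- quantifier can be moved from one tree to the other.
  have hall : ∀ (P : Finset (Fin N) → Prop),
      (∀ w, P (T'.below o w)) ↔ ∀ v, P (T.below o v) := fun P =>
    ⟨fun H v => hf v ▸ H (f v), fun H w => hg w ▸ H (g w)⟩
  have hpar : ∀ u v, v ≠ T.leg o → (f u = T'.par o (f v) ↔ u = T.par o v) := fun u v hv => by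
    rw [eq_par_iff hv, eq_par_iff (mt (hroot v).1 hv), hf, hf,
      hall fun A => T.below o v ⊂ A → T.below o u ⊆ A]
  refine ⟨⟨⟨f, g, fun v => ?_, fun w => ?_⟩, fun {u v} => ?_⟩, fun i => ?_, hf⟩
  · exact below_injective (by rw [hg, hf])
  · exact below_injective (by rw [hf, hg])
  · change T'.G.Adj (f u) (f v) ↔ T.G.Adj u v
    rw [adj_iff (o := o), adj_iff (o := o), Ne, hroot, Ne, hroot, eq_comm (b := f u),
      eq_comm (b := f v), eq_comm (b := u), eq_comm (b := v),
      and_congr_right fun h => hpar u v h, and_congr_right fun h => hpar v u h]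
  · change f (T.leg i) = T'.leg i
    rw [eq_leg_iff (o := o), hf, hall fun A => i ∈ A → T.below o (T.leg i) ⊆ A]
    exact eq_leg_iff.1 rfl

lemma map_edgeEquiv {T T' : TreeType N} (f : T.G ≃g T'.G)
    (hf : ∀ v, T'.below o (f v) = T.below o v) (v : {v : T.V // v ≠ T.leg o}) :
    ∃ hv : f v ≠ T'.leg o, f.mapEdgeSet (T.edgeEquiv o v) = T'.edgeEquiv o ⟨f v, hv⟩ := by
  have hv : f v ≠ T'.leg o := by
    rw [Ne, ← below_eq_univ_iff, hf, below_eq_univ_iff]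
    exact v.2
  refine ⟨hv, Subtype.ext ?_⟩
  change s(f (T.par o v), f v) = s(T'.par o (f v), f v)
  congr 2
  have h := (eq_par_iff v.2).1 (rfl : T.par o v.1 = _)
  rw [eq_par_iff hv, hf, hf]
  refine ⟨h.1, fun w hw => ?_⟩
  obtain ⟨w, rfl⟩ := f.surjective w
  rw [hf] at hw ⊢
  exact h.2 w hw

end TreeType

variable {N : ℕ} {o : Fin N}

/-- Curves with the same lengths as functions of clusters are isomorphic. -/
lemma AbsCurve.exists_iso {C D : AbsCurve N} (h : C.coef o C.length = D.coef o D.length) :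
    ∃ f : C.G ≃g D.G, (∀ i, f (C.leg i) = D.leg i) ∧
      (∀ e, D.length (f.mapEdgeSet e) = C.length e) ∧
      ∀ v, D.below o (f v) = C.below o v := by
  have hc : C.clusters o = D.clusters o := by
    ext A
    rw [← TreeType.coef_pos_iff C.length_pos, h, TreeType.coef_pos_iff D.length_pos]
  obtain ⟨f, hf1, hf2⟩ := TreeType.exists_iso hc
  refine ⟨f, hf1, fun e => ?_, hf2⟩
  obtain ⟨v, rfl⟩ := (C.edgeEquiv o).surjective e
  obtain ⟨hv, h1⟩ := TreeType.map_edgeEquiv f hf2 v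
  rw [h1, ← TreeType.coef_below C.length v, h, ← hf2, ← TreeType.coef_below D.length ⟨f v, hv⟩]

/-! ### The tree of a hierarchy -/

section Canonical

variable {L : Finset (Finset (Fin N))}

/-- The tree whose vertices are the members of the hierarchy and the set of all labels. -/
def hierarchyGraph (hL : IsHierarchy o L) : SimpleGraph {A // A ∈ insert Finset.univ L} where
  Adj A B := (A.1 ≠ Finset.univ ∧ up L A.1 = B.1) ∨ (B.1 ≠ Finset.univ ∧ up L B.1 = A.1)
  symm := ⟨fun A B h => h.symm⟩
  loopless := ⟨fun A h => by
    have h : A.1 ≠ Finset.univ ∧ up L A.1 = A.1 := by tauto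
    have := (hL.up_spec (hL.nonempty_of_mem_full (IsHierarchy.mem_full_of_mem A.2)) h.1).2.1
    rw [h.2] at this
    exact this.ne rfl⟩

lemma IsHierarchy.up_mem_spec (hL : IsHierarchy o L) {A : Finset (Fin N)}
    (hA : A ∈ insert Finset.univ L) (hA' : A ≠ Finset.univ) :
    up L A ∈ insert Finset.univ L ∧ A ⊂ up L A ∧
      ∀ B ∈ insert Finset.univ L, A ⊂ B → up L A ⊆ B :=
  hL.up_spec (hL.nonempty_of_mem_full (mem_full_of_mem hA)) hA'

lemma hierarchyGraph_connected (hL : IsHierarchy o L) : (hierarchyGraph hL).Connected := by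
  have h0 : Finset.univ ∈ insert Finset.univ L := Finset.mem_insert_self _ _
  have key : ∀ (k : ℕ) (A : {A // A ∈ insert Finset.univ L}), N - A.1.card = k →
      (hierarchyGraph hL).Reachable ⟨Finset.univ, h0⟩ A := by
    intro k
    induction k using Nat.strong_induction_on with
    | _ k ih =>
      rintro ⟨A, hA⟩ hk
      by_cases hA' : A = Finset.univ
      · subst hA'
        exact SimpleGraph.Reachable.refl _
      · obtain ⟨h1, h2, -⟩ := hL.up_mem_spec hA hA'
        have h3 := Finset.card_lt_card h2
        have h4 := Finset.card_le_univ (up L A)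
        rw [Fintype.card_fin] at h4
        simp only at hk
        refine (ih (N - (up L A).card) (by omega) ⟨_, h1⟩ rfl).trans ?_
        exact SimpleGraph.Adj.reachable (Or.inr ⟨hA', rfl⟩)
  have : Nonempty {A // A ∈ insert Finset.univ L} := ⟨⟨Finset.univ, h0⟩⟩
  exact ⟨fun A B => (key _ A rfl).symm.trans (key _ B rfl)⟩

/-- A connected graph with one edge less than vertices is a tree; here each member other than `univ`
contributes the edge to the next larger member. -/
lemma hierarchyGraph_isTree (hL : IsHierarchy o L) : (hierarchyGraph hL).IsTree := by
  rw [SimpleGraph.isTree_iff_connected_and_card]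
  refine ⟨hierarchyGraph_connected hL, ?_⟩
  have h0 : Finset.univ ∈ insert Finset.univ L := Finset.mem_insert_self _ _
  let f : {A : {A // A ∈ insert Finset.univ L} // A ≠ ⟨Finset.univ, h0⟩} →
      (hierarchyGraph hL).edgeSet := fun A =>
    have hA : A.1.1 ≠ Finset.univ := fun h => A.2 (Subtype.ext h)
    ⟨s(⟨up L A.1.1, (hL.up_mem_spec A.1.2 hA).1⟩, A.1), Or.inr ⟨hA, rfl⟩⟩
  have hf : Function.Bijective f := by
    constructor
    · rintro ⟨⟨A, hA⟩, hA'⟩ ⟨⟨B, hB⟩, hB'⟩ h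
      have h1 := congrArg Subtype.val h
      simp only [f] at h1
      rw [Sym2.eq_iff] at h1
      rcases h1 with ⟨-, h1⟩ | ⟨h1, h2⟩
      · exact Subtype.ext h1
      · have h1 := congrArg Subtype.val h1
        have h2 := congrArg Subtype.val h2
        simp only at h1 h2
        have h3 := (hL.up_mem_spec hA fun h => hA' (Subtype.ext h)).2.1
        have h4 := (hL.up_mem_spec hB fun h => hB' (Subtype.ext h)).2.1
        rw [h1] at h3
        rw [← h2] at h4
        exact absurd h3.subset h4.not_subset
    · rintro ⟨e, he⟩
      induction e with
      | _ A B =>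
        have he' : (A.1 ≠ Finset.univ ∧ up L A.1 = B.1) ∨ (B.1 ≠ Finset.univ ∧ up L B.1 = A.1) :=
          he
        rcases he' with ⟨h1, h2⟩ | ⟨h1, h2⟩
        · refine ⟨⟨A, fun h => h1 (congrArg Subtype.val h)⟩, Subtype.ext ?_⟩
          change s(_, A) = s(A, B)
          rw [Sym2.eq_swap]
          exact congrArg (fun z => s(A, z)) (Subtype.ext h2)
        · refine ⟨⟨B, fun h => h1 (congrArg Subtype.val h)⟩, Subtype.ext ?_⟩
          change s(_, B) = s(A, B)
          exact congrArg (fun z => s(z, B)) (Subtype.ext h2)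
  rw [← Nat.card_eq_of_bijective f hf]
  have h1 := Set.ncard_add_ncard_compl ({⟨Finset.univ, h0⟩} : Set {A // A ∈ insert Finset.univ L})
  rw [Set.ncard_singleton, add_comm] at h1
  exact h1

variable (hN : 3 ≤ N)
include hN

omit hN in
lemma IsHierarchy.singleton_up_spec (hL : IsHierarchy o L) (hN : 3 ≤ N) (i : Fin N) :
    up L {i} ∈ insert Finset.univ L ∧ {i} ⊂ up L {i} ∧
      ∀ B ∈ insert Finset.univ L, {i} ⊂ B → up L {i} ⊆ B := by
  refine hL.up_spec (Finset.singleton_nonempty i) fun h => ?_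
  have := congrArg Finset.card h
  rw [Finset.card_singleton, Finset.card_univ, Fintype.card_fin] at this
  omega

/-- Attach `o` to `univ` and every other `i` to the smallest member strictly containing `{i}`.
Ancestry in the hierarchy graph is reverse inclusion, so the labels below a member are its elements.
-/
lemma exists_treeType (hL : IsHierarchy o L) : ∃ T : TreeType N, T.clusters o = L := by
  classical
  have h0 : Finset.univ ∈ insert Finset.univ L := Finset.mem_insert_self _ _
  let leg : Fin N → {A // A ∈ insert Finset.univ L} := fun i =>
    if i = o then ⟨Finset.univ, h0⟩ else ⟨up L {i}, (hL.singleton_up_spec hN i).1⟩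
  have hlego : leg o = ⟨Finset.univ, h0⟩ := by simp [leg]
  have hleg : ∀ i, i ≠ o → (leg i).1 = up L {i} := fun i hi => by simp [leg, hi]
  let T : TreeType N :=
    { V := {A // A ∈ insert Finset.univ L}
      finite := inferInstance
      G := hierarchyGraph hL
      isTree := hierarchyGraph_isTree hL
      leg := leg
      stable := by
        rintro ⟨A, hA⟩
        -- `g` turns the neighbours and ends of `A` into sets. Its image contains the children of
        -- `A`, of which there are at least two, and one more set `B`, coming from the parent or
        -- from `o`; hence the valence is at least three.
        let g : {A // A ∈ insert Finset.univ L} ⊕ Fin N → Finset (Fin N) :=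
          Sum.elim Subtype.val singleton
        obtain ⟨B, hB, hB'⟩ : ∃ B ∉ children o L A,
            B ∈ g '' (Sum.inl '' (hierarchyGraph hL).neighborSet ⟨A, hA⟩ ∪
              Sum.inr '' {i | leg i = ⟨A, hA⟩}) := by
          by_cases hAu : A = Finset.univ
          · subst hAu
            refine ⟨{o}, fun h => ?_, .inr o, Or.inr ⟨o, hlego, rfl⟩, rfl⟩
            exact hL.notMem_of_mem_full (IsHierarchy.mem_children.1 h).1
              (IsHierarchy.mem_children.1 h).2.1 (by simp)
          · obtain ⟨h1, h2, -⟩ := hL.up_mem_spec hA hAu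
            refine ⟨up L A, fun h => (hL.child_ssubset h).not_subset h2.subset,
              .inl ⟨_, h1⟩, Or.inl ⟨_, Or.inl ⟨hAu, rfl⟩, rfl⟩, rfl⟩
        have hsub : ((insert B (children o L A) : Finset (Finset (Fin N))) : Set _) ⊆
            g '' (Sum.inl '' (hierarchyGraph hL).neighborSet ⟨A, hA⟩ ∪
              Sum.inr '' {i | leg i = ⟨A, hA⟩}) := by
          intro C hC
          rw [Finset.mem_coe, Finset.mem_insert] at hC
          rcases hC with rfl | hC
          · exact hB'
          · obtain ⟨h1, h2, h3⟩ := IsHierarchy.mem_children.1 hC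
            rcases IsHierarchy.mem_full.1 h1 with rfl | h1 | ⟨i, hi, rfl⟩
            · exact absurd rfl h2
            · exact ⟨.inl ⟨C, Finset.mem_insert_of_mem h1⟩, Or.inl ⟨_, Or.inr ⟨h2, h3⟩, rfl⟩,
                rfl⟩
            · exact ⟨.inr i, Or.inr ⟨i, Subtype.ext ((hleg i hi).trans h3), rfl⟩, rfl⟩
        have h1 := Set.ncard_le_ncard hsub (Set.toFinite _)
        rw [Set.ncard_coe_finset, Finset.card_insert_of_notMem hB] at h1
        have h2 := hL.two_le_card_children hN hA
        have h3 := (Set.ncard_image_le (Set.toFinite _)).trans' h1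
        have h4 := h3.trans (Set.ncard_union_le _ _)
        rw [Set.ncard_image_of_injective _ Sum.inl_injective,
          Set.ncard_image_of_injective _ Sum.inr_injective] at h4
        omega }
  have hroot : ∀ v : T.V, v = T.leg o ↔ v.1 = Finset.univ := fun v => by
    change v = leg o ↔ _
    rw [hlego, Subtype.ext_iff]
  have hanc : ∀ (k : ℕ) (v : T.V), N - v.1.card = k →
      ∀ u : T.V, T.IsAnc o u v ↔ v.1 ⊆ u.1 := by
    intro k
    induction k using Nat.strong_induction_on with
    | _ k ih =>
      intro v hk u
      by_cases hv : v = T.leg o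
      · have hv' := (hroot v).1 hv
        rw [hv, TreeType.isAnc_root_iff, ← hv, hv', hv, hroot]
        exact ⟨fun h => h.ge, fun h => Finset.univ_subset_iff.1 h⟩
      · have hv' := mt (hroot v).2 hv
        obtain ⟨h1, h2, h3⟩ := hL.up_mem_spec v.2 hv'
        have h4 := Finset.card_lt_card h2
        have h5 := Finset.card_le_univ (up L v.1)
        rw [Fintype.card_fin] at h5
        have ih' := ih (N - (up L v.1).card) (by omega) ⟨_, h1⟩ rfl
        have hpar : T.par o v = ⟨_, h1⟩ := by
          refine T.par_of_adj o (Or.inr ⟨hv', rfl⟩) ?_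
          rw [ih']
          exact h2.not_subset
        rw [TreeType.isAnc_iff T o hv, hpar, ih']
        constructor
        · rintro (h | rfl)
          · exact h2.subset.trans h
          · exact subset_rfl
        · intro h
          by_cases huv : u = v
          · exact Or.inr huv
          · exact Or.inl (h3 u.1 u.2 (h.ssubset_of_ne fun h => huv (Subtype.ext h.symm)))
  have hbelow : ∀ v : T.V, T.below o v = v.1 := fun v => by
    ext i
    rw [TreeType.mem_below, hanc _ _ rfl]
    change (leg i).1 ⊆ v.1 ↔ _
    by_cases hi : i = o
    · subst hi
      rw [hlego]
      constructor
      · intro h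
        exact h (Finset.mem_univ i)
      · intro h
        by_contra h'
        exact hL.notMem_of_mem_full (IsHierarchy.mem_full_of_mem v.2)
          (fun h'' => h' h''.ge) h
    · rw [hleg i hi]
      obtain ⟨h1, h2, h3⟩ := hL.singleton_up_spec hN i
      constructor
      · intro h
        exact h (h2.subset (by simp))
      · intro h
        refine h3 v.1 v.2 ((Finset.singleton_subset_iff.2 h).ssubset_of_ne fun h4 => ?_)
        obtain ⟨C, hC, -⟩ := hL.exists_two_children hN v.2
        have h5 := hL.child_ssubset hC
        rw [← h4, Finset.ssubset_singleton_iff] at h5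
        exact (hL.nonempty_of_mem_full (IsHierarchy.mem_children.1 hC).1).ne_empty h5
  refine ⟨T, ?_⟩
  ext A
  rw [TreeType.mem_clusters]
  constructor
  · rintro ⟨v, hv, rfl⟩
    rw [hbelow]
    exact (Finset.mem_insert.1 v.2).resolve_left (mt (hroot v).2 hv)
  · intro hA
    refine ⟨⟨A, Finset.mem_insert_of_mem hA⟩, ?_, hbelow _⟩
    rw [Ne, hroot]
    rintro rfl
    exact hL.univ_notMem hA

omit hN in
/-- Every positive function on the clusters of a tree is given by lengths of its bounded edges. -/
lemma exists_length (T : TreeType N) {c : Finset (Fin N) → ℝ} (hc : ∀ A, 0 ≤ c A)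
    (hc' : ∀ A, c A ≠ 0 ↔ A ∈ T.clusters o) :
    ∃ l : T.G.edgeSet → ℝ, (∀ e, 0 < l e) ∧ T.coef o l = c := by
  refine ⟨fun e => c (T.below o ((T.edgeEquiv o).symm e)), fun e => ?_, funext fun A => ?_⟩
  · refine (hc _).lt_of_ne' ((hc' _).2 ?_)
    exact TreeType.mem_clusters.2 ⟨_, ((T.edgeEquiv o).symm e).2, rfl⟩
  · by_cases hA : A ∈ T.clusters o
    · obtain ⟨v, hv, rfl⟩ := TreeType.mem_clusters.1 hA
      rw [TreeType.coef_below _ ⟨v, hv⟩]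
      simp
    · rw [TreeType.coef_eq_zero hA]
      by_contra h
      exact hA ((hc' A).1 (Ne.symm h))

/-- Every non-negative function supported on a hierarchy comes from a curve. -/
lemma exists_absCurve {c : Finset (Fin N) → ℝ} (hL : IsHierarchy o L)
    (hc : ∀ A, 0 ≤ c A) (hc' : ∀ A, c A ≠ 0 ↔ A ∈ L) :
    ∃ C : AbsCurve N, C.coef o C.length = c := by
  obtain ⟨T, rfl⟩ := exists_treeType hN hL
  obtain ⟨l, hl, hlc⟩ := exists_length T hc hc'
  exact ⟨⟨T, l, hl⟩, hlc⟩

end Canonical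

/-! ### Contractions -/

/-- The curve `C` is obtained from the tree `T` with edge lengths `l` by contracting the edges of
length zero. -/
structure IsTreeContraction (T : TreeType N) (l : T.G.edgeSet → ℝ) (C : AbsCurve N)
    (π : T.V → C.V) : Prop where
  surjective : Function.Surjective π
  eq_iff : ∀ u v, π u = π v ↔ (zeroGraph T l).Reachable u v
  edge_of_pos : ∀ e, 0 < l e → ∃ e' : C.G.edgeSet, e'.1 = Sym2.map π e.1 ∧ C.length e' = l e
  edge : ∀ e' : C.G.edgeSet, ∃ e : T.G.edgeSet, e'.1 = Sym2.map π e.1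
  leg : ∀ i, C.leg i = π (T.leg i)

namespace IsTreeContraction

open TreeType

variable {T : TreeType N} {l : T.G.edgeSet → ℝ} {C : AbsCurve N} {π : T.V → C.V}

/-- A walk along edges of length zero never crosses an edge of positive length. -/
lemma _root_.TropModuli.TreeType.isAnc_iff_of_zeroGraph {v : {v : T.V // v ≠ T.leg o}}
    (hv : 0 < l (T.edgeEquiv o v)) {x y : T.V} (h : (zeroGraph T l).Reachable x y) :
    T.IsAnc o v x ↔ T.IsAnc o v y := by
  obtain ⟨p⟩ := h
  induction p with
  | nil => rfl
  | cons h p ih =>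
    rw [← ih]
    obtain ⟨⟨e, he⟩, h1, h2⟩ := h
    subst h1
    refine isAnc_iff_of_adj he fun h3 => ?_
    have h4 : T.edgeEquiv o v = ⟨_, he⟩ := Subtype.ext h3.symm
    rw [h4, h2] at hv
    exact lt_irrefl _ hv

variable (h : IsTreeContraction T l C π)
include h

lemma eq_of_map_eq {v w : {v : T.V // v ≠ T.leg o}}
    (hv : 0 < l (T.edgeEquiv o v)) (hw : 0 < l (T.edgeEquiv o w))
    (hvw : s(π (T.par o v), π v) = s(π (T.par o w), π w)) : v = w := by
  rw [Sym2.eq_iff, h.eq_iff, h.eq_iff, h.eq_iff, h.eq_iff] at hvw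
  rcases hvw with ⟨-, h1⟩ | ⟨h1, h2⟩
  · exact Subtype.ext (((isAnc_iff_of_zeroGraph hv h1).1 (T.isAnc_refl o v)).antisymm
      ((isAnc_iff_of_zeroGraph hw h1).2 (T.isAnc_refl o w)))
  · have h3 := (isAnc_iff_of_zeroGraph hv h2).1 (T.isAnc_refl o v)
    have h4 := (isAnc_iff_of_zeroGraph hw h1).2 (T.isAnc_refl o w)
    exact absurd (h3.trans ((par_isAnc w.2).trans h4)) (not_isAnc_par v.2)

/-- Being below `v'`, pulled back along `π`, is false at the root and changes exactly across the
edge of `v`: edges of length zero are collapsed, and other positive edges go to other edges. Such a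
predicate is `IsAnc v`. -/
lemma below_eq {v : {v : T.V // v ≠ T.leg o}} (hl : ∀ e, 0 ≤ l e)
    (hv : 0 < l (T.edgeEquiv o v))
    {v' : {v : C.V // v ≠ C.leg o}} (hv' : s(C.par o v', v'.1) = s(π (T.par o v), π v)) :
    C.below o v' = T.below o v := by
  have key : ∀ u, C.IsAnc o v' (π u) ↔ T.IsAnc o v u := by
    refine isAnc_iff_of_forall (fun u => C.IsAnc o v' (π u)) ?_ v.2 ?_ fun w hw hwv => ?_
    · rw [← h.leg, isAnc_root_iff]
      exact v'.2
    · have h1 := not_isAnc_par v'.2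
      have h2 := C.isAnc_refl o v'
      rw [Sym2.eq_iff] at hv'
      rcases hv' with ⟨h3, h4⟩ | ⟨h3, h4⟩ <;> rw [← h3, ← h4] <;> tauto
    · rcases (hl (T.edgeEquiv o ⟨w, hw⟩)).eq_or_lt with h1 | h1
      · have h2 : π (T.par o w) = π w := (h.eq_iff _ _).2
          (SimpleGraph.Adj.reachable ⟨T.edgeEquiv o ⟨w, hw⟩, rfl, h1.symm⟩)
        rw [h2]
      · obtain ⟨⟨e', he'⟩, h2, -⟩ := h.edge_of_pos _ h1
        simp only [edgeEquiv_coe, Sym2.map_mk] at h2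
        subst h2
        refine isAnc_iff_of_adj he' fun h3 => hwv ?_
        exact congrArg Subtype.val (h.eq_of_map_eq h1 hv (h3.trans hv'))
  ext i
  rw [mem_below, mem_below, ← key, ← h.leg]

/-- Surviving edges keep cluster and length, and no edge of `C` comes from one of length zero, since
that is mapped to a point. So the class in `Q N` can be computed before contracting. -/
lemma coef_eq (hl : ∀ e, 0 ≤ l e) : C.coef o C.length = T.coef o l := by
  have key : ∀ v : {v : T.V // v ≠ T.leg o}, 0 < l (T.edgeEquiv o v) →
      ∃ v' : {v : C.V // v ≠ C.leg o}, s(C.par o v', v'.1) = s(π (T.par o v), π v) ∧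
        C.below o v' = T.below o v ∧ C.length (C.edgeEquiv o v') = l (T.edgeEquiv o v) := by
    intro v hv
    obtain ⟨e', h1, h2⟩ := h.edge_of_pos _ hv
    obtain ⟨v', rfl⟩ := (C.edgeEquiv o).surjective e'
    exact ⟨v', h1, h.below_eq hl hv h1, h2⟩
  funext A
  by_cases hA : ∃ v : {v : T.V // v ≠ T.leg o}, 0 < l (T.edgeEquiv o v) ∧ T.below o v = A
  · obtain ⟨v, hv, rfl⟩ := hA
    obtain ⟨v', -, h1, h2⟩ := key v hv
    rw [coef_below, ← h1, coef_below, h2]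
  · push Not at hA
    have h1 : T.coef o l A = 0 := by
      by_cases hA' : A ∈ T.clusters o
      · obtain ⟨v, hv, rfl⟩ := mem_clusters.1 hA'
        rw [coef_below l ⟨v, hv⟩]
        by_contra hne
        exact hA ⟨v, hv⟩ ((hl _).lt_of_ne' hne) rfl
      · exact coef_eq_zero hA'
    rw [h1, coef_eq_zero]
    intro hA'
    obtain ⟨v', hv', rfl⟩ := mem_clusters.1 hA'
    obtain ⟨e, he⟩ := h.edge (C.edgeEquiv o ⟨v', hv'⟩)
    obtain ⟨v, rfl⟩ := (T.edgeEquiv o).surjective e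
    simp only [edgeEquiv_coe, Sym2.map_mk] at he
    have hv : 0 < l (T.edgeEquiv o v) := by
      refine (hl _).lt_of_ne' fun h2 => ?_
      have h3 : π (T.par o v) = π v := (h.eq_iff _ _).2
        (SimpleGraph.Adj.reachable ⟨T.edgeEquiv o v, rfl, h2⟩)
      have h4 := C.adj_par o hv'
      rw [← SimpleGraph.mem_edgeSet, he, h3] at h4
      exact C.G.loopless.irrefl _ h4
    exact hA v hv (h.below_eq (v' := ⟨v', hv'⟩) hl hv he).symm

end IsTreeContraction

open TreeType in
-- `C` is the curve of the clusters with non-zero length, and `π` takes a vertex to the lowest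
-- vertex of `C` whose label set contains its own. The last clause, that clusters of non-zero length
-- do not distinguish `v` from `π v`, serves to place the vertices of labeled curves.
lemma exists_isTreeContraction (hN : 3 ≤ N) (o : Fin N) (T : TreeType N) {l : T.G.edgeSet → ℝ}
    (hl : ∀ e, 0 ≤ l e) : ∃ (C : AbsCurve N) (π : T.V → C.V), IsTreeContraction T l C π ∧
      ∀ v A, T.coef o l A ≠ 0 → (C.below o (π v) ⊆ A ↔ T.below o v ⊆ A) := by
  classical
  obtain ⟨C, hC⟩ := exists_absCurve (o := o) (c := T.coef o l)
    (L := (T.clusters o).filter fun A => T.coef o l A ≠ 0) hN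
    (isHierarchy_clusters.mono (Finset.filter_subset _ _)) (coef_nonneg hl) (fun A => by
      rw [Finset.mem_filter]
      refine ⟨fun h => ⟨?_, h⟩, fun h => h.2⟩
      by_contra h'
      exact h (coef_eq_zero h'))
  have hcl : ∀ A, A ∈ C.clusters o ↔ T.coef o l A ≠ 0 := fun A => by
    rw [← coef_pos_iff C.length_pos, hC]
    exact ⟨fun h => h.ne', fun h => (coef_nonneg hl A).lt_of_ne' h⟩
  choose π hπ1 hπ2 using fun v : T.V => exists_lowest (o := o) C.toTreeType (below_nonempty (o := o) v)
  -- The vertices of `C` correspond to the top vertices of the collapsed components: the root, and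
  -- those whose parent edge has positive length.
  have hC' : ∀ w : C.V, ∃ v, T.below o v = C.below o w ∧
      (v = T.leg o ∨ ∃ hv, 0 < l (T.edgeEquiv o ⟨v, hv⟩)) := fun w => by
    by_cases hw : w = C.leg o
    · exact ⟨T.leg o, by rw [hw, below_root, below_root], Or.inl rfl⟩
    · have h1 := (hcl _).1 (mem_clusters.2 ⟨w, hw, rfl⟩)
      by_cases h2 : C.below o w ∈ T.clusters o
      · obtain ⟨v, hv, h3⟩ := mem_clusters.1 h2
        rw [← h3, coef_below l ⟨v, hv⟩] at h1
        exact ⟨v, h3, Or.inr ⟨hv, (hl _).lt_of_ne' h1⟩⟩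
      · exact absurd (coef_eq_zero h2) h1
  have hπ3 : ∀ v, (v = T.leg o ∨ ∃ hv, 0 < l (T.edgeEquiv o ⟨v, hv⟩)) →
      C.below o (π v) = T.below o v := fun v hv => by
    obtain ⟨w, hw⟩ : ∃ w, C.below o w = T.below o v := by
      rcases hv with rfl | ⟨hv, h1⟩
      · exact ⟨C.leg o, by rw [below_root, below_root]⟩
      · refine exists_below_eq (Finset.mem_insert_of_mem ((hcl _).2 ?_))
        rw [coef_below l ⟨v, hv⟩]
        exact h1.ne'
    exact (hw ▸ hπ2 v w hw.ge).antisymm (hπ1 v)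
  have hup : ∀ v, v ≠ T.leg o → ∀ w, T.below o v ⊂ C.below o w →
      T.below o (T.par o v) ⊆ C.below o w := fun v hv w hw => by
    obtain ⟨u, hu, -⟩ := hC' w
    rw [← hu] at hw ⊢
    exact ((eq_par_iff hv).1 rfl).2 u hw
  -- If the parent edge of `v` has length zero, `T.below o v` is not a label set of `C`, so any
  -- label set of `C` containing it also contains that of the parent.
  have hπ4 : ∀ v (hv : v ≠ T.leg o), l (T.edgeEquiv o ⟨v, hv⟩) = 0 → π (T.par o v) = π v :=
    fun v hv h0 => by
      have h1 : ∀ w, T.below o v ⊆ C.below o w → T.below o (T.par o v) ⊆ C.below o w :=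
        fun w hw => by
          refine hup v hv w (hw.ssubset_of_ne fun h2 => ?_)
          obtain ⟨u, hu, hu'⟩ := hC' w
          rw [← h2] at hu
          obtain rfl := below_injective hu
          rcases hu' with h3 | ⟨h3, h4⟩
          · exact hv h3
          · exact h4.ne' h0
      exact below_injective ((hπ2 _ _ (h1 _ (hπ1 v))).antisymm
        (hπ2 _ _ ((below_ssubset_par hv).subset.trans (hπ1 _))))
  have hedge : ∀ v : {v : T.V // v ≠ T.leg o}, 0 < l (T.edgeEquiv o v) →
      ∃ hv : π v ≠ C.leg o, π (T.par o v) = C.par o (π v) := fun v hv => by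
    have h1 := hπ3 v (Or.inr ⟨v.2, hv⟩)
    have h2 : π v ≠ C.leg o := by
      rw [Ne, ← below_eq_univ_iff, h1, below_eq_univ_iff]
      exact v.2
    refine ⟨h2, (eq_par_iff h2).2 ⟨?_, fun w hw => ?_⟩⟩
    · rw [h1]
      exact (below_ssubset_par v.2).trans_subset (hπ1 _)
    · rw [h1] at hw
      exact hπ2 _ _ (hup v v.2 w hw)
  -- Climbing through edges of length zero leads to the top of the component. There `π` keeps the
  -- label set (`hπ3`), so `π` separates different components.
  have hzero : ∀ v, ∃ v0, (zeroGraph T l).Reachable v v0 ∧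
      (v0 = T.leg o ∨ ∃ hv, 0 < l (T.edgeEquiv o ⟨v0, hv⟩)) := fun v => by
    induction v using T.par_induction o with
    | root => exact ⟨_, SimpleGraph.Reachable.refl _, Or.inl rfl⟩
    | step v hv ih =>
      rcases (hl (T.edgeEquiv o ⟨v, hv⟩)).eq_or_lt with h1 | h1
      · obtain ⟨v0, h2, h3⟩ := ih
        have h4 : (zeroGraph T l).Adj (T.par o v) v := ⟨T.edgeEquiv o ⟨v, hv⟩, rfl, h1.symm⟩
        exact ⟨v0, h4.symm.reachable.trans h2, h3⟩
      · exact ⟨v, SimpleGraph.Reachable.refl _, Or.inr ⟨hv, h1⟩⟩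
  have hreach : ∀ u v, (zeroGraph T l).Reachable u v → π u = π v := by
    rintro u v ⟨p⟩
    induction p with
    | nil => rfl
    | cons h p ih =>
      rw [← ih]
      obtain ⟨e, h1, h2⟩ := h
      obtain ⟨x, rfl⟩ := (T.edgeEquiv o).surjective e
      rw [edgeEquiv_coe, Sym2.eq_iff] at h1
      have := hπ4 x x.2 h2
      rcases h1 with ⟨rfl, rfl⟩ | ⟨rfl, rfl⟩
      · exact this
      · exact this.symm
  refine ⟨C, π, ⟨fun w => ?_, fun u v => ⟨fun huv => ?_, hreach u v⟩, fun e he => ?_,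
    fun e' => ?_, fun i => ?_⟩, fun v A hA => ?_⟩
  · obtain ⟨v, h1, h2⟩ := hC' w
    exact ⟨v, below_injective ((hπ3 v h2).trans h1)⟩
  · obtain ⟨u0, hu, hu'⟩ := hzero u
    obtain ⟨v0, hv, hv'⟩ := hzero v
    have h1 : u0 = v0 := below_injective (o := o) (by
      rw [← hπ3 u0 hu', ← hπ3 v0 hv', ← hreach _ _ hu, ← hreach _ _ hv, huv])
    exact hu.trans (h1 ▸ hv.symm)
  · obtain ⟨v, rfl⟩ := (T.edgeEquiv o).surjective e
    obtain ⟨h1, h2⟩ := hedge v he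
    refine ⟨C.edgeEquiv o ⟨π v, h1⟩, ?_, ?_⟩
    · simp [h2]
    · rw [← coef_below C.length ⟨π v, h1⟩, hC, hπ3 v (Or.inr ⟨v.2, he⟩), coef_below]
  · obtain ⟨⟨w, hw⟩, rfl⟩ := (C.edgeEquiv o).surjective e'
    obtain ⟨v, h1, h2⟩ := hC' w
    have h3 : π v = w := below_injective ((hπ3 v h2).trans h1)
    subst h3
    rcases h2 with rfl | ⟨hv, h2⟩
    · rw [below_root] at h1
      exact absurd (below_eq_univ_iff.1 h1.symm) hw
    · obtain ⟨-, h4⟩ := hedge ⟨v, hv⟩ h2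
      exact ⟨T.edgeEquiv o ⟨v, hv⟩, by simp [← h4]⟩
  · refine (eq_leg_iff.2 ⟨hπ1 _ (mem_below.2 (T.isAnc_refl o _)), fun w hw => hπ2 _ _ ?_⟩).symm
    obtain ⟨u, hu, -⟩ := hC' w
    rw [← hu] at hw ⊢
    exact ((eq_leg_iff (o := o) (T := T) (i := i)).1 rfl).2 u hw
  · obtain ⟨w, hw⟩ := exists_below_eq (Finset.mem_insert_of_mem ((hcl A).2 hA))
    rw [← hw]
    exact ⟨(hπ1 v).trans, hπ2 v w⟩

end TropModuli

end

noncomputable section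

namespace TropModuli

variable {N : ℕ} {o : Fin N}

/-! ### Linear forms on `Q N` -/

/-- The entry of a vector at the unordered pair `{i, j}`. -/
def entry (i j : Fin N) : (Pairs N → ℝ) →ₗ[ℝ] ℝ :=
  if h : i < j then LinearMap.proj ⟨(i, j), h⟩
  else if h : j < i then LinearMap.proj ⟨(j, i), h⟩ else 0

lemma entry_symm (i j : Fin N) : entry i j = entry j i := by
  unfold entry
  rcases lt_trichotomy i j with h | h | h
  · simp [h, h.not_gt]
  · simp [h]
  · simp [h, h.not_gt]

lemma entry_of_lt {i j : Fin N} (h : i < j) (x : Pairs N → ℝ) : entry i j x = x ⟨(i, j), h⟩ := by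
  simp [entry, h]

lemma entry_Phi {i j : Fin N} (h : i ≠ j) (a : Fin N → ℝ) : entry i j (Phi N a) = a i + a j := by
  rcases lt_or_gt_of_ne h with h | h
  · rw [entry_of_lt h]; rfl
  · rw [entry_symm, entry_of_lt h, add_comm]; rfl

/-- The vector of the cut metric of `A`. -/
def cutVector (A : Finset (Fin N)) (t : Pairs N) : ℝ := cut A t.1.1 t.1.2

lemma cut_symm (A : Finset (Fin N)) (i j : Fin N) : cut A i j = cut A j i := by
  simp [cut, iff_comm]

lemma entry_cutVector (A : Finset (Fin N)) (i j : Fin N) :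
    entry i j (cutVector A) = cut A i j := by
  rcases lt_trichotomy i j with h | rfl | h
  · rw [entry_of_lt h]; rfl
  · simp [entry, cut]
  · rw [entry_symm, entry_of_lt h, cut_symm]; rfl

/-- The class of the cut metric of `A`. -/
def splitVector (A : Finset (Fin N)) : Q N := Submodule.Quotient.mk (cutVector A)

/-- The difference of the Gromov products of `i, j` and of `k, l` with respect to `o`. -/
def gromovForm {o i j k l : Fin N} (hij : i ≠ j) (hkl : k ≠ l) (hi : i ≠ o) (hj : j ≠ o)
    (hk : k ≠ o) (hl : l ≠ o) : Q N →ₗ[ℝ] ℝ :=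
  (LinearMap.range (Phi N)).liftQ
    ((2 : ℝ)⁻¹ • (entry i o + entry j o - entry i j - entry k o - entry l o + entry k l)) (by
      -- On `Phi N a` every Gromov product at `o` equals `a o`, so the difference of two vanishes.
      rintro _ ⟨a, rfl⟩
      simp only [LinearMap.mem_ker, LinearMap.smul_apply, LinearMap.add_apply,
        LinearMap.sub_apply, entry_Phi hij, entry_Phi hkl, entry_Phi hi, entry_Phi hj,
        entry_Phi hk, entry_Phi hl, smul_eq_mul]
      ring)

lemma gromovForm_mk {o i j k l : Fin N} (hij : i ≠ j) (hkl : k ≠ l) (hi : i ≠ o) (hj : j ≠ o)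
    (hk : k ≠ o) (hl : l ≠ o) (x : Pairs N → ℝ) :
    gromovForm hij hkl hi hj hk hl (Submodule.Quotient.mk x) =
      2⁻¹ * (entry i o x + entry j o x - entry i j x - entry k o x - entry l o x +
        entry k l x) := rfl

/-- One if both `i` and `j` lie in `A`, and zero otherwise. -/
def bothMem (A : Finset (Fin N)) (i j : Fin N) : ℤ := if i ∈ A ∧ j ∈ A then 1 else 0

/-- The Gromov product at `o` of a cut metric counts whether both labels lie on the side away from
`o`. Hence the form is integral on these vectors in spite of the factor `2⁻¹`. -/
lemma gromovForm_splitVector {o i j k l : Fin N} (hij : i ≠ j) (hkl : k ≠ l) (hi : i ≠ o)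
    (hj : j ≠ o) (hk : k ≠ o) (hl : l ≠ o) {A : Finset (Fin N)} (hA : o ∉ A) :
    gromovForm hij hkl hi hj hk hl (splitVector A) = ((bothMem A i j - bothMem A k l : ℤ) : ℝ) := by
  have key : ∀ i j : Fin N, cut A i o + cut A j o - cut A i j = 2 * (bothMem A i j : ℝ) := by
    intro i j
    by_cases h1 : i ∈ A <;> by_cases h2 : j ∈ A <;> simp [cut, bothMem, h1, h2, hA]
    norm_num
  rw [splitVector, gromovForm_mk]
  simp only [entry_cutVector]
  push_cast
  linarith [key i j, key k l]

lemma splitVector_univ : splitVector (Finset.univ : Finset (Fin N)) = 0 := by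
  rw [splitVector, Submodule.Quotient.mk_eq_zero]
  refine ⟨0, ?_⟩
  rw [map_zero]
  funext t
  simp [cutVector, cut]

/-- Cutting off one label only lengthens an end, which the quotient by the image of `Phi` ignores.
-/
lemma splitVector_singleton (i : Fin N) : splitVector ({i} : Finset (Fin N)) = 0 := by
  rw [splitVector, Submodule.Quotient.mk_eq_zero]
  refine ⟨Pi.single i 1, ?_⟩
  funext t
  have h := t.2.ne
  change (Pi.single i 1 : Fin N → ℝ) t.1.1 + (Pi.single i 1 : Fin N → ℝ) t.1.2 = _
  by_cases h1 : t.1.1 = i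
  · have h2 : t.1.2 ≠ i := fun h2 => h (h1.trans h2.symm)
    simp [cutVector, cut, h1, h2]
  · by_cases h2 : t.1.2 = i <;> simp [cutVector, cut, h1, h2]

lemma splitVector_erase_univ (i : Fin N) :
    splitVector ((Finset.univ : Finset (Fin N)).erase i) = 0 := by
  rw [← splitVector_singleton i, splitVector, splitVector]
  congr 1
  funext t
  simp only [cutVector, cut, Finset.mem_erase, Finset.mem_univ, and_true, Finset.mem_singleton]
  split_ifs <;> tauto

/-- The relation of the three ways to resolve a four-valent vertex. -/
lemma splitVector_union {B C D : Finset (Fin N)} (hBC : Disjoint B C) (hBD : Disjoint B D)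
    (hCD : Disjoint C D) :
    splitVector (B ∪ C) + splitVector (B ∪ D) + splitVector (C ∪ D) =
      splitVector (B ∪ C ∪ D) + splitVector B + splitVector C + splitVector D := by
  simp only [splitVector, ← Submodule.Quotient.mk_add]
  congr 1
  funext t
  have h : ∀ i, (i ∈ B → i ∉ C ∧ i ∉ D) ∧ (i ∈ C → i ∉ D) := fun i =>
    ⟨fun h => ⟨Finset.disjoint_left.1 hBC h, Finset.disjoint_left.1 hBD h⟩,
      fun h => Finset.disjoint_left.1 hCD h⟩
  have h1 := h t.1.1
  have h2 := h t.1.2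
  simp only [Pi.add_apply, cutVector, cut, Finset.mem_union]
  -- The labels fall into `B`, `C`, `D` and the rest. Labels in different blocks are separated by
  -- exactly two terms on each side, labels in the same block by none.
  by_cases b1 : t.1.1 ∈ B <;> by_cases c1 : t.1.1 ∈ C <;> by_cases d1 : t.1.1 ∈ D <;>
    simp only [b1, c1, d1, not_true_eq_false, and_false, and_true, imp_false,
      forall_const, not_false_eq_true, and_self, false_imp_iff] at h1 <;>
    by_cases b2 : t.1.2 ∈ B <;> by_cases c2 : t.1.2 ∈ C <;> by_cases d2 : t.1.2 ∈ D <;>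
    simp only [b2, c2, d2, not_true_eq_false, and_false, and_true, imp_false,
      forall_const, not_false_eq_true, and_self, false_imp_iff] at h2 <;>
    simp [b1, c1, d1, b2, c2, d2]

/-! ### Combinations of the vectors of a hierarchy -/

/-- The linear combination of the classes of cut metrics with coefficients `c`. -/
def combination : (Finset (Fin N) → ℝ) →ₗ[ℝ] Q N :=
  Fintype.linearCombination ℝ splitVector

lemma combination_apply (c : Finset (Fin N) → ℝ) :
    combination c = ∑ A, c A • splitVector A := rfl

lemma distClass_eq (T : TreeType N) (l : T.G.edgeSet → ℝ) :
    T.distClass l = combination (T.coef o l) := by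
  rw [combination_apply]
  simp only [splitVector, ← Submodule.Quotient.mk_smul]
  rw [TreeType.distClass, ← Submodule.mkQ_apply]
  simp only [← Submodule.mkQ_apply, ← map_sum]
  congr 1
  funext t
  rw [TreeType.legDist_eq_sum (o := o)]
  simp [Finset.sum_apply, cutVector]

/-- The coefficients `c` are non-negative, and they vanish outside of `L`. -/
structure IsCoef (L : Finset (Finset (Fin N))) (c : Finset (Fin N) → ℝ) : Prop where
  nonneg : ∀ A, 0 ≤ c A
  mem : ∀ A, c A ≠ 0 → A ∈ L

lemma form_combination (f : Q N →ₗ[ℝ] ℝ) (c : Finset (Fin N) → ℝ) :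
    f (combination c) = ∑ A, c A * f (splitVector A) := by
  simp [combination_apply, map_sum]

/-- For `c A > 0`, evaluate on both sides the Gromov product of `i, j` minus that of `i, k`, where
`i, j ∈ A` and `k ∉ A`. On the left it is at least `c A`, since a cluster compatible with `A` that
contains `i` and `k` also contains `j`. On the right it is at most zero for a suitable choice if
some cluster in use crosses `A`, and otherwise another choice makes it equal to `c' A`. -/
lemma le_of_combination_eq (hN : 3 ≤ N) {L L' : Finset (Finset (Fin N))} (hL : IsHierarchy o L)
    (hL' : IsHierarchy o L') {c c' : Finset (Fin N) → ℝ} (hc : IsCoef L c) (hc' : IsCoef L' c')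
    (h : combination c = combination c') (A : Finset (Fin N)) : c A ≤ c' A := by
  classical
  by_cases hA0 : c A = 0
  · rw [hA0]; exact hc'.nonneg A
  have hA := hc.mem A hA0
  have hAc := hL.isCluster A hA
  have hval : ∀ {L c}, IsHierarchy o L → IsCoef L c → ∀ i j k (hij : i ≠ j) (hik : i ≠ k)
      (hi : i ≠ o) (hj : j ≠ o) (hk : k ≠ o),
      gromovForm hij hik hi hj hi hk (combination c) =
        ∑ B, c B * ((bothMem B i j - bothMem B i k : ℤ) : ℝ) := by
    intro L c hL hc i j k hij hik hi hj hk
    rw [form_combination]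
    refine Finset.sum_congr rfl fun B _ => ?_
    by_cases hB : c B = 0
    · rw [hB, zero_mul, zero_mul]
    · rw [gromovForm_splitVector _ _ _ _ _ _ (hL.isCluster B (hc.mem B hB)).notMem]
  have hge : ∀ i j k (hij : i ≠ j) (hik : i ≠ k) (hi : i ≠ o) (hj : j ≠ o) (hk : k ≠ o),
      i ∈ A → j ∈ A → k ∉ A → c A ≤ gromovForm hij hik hi hj hi hk (combination c) := by
    intro i j k hij hik hi hj hk hiA hjA hkA
    rw [hval hL hc]
    have h1 : c A = c A * ((bothMem A i j - bothMem A i k : ℤ) : ℝ) := by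
      simp [bothMem, hiA, hjA, hkA]
    rw [h1]
    refine Finset.single_le_sum (f := fun B => c B * ((bothMem B i j - bothMem B i k : ℤ) : ℝ))
      (fun B _ => ?_) (Finset.mem_univ A)
    by_cases hB : c B = 0
    · simp [hB]
    · refine mul_nonneg (hc.nonneg B) (Int.cast_nonneg ?_)
      by_cases h2 : i ∈ B ∧ k ∈ B
      · have h3 : j ∈ B := by
          rcases hL.compat A hA B (hc.mem B hB) with h4 | h4 | h4
          · exact h4 hjA
          · exact absurd (h4 h2.2) hkA
          · exact absurd h2.1 (Finset.disjoint_left.1 h4 hiA)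
        simp [bothMem, h2, h3]
      · simp only [bothMem, h2, if_false]
        split_ifs <;> simp
  set L0 := L'.filter fun B => c' B ≠ 0 with hL0
  have hc0 : IsCoef L0 c' := ⟨hc'.nonneg, fun B hB => Finset.mem_filter.2 ⟨hc'.mem B hB, hB⟩⟩
  have hL0' : IsHierarchy o L0 := hL'.mono (Finset.filter_subset _ _)
  -- If `B` crosses `A`, take `i` in both, `j ∈ A \ B` and `k ∈ B \ A`. Every cluster of `L0`
  -- containing `i` and `j` then contains `k`, so the form is at most zero on the right but positive
  -- on the left.
  have hcompat : ∀ B ∈ L0, Compat A B := by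
    intro B hB
    by_contra hcon
    simp only [Compat, not_or] at hcon
    obtain ⟨j, hjA, hjB⟩ := Finset.not_subset.1 hcon.1
    obtain ⟨k, hkB, hkA⟩ := Finset.not_subset.1 hcon.2.1
    obtain ⟨i, hiA, hiB⟩ := Finset.not_disjoint_iff.1 hcon.2.2
    have ho := (hL0'.isCluster B hB).notMem
    have hij : i ≠ j := fun h => hjB (h ▸ hiB)
    have hik : i ≠ k := fun h => hkA (h ▸ hiA)
    have hi : i ≠ o := fun h => ho (h ▸ hiB)
    have hj : j ≠ o := fun h => hAc.notMem (h ▸ hjA)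
    have hk : k ≠ o := fun h => ho (h ▸ hkB)
    have h1 := hge i j k hij hik hi hj hk hiA hjA hkA
    rw [h, hval hL0' hc0] at h1
    have h2 : ∑ B, c' B * ((bothMem B i j - bothMem B i k : ℤ) : ℝ) ≤ 0 := by
      refine Finset.sum_nonpos fun E _ => ?_
      by_cases hE : c' E = 0
      · simp [hE]
      · refine mul_nonpos_of_nonneg_of_nonpos (hc'.nonneg E) (Int.cast_nonpos.2 ?_)
        by_cases h2 : i ∈ E ∧ j ∈ E
        · have h3 : k ∈ E := by
            rcases hL0'.compat B hB E (hc0.mem E hE) with h4 | h4 | h4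
            · exact h4 hkB
            · exact absurd (h4 h2.2) hjB
            · exact absurd h2.1 (Finset.disjoint_left.1 h4 hiB)
          simp [bothMem, h2, h3]
        · simp only [bothMem, h2, if_false]
          split_ifs <;> simp
    exact absurd ((hc.nonneg A).lt_of_ne' hA0) (by linarith)
  -- Now `A` fits into a common hierarchy with `L0`, and labels separated by `A` alone isolate `c'
  -- A`; this covers the case `A ∉ L0`.
  have hins := hL0'.insert_cluster hAc hcompat
  obtain ⟨i, j, k, hiA, hjA, hkA, hi, hj, hk, hij, hsep⟩ :=
    hins.exists_separating hN (Finset.mem_insert_self A L0)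
  have hik : i ≠ k := fun h => hkA (h ▸ hiA)
  refine (hge i j k hij hik hi hj hk hiA hjA hkA).trans (le_of_eq ?_)
  rw [h, hval hL0' hc0, Finset.sum_eq_single A]
  · simp [bothMem, hiA, hjA, hkA]
  · intro B _ hBA
    by_cases hB : c' B = 0
    · simp [hB]
    · have h1 := hsep B (Finset.mem_insert_of_mem (hc0.mem B hB)) hBA
      have h2 : bothMem B i j = bothMem B i k := by
        unfold bothMem
        congr 1
        exact propext (and_congr_right h1)
      simp [h2]
  · simp

/-- The metric of a curve determines the lengths of its bounded edges. -/
lemma eq_of_combination_eq (hN : 3 ≤ N) {L L' : Finset (Finset (Fin N))} (hL : IsHierarchy o L)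
    (hL' : IsHierarchy o L') {c c' : Finset (Fin N) → ℝ} (hc : IsCoef L c) (hc' : IsCoef L' c')
    (h : combination c = combination c') : c = c' :=
  funext fun A => (le_of_combination_eq hN hL hL' hc hc' h A).antisymm
    (le_of_combination_eq hN hL' hL hc' hc h.symm A)

/-! ### The lattice -/

lemma _root_.TropModuli.TreeType.card_edgeSet (T : TreeType N) :
    Nat.card T.G.edgeSet = (T.clusters o).card := by
  rw [← Nat.card_congr (T.edgeEquiv o), ← Set.ncard_coe_finset]
  refine Nat.card_congr (Equiv.ofBijective
    (fun v => ⟨T.below o v.1, by simpa using ⟨v.1, v.2, rfl⟩⟩) ⟨fun v w h => ?_, ?_⟩)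
  · exact Subtype.ext (TreeType.below_injective (congrArg Subtype.val h))
  · rintro ⟨A, hA⟩
    obtain ⟨v, hv, rfl⟩ := TreeType.mem_clusters.1 (Finset.mem_coe.1 hA)
    exact ⟨⟨v, hv⟩, rfl⟩

lemma combination_single (A : Finset (Fin N)) (x : ℝ) :
    combination (Pi.single A x) = x • splitVector A := by
  classical
  rw [combination_apply, Finset.sum_eq_single A]
  · simp
  · intro B _ h
    simp [h]
  · simp

lemma phi_mk (C : AbsCurve N) : phi N ⟦C⟧ = combination (C.coef o C.length) :=
  distClass_eq C.toTreeType C.length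

lemma isHierarchy_singleton {A : Finset (Fin N)} (hA : IsCluster o A) : IsHierarchy o {A} := by
  simpa using isHierarchy_empty.insert_cluster hA (by simp)

variable (o) in
lemma splitVectors_eq (hN : 3 ≤ N) : splitVectors N = splitVector '' {A | IsCluster o A} := by
  classical
  ext x
  constructor
  · rintro ⟨C, hC, hl, rfl⟩
    rw [TreeType.card_edgeSet (o := o), Finset.card_eq_one] at hC
    obtain ⟨A, hA⟩ := hC
    have hA' : A ∈ C.clusters o := by simp [hA]
    refine ⟨A, TreeType.isHierarchy_clusters.isCluster A hA', ?_⟩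
    rw [phi_mk (o := o), ← one_smul ℝ (splitVector A), ← combination_single]
    congr 1
    funext B
    by_cases hB : B = A
    · subst hB
      obtain ⟨v, hv, rfl⟩ := TreeType.mem_clusters.1 hA'
      rw [TreeType.coef_below C.length ⟨v, hv⟩, hl, Pi.single_eq_same]
    · rw [Pi.single_eq_of_ne hB, TreeType.coef_eq_zero]
      simpa [hA] using hB
  · rintro ⟨A, hA, rfl⟩
    have h1 : ∀ B, 0 ≤ (Pi.single A 1 : Finset (Fin N) → ℝ) B := fun B => by
      rw [Pi.single_apply]; split_ifs <;> norm_num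
    have h2 : ∀ B, (Pi.single A 1 : Finset (Fin N) → ℝ) B ≠ 0 ↔ B ∈ ({A} : Finset _) := fun B => by
      rw [Pi.single_apply]; split_ifs <;> simp_all
    obtain ⟨C, hC⟩ := exists_absCurve hN (isHierarchy_singleton hA) h1 h2
    have hcl : C.clusters o = {A} := by
      ext B
      rw [← TreeType.coef_pos_iff C.length_pos, hC, ← h2]
      exact ⟨fun h => h.ne', fun h => (h1 B).lt_of_ne' h⟩
    refine ⟨C, ?_, fun e => ?_, ?_⟩
    · rw [TreeType.card_edgeSet (o := o), hcl, Finset.card_singleton]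
    · obtain ⟨v, rfl⟩ := (C.edgeEquiv o).surjective e
      have h3 : C.below o v ∈ C.clusters o := TreeType.mem_clusters.2 ⟨v, v.2, rfl⟩
      rw [hcl, Finset.mem_singleton] at h3
      rw [← TreeType.coef_below C.length v, hC, h3, Pi.single_eq_same]
    · rw [phi_mk (o := o), hC, combination_single, one_smul]

lemma splitVector_mem_latticeQ (hN : 3 ≤ N) {A : Finset (Fin N)} (hA : IsCluster o A) :
    splitVector A ∈ latticeQ N := by
  refine AddSubgroup.subset_closure ?_
  rw [splitVectors_eq o hN]
  exact ⟨A, hA, rfl⟩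

lemma isIntegral_latticeQ (hN : 3 ≤ N) {f : Q N →ₗ[ℝ] ℝ}
    (hf : ∀ A, IsCluster o A → ∃ k : ℤ, f (splitVector A) = k) : IsIntegral (latticeQ N) f := by
  intro x hx
  induction hx using AddSubgroup.closure_induction with
  | mem x hx =>
    rw [splitVectors_eq o hN] at hx
    obtain ⟨A, hA, rfl⟩ := hx
    exact hf A hA
  | zero => exact ⟨0, by simp⟩
  | add x y _ _ hx hy =>
    obtain ⟨a, ha⟩ := hx
    obtain ⟨b, hb⟩ := hy
    exact ⟨a + b, by rw [map_add, ha, hb]; push_cast; ring⟩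
  | neg x _ hx =>
    obtain ⟨a, ha⟩ := hx
    exact ⟨-a, by rw [map_neg, ha]; push_cast; ring⟩

lemma isIntegral_gromovForm (hN : 3 ≤ N) {i j k l : Fin N} (hij : i ≠ j) (hkl : k ≠ l)
    (hi : i ≠ o) (hj : j ≠ o) (hk : k ≠ o) (hl : l ≠ o) :
    IsIntegral (latticeQ N) (gromovForm hij hkl hi hj hk hl) :=
  isIntegral_latticeQ hN fun _ hA => ⟨_, gromovForm_splitVector _ _ _ _ _ _ hA.notMem⟩

/-- The vectors of a hierarchy have a dual system of integral linear forms. -/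
lemma IsHierarchy.exists_dual (hN : 3 ≤ N) {L : Finset (Finset (Fin N))} (hL : IsHierarchy o L) :
    ∃ φ : Finset (Fin N) → Q N →ₗ[ℝ] ℝ, (∀ A, IsIntegral (latticeQ N) (φ A)) ∧
      (∀ A ∈ L, φ A (splitVector A) = 1) ∧
      ∀ A ∈ L, ∀ B ∈ L, B ≠ A → φ A (splitVector B) = 0 := by
  have key : ∀ A, ∃ f : Q N →ₗ[ℝ] ℝ, IsIntegral (latticeQ N) f ∧ (A ∈ L → f (splitVector A) = 1) ∧
      (A ∈ L → ∀ B ∈ L, B ≠ A → f (splitVector B) = 0) := by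
    intro A
    by_cases hA : A ∈ L
    -- The form for these labels is one on `A` and zero on all other members, which do not tell `j`
    -- from `k` once they contain `i`.
    · obtain ⟨i, j, k, hiA, hjA, hkA, hi, hj, hk, hij, hsep⟩ := hL.exists_separating hN hA
      have hik : i ≠ k := fun h => hkA (h ▸ hiA)
      refine ⟨gromovForm hij hik hi hj hi hk, isIntegral_gromovForm hN _ _ _ _ _ _, fun _ => ?_,
        fun _ B hB hBA => ?_⟩
      · rw [gromovForm_splitVector _ _ _ _ _ _ (hL.isCluster A hA).notMem]
        simp [bothMem, hiA, hjA, hkA]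
      · rw [gromovForm_splitVector _ _ _ _ _ _ (hL.isCluster B hB).notMem]
        have h2 : bothMem B i j = bothMem B i k := by
          unfold bothMem
          congr 1
          exact propext (and_congr_right (hsep B hB hBA))
        simp [h2]
    · exact ⟨0, fun x _ => ⟨0, by simp⟩, fun h => absurd h hA, fun h => absurd h hA⟩
  choose φ h1 h2 h3 using key
  exact ⟨φ, h1, h2, h3⟩

/-- The pairs of labels different from `o`. -/
abbrev PairsAway (o : Fin N) : Type := {t : Pairs N // t.1.1 ≠ o ∧ t.1.2 ≠ o}

/-- The Gromov product form of two pairs. -/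
def pairForm (e e' : PairsAway o) : Q N →ₗ[ℝ] ℝ :=
  gromovForm e.1.2.ne e'.1.2.ne e.2.1 e.2.2 e'.2.1 e'.2.2

/-- The set of the two elements of a pair. -/
def pairSet (e : PairsAway o) : Finset (Fin N) := {e.1.1.1, e.1.1.2}

lemma notMem_pairSet (e : PairsAway o) : o ∉ pairSet e := by
  simp [pairSet, e.2.1.symm, e.2.2.symm]

lemma bothMem_pairSet (e e' : PairsAway o) :
    bothMem (pairSet e) e'.1.1.1 e'.1.1.2 = if e' = e then 1 else 0 := by
  unfold bothMem
  congr 1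
  rw [eq_iff_iff]
  constructor
  · rintro ⟨h1, h2⟩
    have h3 := e.1.2
    have h4 := e'.1.2
    simp only [pairSet, Finset.mem_insert, Finset.mem_singleton] at h1 h2
    refine Subtype.ext (Subtype.ext (Prod.ext ?_ ?_)) <;> rcases h1 with h1 | h1 <;>
      rcases h2 with h2 | h2 <;> first | assumption | (rw [h1, h2] at h4; exact absurd h4 (lt_irrefl _)) | (rw [h1, h2] at h4; exact absurd h4 h3.not_gt)
  · rintro rfl
    simp [pairSet]

/-- A second pair away from `o` needs a label outside `e` and `o`. For `N = 3` there is one pair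
only, and no cluster. -/
lemma card_pairSet_add_two_le {e e' : PairsAway o} (h : e ≠ e') : (pairSet e).card + 2 ≤ N := by
  obtain ⟨a, ha, hao⟩ : ∃ a, a ∉ pairSet e ∧ a ≠ o := by
    by_contra! h1
    have h2 := bothMem_pairSet e e'
    rw [if_neg h.symm, bothMem, if_pos] at h2
    · exact one_ne_zero h2
    · exact ⟨by_contra fun h3 => e'.2.1 (h1 _ h3), by_contra fun h3 => e'.2.2 (h1 _ h3)⟩
  have h1 := Finset.card_le_univ (insert o (insert a (pairSet e)))
  rw [Fintype.card_fin, Finset.card_insert_of_notMem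
    (by simp [hao.symm, notMem_pairSet]), Finset.card_insert_of_notMem ha] at h1
  exact h1

lemma isCluster_pairSet {e e' : PairsAway o} (h : e ≠ e') : IsCluster o (pairSet e) :=
  ⟨notMem_pairSet e, by rw [pairSet, Finset.card_pair e.1.2.ne], card_pairSet_add_two_le h⟩

/-- All Gromov products have the same value `t`, so `x i j = x i o + x j o - 2 * t`. This exhibits
`x` as `Phi` of the vector with entry `t` at `o` and `x i o - t` at `i`. -/
lemma eq_zero_of_pairForm (e0 : PairsAway o) (x : Q N)
    (h : ∀ e : PairsAway o, pairForm e e0 x = 0) : x = 0 := by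
  induction x using Submodule.Quotient.induction_on with
  | H x =>
    rw [Submodule.Quotient.mk_eq_zero]
    set t : ℝ := 2⁻¹ * (entry e0.1.1.1 o x + entry e0.1.1.2 o x - entry e0.1.1.1 e0.1.1.2 x)
      with ht
    refine ⟨fun i => if i = o then t else entry i o x - t, ?_⟩
    funext p
    change (if p.1.1 = o then t else _) + (if p.1.2 = o then t else _) = _
    have hp : entry p.1.1 p.1.2 x = x p := entry_of_lt p.2 x
    by_cases h1 : p.1.1 = o
    · have h2 : p.1.2 ≠ o := fun h2 => p.2.ne (h1.trans h2.symm)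
      rw [if_pos h1, if_neg h2, ← hp, h1, entry_symm o]
      ring
    · by_cases h2 : p.1.2 = o
      · rw [if_neg h1, if_pos h2, ← hp, h2]
        ring
      · rw [if_neg h1, if_neg h2, ← hp]
        have := h ⟨p, h1, h2⟩
        rw [pairForm, gromovForm_mk] at this
        linarith

lemma mem_closure_range_basis {V ι : Type*} [AddCommGroup V] [Module ℝ V] [Finite ι]
    (b : Module.Basis ι ℝ V) (x : V) :
    x ∈ AddSubgroup.closure (range b) ↔ ∀ i, ∃ k : ℤ, b.repr x i = k := by
  rw [← Submodule.span_int_eq_addSubgroupClosure, Submodule.mem_toAddSubgroup,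
    b.mem_span_iff_repr_mem ℤ]
  simp [eq_comm]

/-- The lattice `Λ_N` is generated by a basis of `Q N`. -/
lemma exists_basis_latticeQ (o : Fin N) (hN : 3 ≤ N) :
    ∃ (ι : Type) (_ : Fintype ι) (b : Module.Basis ι ℝ (Q N)),
      latticeQ N = AddSubgroup.closure (range b) := by
  classical
  obtain ⟨e0⟩ : Nonempty (PairsAway o) := by
    have h1 : 1 < ((Finset.univ : Finset (Fin N)).erase o).card := by
      rw [Finset.card_erase_of_mem (Finset.mem_univ _), Finset.card_univ, Fintype.card_fin]
      omega
    obtain ⟨a, ha, b, hb, hab⟩ := Finset.one_lt_card.1 h1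
    have ha := Finset.ne_of_mem_erase ha
    have hb := Finset.ne_of_mem_erase hb
    rcases lt_or_gt_of_ne hab with h | h
    · exact ⟨⟨⟨(a, b), h⟩, ha, hb⟩⟩
    · exact ⟨⟨⟨(b, a), h⟩, hb, ha⟩⟩
  -- The forms comparing the remaining pairs with `e0` are dual to the vectors of these pairs. They
  -- are integral coordinates on `Q N`, and the pair vectors lie in `Λ_N`, so the latter form a
  -- lattice basis.
  let ι := {e : PairsAway o // e ≠ e0}
  have hval : ∀ e e' : ι, pairForm e'.1 e0 (splitVector (pairSet e.1)) = if e' = e then 1 else 0 := by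
    intro e e'
    rw [pairForm, gromovForm_splitVector _ _ _ _ _ _ (notMem_pairSet _), bothMem_pairSet,
      bothMem_pairSet, if_neg (Ne.symm e.2)]
    have h : e'.1 = e.1 ↔ e' = e := Subtype.ext_iff.symm
    simp [h]
  let g : Q N →ₗ[ℝ] (ι → ℝ) := LinearMap.pi fun e => pairForm e.1 e0
  have hg : Function.Bijective g := by
    constructor
    · rw [injective_iff_map_eq_zero]
      intro x hx
      refine eq_zero_of_pairForm e0 x fun e => ?_
      by_cases he : e = e0
      · subst he
        induction x using Submodule.Quotient.induction_on with
        | H x => rw [pairForm, gromovForm_mk]; ring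
      · exact congrFun hx ⟨e, he⟩
    · intro c
      refine ⟨∑ e, c e • splitVector (pairSet e.1), ?_⟩
      funext e'
      change pairForm e'.1 e0 _ = _
      rw [map_sum, Finset.sum_eq_single e']
      · simp [hval]
      · intro e _ he
        simp [hval, he.symm]
      · simp
  let b : Module.Basis ι ℝ (Q N) := Module.Basis.ofEquivFun (LinearEquiv.ofBijective g hg)
  have hrepr : ∀ x e, b.repr x e = pairForm e.1 e0 x := fun x e => rfl
  refine ⟨ι, inferInstance, b, le_antisymm ?_ ?_⟩
  · intro x hx
    rw [mem_closure_range_basis]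
    intro e
    rw [hrepr]
    exact isIntegral_gromovForm hN _ _ _ _ _ _ x hx
  · rw [AddSubgroup.closure_le]
    rintro _ ⟨e, rfl⟩
    have : b e = splitVector (pairSet e.1) := by
      refine b.repr.injective (Finsupp.ext fun e' => ?_)
      rw [Module.Basis.repr_self, hrepr, hval, Finsupp.single_apply]
      simp [eq_comm]
    rw [this]
    exact splitVector_mem_latticeQ hN (isCluster_pairSet e.2)

lemma mem_intLattice {r : ℕ} {x : Fin r → ℝ} : x ∈ intLattice r ↔ ∀ i, ∃ k : ℤ, x i = k := by
  rw [intLattice, AddSubgroup.mem_pi]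
  refine ⟨fun h i => ?_, fun h i _ => ?_⟩
  · obtain ⟨k, hk⟩ := h i (mem_univ i)
    exact ⟨k, hk.symm⟩
  · obtain ⟨k, hk⟩ := h i
    exact ⟨k, hk.symm⟩

/-- The lattice of the ambient space of the product fan is generated by a basis. -/
lemma isLattice_prod (o : Fin N) (hN : 3 ≤ N) (r : ℕ) :
    IsLattice ((latticeQ N).prod (intLattice r)) := by
  obtain ⟨ι, _, b, hb⟩ := exists_basis_latticeQ o hN
  let b' : Module.Basis (ι ⊕ Fin r) ℝ (Q N × (Fin r → ℝ)) := b.prod (Pi.basisFun ℝ (Fin r))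
  refine ⟨_, b'.reindex (Fintype.equivFin _), ?_⟩
  rw [Module.Basis.range_reindex]
  ext ⟨x, y⟩
  rw [AddSubgroup.mem_prod, mem_closure_range_basis, Sum.forall, hb, mem_closure_range_basis,
    mem_intLattice]
  simp [b']

end TropModuli

end

noncomputable section

namespace TropModuli

variable {N : ℕ} {o : Fin N} {r : ℕ}

/-! ### The cones of the product fan -/

/-- The cone spanned by the vectors of a hierarchy. -/
def hierarchyCone (L : Finset (Finset (Fin N))) : Set (Q N) :=
  {x | ∃ c, IsCoef L c ∧ combination c = x}

lemma cone_eq_hierarchyCone (T : TreeType N) : T.cone = hierarchyCone (T.clusters o) := by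
  ext x
  constructor
  · rintro ⟨l, hl, rfl⟩
    refine ⟨T.coef o l, ⟨TreeType.coef_nonneg hl, fun A hA => ?_⟩, (distClass_eq T l).symm⟩
    by_contra h
    exact hA (TreeType.coef_eq_zero h)
  · rintro ⟨c, hc, rfl⟩
    refine ⟨fun e => c (T.below o ((T.edgeEquiv o).symm e)), fun e => hc.nonneg _, ?_⟩
    rw [distClass_eq (o := o)]
    congr 1
    funext A
    by_cases hA : A ∈ T.clusters o
    · obtain ⟨v, hv, rfl⟩ := TreeType.mem_clusters.1 hA
      rw [TreeType.coef_below _ ⟨v, hv⟩]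
      simp
    · rw [TreeType.coef_eq_zero hA]
      by_contra h
      exact hA (hc.mem A (Ne.symm h))

variable (o) in
lemma range_cone (hN : 3 ≤ N) :
    range TreeType.cone = {σ | ∃ L : Finset (Finset (Fin N)), IsHierarchy o L ∧
      σ = hierarchyCone L} := by
  ext σ
  constructor
  · rintro ⟨T, rfl⟩
    exact ⟨_, TreeType.isHierarchy_clusters, cone_eq_hierarchyCone T⟩
  · rintro ⟨L, hL, rfl⟩
    obtain ⟨T, rfl⟩ := exists_treeType hN hL
    exact ⟨T, cone_eq_hierarchyCone T⟩

variable (r) in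
/-- The product of the cone of a hierarchy with `ℝ^r`. -/
def prodCone (L : Finset (Finset (Fin N))) : Set (Q N × (Fin r → ℝ)) := hierarchyCone L ×ˢ univ

lemma mem_prodCone {L : Finset (Finset (Fin N))} {x : Q N × (Fin r → ℝ)} :
    x ∈ prodCone r L ↔ x.1 ∈ hierarchyCone L := by
  simp [prodCone]

variable (o r) in
lemma prod_cones (hN : 3 ≤ N) :
    ((m0Fan N).prod (WeightedFan.whole (Fin r → ℝ))).cones =
      {P | ∃ L : Finset (Finset (Fin N)), IsHierarchy o L ∧ P = prodCone r L} := by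
  ext P
  constructor
  · rintro ⟨σ, hσ, σ', rfl, rfl⟩
    obtain ⟨L, hL, rfl⟩ : σ ∈ {σ | ∃ L : Finset (Finset (Fin N)), IsHierarchy o L ∧
      σ = hierarchyCone L} := range_cone o hN ▸ hσ
    exact ⟨L, hL, rfl⟩
  · rintro ⟨L, hL, rfl⟩
    refine ⟨hierarchyCone L, ?_, univ, rfl, rfl⟩
    change _ ∈ range TreeType.cone
    rw [range_cone o hN]
    exact ⟨L, hL, rfl⟩

lemma IsCoef.single {L : Finset (Finset (Fin N))} {A : Finset (Fin N)} (hA : A ∈ L) :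
    IsCoef L (Pi.single A 1) := by
  refine ⟨fun B => ?_, fun B hB => ?_⟩
  · rw [Pi.single_apply]; split_ifs <;> norm_num
  · rw [Pi.single_apply] at hB
    split_ifs at hB with h
    · exact h ▸ hA
    · exact absurd rfl hB

lemma splitVector_mem_hierarchyCone {L : Finset (Finset (Fin N))} {A : Finset (Fin N)}
    (hA : A ∈ L) : splitVector A ∈ hierarchyCone L :=
  ⟨_, IsCoef.single hA, by rw [combination_single, one_smul]⟩

lemma zero_mem_hierarchyCone (L : Finset (Finset (Fin N))) : (0 : Q N) ∈ hierarchyCone L :=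
  ⟨0, ⟨fun _ => le_rfl, fun _ h => absurd rfl h⟩, map_zero _⟩

lemma IsCoef.combination_eq {L : Finset (Finset (Fin N))} {c : Finset (Fin N) → ℝ}
    (hc : IsCoef L c) : combination c = ∑ A ∈ L, c A • splitVector A := by
  rw [combination_apply]
  refine (Finset.sum_subset (Finset.subset_univ L) fun A _ hA => ?_).symm
  rw [not_not.1 (mt (hc.mem A) hA), zero_smul]

/-- A system of integral linear forms dual to the vectors of a hierarchy. -/
structure IsDual (L : Finset (Finset (Fin N))) (φ : Finset (Fin N) → Q N →ₗ[ℝ] ℝ) : Prop where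
  isIntegral : ∀ A, IsIntegral (latticeQ N) (φ A)
  self : ∀ A ∈ L, φ A (splitVector A) = 1
  other : ∀ A ∈ L, ∀ B ∈ L, B ≠ A → φ A (splitVector B) = 0

lemma IsHierarchy.exists_isDual (hN : 3 ≤ N) {L : Finset (Finset (Fin N))}
    (hL : IsHierarchy o L) : ∃ φ, IsDual L φ := by
  obtain ⟨φ, h1, h2, h3⟩ := hL.exists_dual hN
  exact ⟨φ, h1, h2, h3⟩

lemma IsDual.apply_sum {L : Finset (Finset (Fin N))} {φ : Finset (Fin N) → Q N →ₗ[ℝ] ℝ}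
    (hφ : IsDual L φ) (c : Finset (Fin N) → ℝ) {A : Finset (Fin N)} (hA : A ∈ L) :
    φ A (∑ B ∈ L, c B • splitVector B) = c A := by
  rw [map_sum, Finset.sum_eq_single A]
  · rw [map_smul, hφ.self A hA, smul_eq_mul, mul_one]
  · intro B hB hBA
    rw [map_smul, hφ.other A hA B hB hBA, smul_zero]
  · exact fun h => absurd hA h

/-- The dual forms are coordinates: the equation places `x` in the span of `L`, and the remaining
conditions are those on its coefficients. -/
lemma IsDual.mem_hierarchyCone_iff {L L0 : Finset (Finset (Fin N))}
    {φ : Finset (Fin N) → Q N →ₗ[ℝ] ℝ} (hφ : IsDual L φ) (h0 : L0 ⊆ L) (x : Q N) :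
    x ∈ hierarchyCone L0 ↔ x - ∑ A ∈ L, φ A x • splitVector A = 0 ∧ (∀ A ∈ L, 0 ≤ φ A x) ∧
      ∀ A ∈ L, A ∉ L0 → φ A x = 0 := by
  classical
  constructor
  · rintro ⟨c, hc, rfl⟩
    have hc' : IsCoef L c := ⟨hc.nonneg, fun A hA => h0 (hc.mem A hA)⟩
    have h1 : ∀ A ∈ L, φ A (combination c) = c A := fun A hA => by
      rw [hc'.combination_eq, hφ.apply_sum c hA]
    refine ⟨?_, fun A hA => ?_, fun A hA hA0 => ?_⟩
    · rw [sub_eq_zero, Finset.sum_congr rfl fun A hA => by rw [h1 A hA], ← hc'.combination_eq]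
    · rw [h1 A hA]; exact hc.nonneg A
    · rw [h1 A hA]
      exact not_not.1 (mt (hc.mem A) hA0)
  · rintro ⟨h1, h2, h3⟩
    have hc : IsCoef L0 fun A => if A ∈ L0 then φ A x else 0 := by
      refine ⟨fun A => ?_, fun A hA => ?_⟩
      · split_ifs with h
        · exact h2 A (h0 h)
        · exact le_rfl
      · by_contra h
        exact hA (if_neg h)
    refine ⟨_, hc, ?_⟩
    rw [hc.combination_eq]
    refine (Finset.sum_congr rfl fun A hA => by rw [if_pos hA]).trans
      ((Finset.sum_subset h0 fun A hA hA0 => ?_).trans (sub_eq_zero.1 h1).symm)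
    rw [h3 A hA hA0, zero_smul]

variable (r) in
lemma isFace_prodCone (hN : 3 ≤ N) {L L0 : Finset (Finset (Fin N))} (hL : IsHierarchy o L)
    (h0 : L0 ⊆ L) :
    IsFace ((latticeQ N).prod (intLattice r)) (prodCone r L0) (prodCone r L) := by
  obtain ⟨φ, hφ⟩ := hL.exists_isDual hN
  obtain ⟨ι, _, b, hb⟩ := exists_basis_latticeQ o hN
  have e := Fintype.equivFin ι
  -- The equalities are the lattice coordinates of `x - ∑ φ A x • splitVector A`. This projection
  -- preserves the lattice because the `φ A` are integral, so the equalities are integral too.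
  refine ⟨Fintype.card ι, L.card,
    fun i => (b.coord (e.symm i) ∘ₗ (LinearMap.id - ∑ A ∈ L, (φ A).smulRight (splitVector A))) ∘ₗ
      LinearMap.fst ℝ _ _,
    fun j => φ (L.equivFin.symm j).1 ∘ₗ LinearMap.fst ℝ _ _,
    {j | (L.equivFin.symm j).1 ∉ L0}, ?_, ?_, ?_, ?_⟩
  · rintro i ⟨x, y⟩ hx
    have hx := (AddSubgroup.mem_prod.1 hx).1
    have h1 : x - ∑ A ∈ L, φ A x • splitVector A ∈ latticeQ N := by
      refine AddSubgroup.sub_mem _ hx (AddSubgroup.sum_mem _ fun A hA => ?_)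
      obtain ⟨k, hk⟩ := hφ.isIntegral A x hx
      rw [hk, Int.cast_smul_eq_zsmul]
      exact AddSubgroup.zsmul_mem _ (splitVector_mem_latticeQ hN (hL.isCluster A hA)) k
    rw [hb, mem_closure_range_basis] at h1
    obtain ⟨k, hk⟩ := h1 (e.symm i)
    refine ⟨k, hk ▸ ?_⟩
    simp
  · rintro j ⟨x, y⟩ hx
    exact hφ.isIntegral _ x (AddSubgroup.mem_prod.1 hx).1
  all_goals
    ext ⟨x, y⟩
    have h1 : (∀ i, b.coord (e.symm i) (x - ∑ A ∈ L, φ A x • splitVector A) = 0) ↔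
        x - ∑ A ∈ L, φ A x • splitVector A = 0 := by
      rw [← b.forall_coord_eq_zero_iff]
      exact e.symm.forall_congr_right (q := fun i => b.coord i _ = 0)
    have h2 : (∀ j, 0 ≤ φ (L.equivFin.symm j).1 x) ↔ ∀ A ∈ L, 0 ≤ φ A x :=
      ⟨fun h A hA => by simpa using h (L.equivFin ⟨A, hA⟩), fun h j => h _ (L.equivFin.symm j).2⟩
    have h3 : (∀ j ∈ {j | (L.equivFin.symm j).1 ∉ L0}, φ (L.equivFin.symm j).1 x = 0) ↔
        ∀ A ∈ L, A ∉ L0 → φ A x = 0 :=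
      ⟨fun h A hA hA0 => by simpa using h (L.equivFin ⟨A, hA⟩) (by simpa using hA0),
        fun h j hj => h _ (L.equivFin.symm j).2 hj⟩
    simp only [mem_prodCone, solutionSet, mem_ofPred_eq, LinearMap.comp_apply,
      LinearMap.fst_apply, LinearMap.sub_apply, LinearMap.id_apply, LinearMap.sum_apply,
      LinearMap.smulRight_apply]
  · rw [hφ.mem_hierarchyCone_iff subset_rfl, h1, h2]
    exact ⟨fun h => ⟨h.1, h.2.1⟩, fun h => ⟨h.1, h.2, fun A hA hA' => absurd hA hA'⟩⟩
  · rw [hφ.mem_hierarchyCone_iff h0, h1, h2]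
    exact ⟨fun h => ⟨⟨h.1, h.2.1⟩, h3.2 h.2.2⟩, fun h => ⟨h.1.1, h.1.2, h3.1 h.2⟩⟩

lemma _root_.TropModuli.IsFace.isCone {V : Type*} [AddCommGroup V] [Module ℝ V]
    {Λ : AddSubgroup V} {τ σ : Set V} (h : IsFace Λ τ σ) : IsCone Λ σ := by
  obtain ⟨p, m, f, g, J, hf, hg, h1, -⟩ := h
  exact ⟨p, m, f, g, hf, hg, h1⟩

/-- In any presentation an inequality vanishes on the linear part `ℝ^r`, and it vanishes on a
non-negative combination only if it does so on each ray in use. So it cuts out the cone of a subset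
of `L`. -/
lemma exists_of_isFace {Λ : AddSubgroup (Q N × (Fin r → ℝ))} {L : Finset (Finset (Fin N))}
    {τ : Set (Q N × (Fin r → ℝ))} (h : IsFace Λ τ (prodCone r L)) :
    ∃ L0 ⊆ L, τ = prodCone r L0 := by
  classical
  obtain ⟨p, m, f, g, J, -, -, h1, h2⟩ := h
  have hnonneg : ∀ x ∈ prodCone r L, ∀ j, 0 ≤ g j x := fun x hx => by
    rw [h1] at hx
    exact hx.2
  have hsnd : ∀ j y, g j (0, y) = 0 := fun j y => by
    have h3 := hnonneg (0, y) (mem_prodCone.2 (zero_mem_hierarchyCone L)) j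
    have h4 := hnonneg (0, -y) (mem_prodCone.2 (zero_mem_hierarchyCone L)) j
    have h5 : ((0 : Q N), -y) = -(0, y) := by simp
    rw [h5, map_neg] at h4
    linarith
  have hval : ∀ j c y, IsCoef L c → g j (combination c, y) =
      ∑ A ∈ L, c A * g j (splitVector A, 0) := fun j c y hc => by
    have h3 : (combination c, y) = LinearMap.inl ℝ (Q N) (Fin r → ℝ) (combination c) + (0, y) := by
      simp
    rw [h3, map_add, hsnd, add_zero, hc.combination_eq, map_sum, map_sum]
    refine Finset.sum_congr rfl fun A _ => ?_
    rw [map_smul, map_smul]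
    rfl
  have hterm : ∀ j, ∀ A ∈ L, 0 ≤ g j (splitVector A, 0) := fun j A hA =>
    hnonneg _ (mem_prodCone.2 (splitVector_mem_hierarchyCone hA)) j
  refine ⟨L.filter fun A => ∀ j ∈ J, g j (splitVector A, 0) = 0, Finset.filter_subset _ _, ?_⟩
  rw [h2, ← h1]
  ext ⟨x, y⟩
  simp only [mem_ofPred_eq, mem_prodCone]
  constructor
  · rintro ⟨⟨c, hc, rfl⟩, hJ⟩
    refine ⟨c, ⟨hc.nonneg, fun A hA => Finset.mem_filter.2 ⟨hc.mem A hA, fun j hj => ?_⟩⟩, rfl⟩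
    have h3 := hJ j hj
    rw [hval j c y hc, Finset.sum_eq_zero_iff_of_nonneg fun A hA =>
      mul_nonneg (hc.nonneg A) (hterm j A hA)] at h3
    exact (mul_eq_zero.1 (h3 A (hc.mem A hA))).resolve_left hA
  · rintro ⟨c, hc, rfl⟩
    have hc' : IsCoef L c := ⟨hc.nonneg, fun A hA => (Finset.mem_filter.1 (hc.mem A hA)).1⟩
    refine ⟨⟨c, hc', rfl⟩, fun j hj => ?_⟩
    rw [hval j c y hc']
    refine Finset.sum_eq_zero fun A _ => ?_
    by_cases hA : c A = 0
    · rw [hA, zero_mul]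
    · rw [(Finset.mem_filter.1 (hc.mem A hA)).2 j hj, mul_zero]

lemma subset_of_prodCone_subset (hN : 3 ≤ N) {L L' : Finset (Finset (Fin N))}
    (hL : IsHierarchy o L) (hL' : IsHierarchy o L') (h : prodCone r L ⊆ prodCone r L') :
    L ⊆ L' := by
  intro A hA
  have h1 : (splitVector A, (0 : Fin r → ℝ)) ∈ prodCone r L :=
    mem_prodCone.2 (splitVector_mem_hierarchyCone hA)
  obtain ⟨c, hc, h2⟩ := mem_prodCone.1 (h h1)
  have h3 := eq_of_combination_eq hN hL' hL hc (IsCoef.single hA)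
    (by rw [h2, combination_single, one_smul])
  refine hc.mem A ?_
  rw [h3, Pi.single_eq_same]
  exact one_ne_zero

variable (o r) in
lemma prodCone_injOn (hN : 3 ≤ N) : InjOn (prodCone (N := N) r) {L | IsHierarchy o L} :=
  fun _ hL _ hL' h => (subset_of_prodCone_subset hN hL hL' h.le).antisymm
    (subset_of_prodCone_subset hN hL' hL h.ge)

lemma prodCone_inter (hN : 3 ≤ N) {L L' : Finset (Finset (Fin N))} (hL : IsHierarchy o L)
    (hL' : IsHierarchy o L') : prodCone r L ∩ prodCone r L' = prodCone r (L ∩ L') := by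
  ext ⟨x, y⟩
  rw [mem_inter_iff, mem_prodCone, mem_prodCone, mem_prodCone]
  constructor
  · rintro ⟨⟨c, hc, rfl⟩, ⟨c', hc', h⟩⟩
    have h1 := eq_of_combination_eq hN hL' hL hc' hc h
    exact ⟨c, ⟨hc.nonneg, fun A hA =>
      Finset.mem_inter.2 ⟨hc.mem A hA, hc'.mem A (h1 ▸ hA)⟩⟩, rfl⟩
  · rintro ⟨c, hc, rfl⟩
    exact ⟨⟨c, ⟨hc.nonneg, fun A hA => (Finset.mem_inter.1 (hc.mem A hA)).1⟩, rfl⟩,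
      ⟨c, ⟨hc.nonneg, fun A hA => (Finset.mem_inter.1 (hc.mem A hA)).2⟩, rfl⟩⟩

lemma isFan_prod (o : Fin N) (r : ℕ) (hN : 3 ≤ N) :
    IsFan ((latticeQ N).prod (intLattice r))
      ((m0Fan N).prod (WeightedFan.whole (Fin r → ℝ))).cones := by
  rw [prod_cones o r hN]
  refine ⟨?_, ?_, ?_, ?_⟩
  · refine (Set.toFinite (range (prodCone (N := N) r))).subset ?_
    rintro _ ⟨L, -, rfl⟩
    exact ⟨L, rfl⟩
  · rintro _ ⟨L, hL, rfl⟩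
    exact (isFace_prodCone r hN hL subset_rfl).isCone
  · rintro _ ⟨L, hL, rfl⟩ τ hτ
    obtain ⟨L0, h0, rfl⟩ := exists_of_isFace hτ
    exact ⟨L0, hL.mono h0, rfl⟩
  · rintro _ ⟨L, hL, rfl⟩ _ ⟨L', hL', rfl⟩
    rw [prodCone_inter hN hL hL']
    exact ⟨isFace_prodCone r hN hL Finset.inter_subset_left,
      isFace_prodCone r hN hL' Finset.inter_subset_right⟩

/-! ### Spans and lattices of the cones -/

lemma mem_span_hierarchyCone {L : Finset (Finset (Fin N))} {x : Q N} :
    x ∈ Submodule.span ℝ (hierarchyCone L) ↔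
      ∃ c : Finset (Fin N) → ℝ, x = ∑ A ∈ L, c A • splitVector A := by
  constructor
  · intro h
    induction h using Submodule.span_induction with
    | mem x hx =>
      obtain ⟨c, hc, rfl⟩ := hx
      exact ⟨c, hc.combination_eq⟩
    | zero => exact ⟨0, by simp⟩
    | add x y _ _ hx hy =>
      obtain ⟨c, rfl⟩ := hx
      obtain ⟨d, rfl⟩ := hy
      exact ⟨c + d, by simp [add_smul, Finset.sum_add_distrib]⟩
    | smul a x _ hx =>
      obtain ⟨c, rfl⟩ := hx
      exact ⟨a • c, by simp [Finset.smul_sum, mul_smul]⟩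
  · rintro ⟨c, rfl⟩
    exact Submodule.sum_mem _ fun A hA => Submodule.smul_mem _ _
      (Submodule.subset_span (splitVector_mem_hierarchyCone hA))

lemma mem_span_prodCone {L : Finset (Finset (Fin N))} {x : Q N × (Fin r → ℝ)} :
    x ∈ Submodule.span ℝ (prodCone r L) ↔
      ∃ c : Finset (Fin N) → ℝ, x.1 = ∑ A ∈ L, c A • splitVector A := by
  rw [← mem_span_hierarchyCone]
  constructor
  · intro h
    have h1 := Submodule.mem_map_of_mem (f := LinearMap.fst ℝ (Q N) (Fin r → ℝ)) h
    rw [Submodule.map_span] at h1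
    refine Submodule.span_mono ?_ h1
    rintro _ ⟨y, hy, rfl⟩
    exact mem_prodCone.1 hy
  · intro h
    have h1 := Submodule.mem_map_of_mem (f := LinearMap.inl ℝ (Q N) (Fin r → ℝ)) h
    rw [Submodule.map_span] at h1
    have h2 : (x.1, (0 : Fin r → ℝ)) ∈ Submodule.span ℝ (prodCone r L) := by
      refine Submodule.span_mono ?_ h1
      rintro _ ⟨y, hy, rfl⟩
      exact mem_prodCone.2 hy
    have h3 : ((0 : Q N), x.2) ∈ Submodule.span ℝ (prodCone r L) :=
      Submodule.subset_span (mem_prodCone.2 (zero_mem_hierarchyCone L))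
    have h4 : x = (x.1, 0) + (0, x.2) := by simp
    rw [h4]
    exact Submodule.add_mem _ h2 h3

lemma coneDim_prodCone (hN : 3 ≤ N) {L : Finset (Finset (Fin N))} (hL : IsHierarchy o L) :
    coneDim (prodCone r L) = L.card + r := by
  obtain ⟨φ, hφ⟩ := hL.exists_isDual hN
  have h1 : LinearIndependent ℝ fun A : L => splitVector A.1 := by
    rw [Fintype.linearIndependent_iff]
    intro c hc A
    have h2 : ∑ B ∈ L, (if h : B ∈ L then c ⟨B, h⟩ else 0) • splitVector B = 0 := by
      rw [← Finset.sum_coe_sort, ← hc]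
      exact Finset.sum_congr rfl fun B _ => by rw [dif_pos B.2]
    have h3 := hφ.apply_sum (fun B => if h : B ∈ L then c ⟨B, h⟩ else 0) A.2
    rw [h2, map_zero, dif_pos A.2] at h3
    exact h3.symm
  have h2 := linearIndependent_inl_union_inr' h1 (Pi.basisFun ℝ (Fin r)).linearIndependent
  have h3 : Submodule.span ℝ (prodCone r L) = Submodule.span ℝ (range (Sum.elim
      (LinearMap.inl ℝ (Q N) (Fin r → ℝ) ∘ fun A : L => splitVector A.1)
      (LinearMap.inr ℝ (Q N) (Fin r → ℝ) ∘ Pi.basisFun ℝ (Fin r)))) := by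
    apply le_antisymm
    · rintro ⟨x, y⟩ hx
      obtain ⟨c, hc⟩ := mem_span_prodCone.1 hx
      have h4 : (x, y) = LinearMap.inl ℝ (Q N) (Fin r → ℝ) x + LinearMap.inr ℝ (Q N) (Fin r → ℝ) y := by
        simp
      rw [h4, show x = ∑ A ∈ L, c A • splitVector A from hc,
        ← (Pi.basisFun ℝ (Fin r)).sum_repr y, map_sum, map_sum]
      refine Submodule.add_mem _ (Submodule.sum_mem _ fun A hA => ?_)
        (Submodule.sum_mem _ fun i _ => ?_)
      · rw [map_smul]
        exact Submodule.smul_mem _ _ (Submodule.subset_span ⟨.inl ⟨A, hA⟩, rfl⟩)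
      · rw [map_smul]
        exact Submodule.smul_mem _ _ (Submodule.subset_span ⟨.inr i, rfl⟩)
    · rw [Submodule.span_le]
      rintro _ ⟨A | i, rfl⟩
      · exact Submodule.subset_span (mem_prodCone.2 (splitVector_mem_hierarchyCone A.2))
      · exact Submodule.subset_span (mem_prodCone.2 (zero_mem_hierarchyCone L))
  rw [coneDim, h3, finrank_span_eq_card h2]
  simp

/-- A lattice point `x` of the span has the integers `φ A x` as coefficients, so the marking vectors
generate the lattice of the cone. -/
lemma weight_prodCone (hN : 3 ≤ N) {L : Finset (Finset (Fin N))} (hL : IsHierarchy o L) :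
    ((m0Fan N).prod (WeightedFan.whole (Fin r → ℝ))).weight (prodCone r L) = 1 := by
  obtain ⟨φ, hφ⟩ := hL.exists_isDual hN
  change (AddSubgroup.closure (splitVectors N ∩ Prod.fst '' prodCone r L)).relIndex
    (coneLattice (latticeQ N) (Prod.fst '' prodCone r L)) * 1 = 1
  rw [mul_one, prodCone, fst_image_prod _ univ_nonempty, AddSubgroup.relIndex_eq_one]
  rintro x ⟨hx, hx'⟩
  obtain ⟨c, hc⟩ := mem_span_hierarchyCone.1 hx'
  rw [hc]
  refine AddSubgroup.sum_mem _ fun A hA => ?_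
  obtain ⟨k, hk⟩ := hφ.isIntegral A x hx
  rw [hc, hφ.apply_sum c hA] at hk
  rw [hk, Int.cast_smul_eq_zsmul]
  have hmem : splitVector A ∈ splitVectors N ∩ hierarchyCone L :=
    ⟨by rw [splitVectors_eq o hN]; exact ⟨A, hL.isCluster A hA, rfl⟩,
      splitVector_mem_hierarchyCone hA⟩
  exact AddSubgroup.zsmul_mem _ (AddSubgroup.subset_closure hmem) k

/-- The dual form of `S` reads off the coefficient at `S`. It is integral, vanishes on the face and
is one on `splitVector S`, so this vector generates the quotient lattice. -/
lemma isNormalVector_prodCone (hN : 3 ≤ N) {L : Finset (Finset (Fin N))} {S : Finset (Fin N)}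
    (hS : S ∉ L) (hL : IsHierarchy o (insert S L)) :
    IsNormalVector ((latticeQ N).prod (intLattice r)) (prodCone r L) (prodCone r (insert S L))
      (splitVector S, 0) := by
  obtain ⟨φ, hφ⟩ := hL.exists_isDual hN
  have hS' : S ∈ insert S L := Finset.mem_insert_self S L
  have hu : (splitVector S, (0 : Fin r → ℝ)) ∈ (latticeQ N).prod (intLattice r) :=
    AddSubgroup.mem_prod.2 ⟨splitVector_mem_latticeQ hN (hL.isCluster S hS'),
      AddSubgroup.zero_mem _⟩
  have hzero : ∀ c, IsCoef L c → φ S (combination c) = 0 := fun c hc => by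
    have hc' : IsCoef (insert S L) c := ⟨hc.nonneg, fun A hA => Finset.mem_insert_of_mem (hc.mem A hA)⟩
    rw [hc'.combination_eq, hφ.apply_sum c hS']
    exact not_not.1 (mt (hc.mem S) hS)
  refine ⟨⟨hu, ?_⟩, ?_, φ S ∘ₗ LinearMap.fst ℝ _ _, ?_, ?_, ?_, ?_⟩
  · exact Submodule.subset_span (mem_prodCone.2 (splitVector_mem_hierarchyCone hS'))
  · rintro x ⟨hx, hx'⟩
    obtain ⟨k, hk⟩ := hφ.isIntegral S x.1 (AddSubgroup.mem_prod.1 hx).1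
    refine ⟨k, AddSubgroup.sub_mem _ hx (AddSubgroup.zsmul_mem _ hu k), ?_⟩
    obtain ⟨c, hc⟩ := mem_span_prodCone.1 hx'
    refine mem_span_prodCone.2 ⟨c, ?_⟩
    rw [hc, hφ.apply_sum c hS'] at hk
    rw [Prod.fst_sub, Prod.smul_fst, hc, Finset.sum_insert hS, hk, Int.cast_smul_eq_zsmul]
    abel
  · exact fun x hx => hφ.isIntegral S x.1 (AddSubgroup.mem_prod.1 hx).1
  · intro x hx
    obtain ⟨c, hc, h1⟩ := mem_prodCone.1 hx
    change φ S x.1 = 0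
    rw [← h1, hzero c hc]
  · intro x hx
    obtain ⟨c, hc, h1⟩ := mem_prodCone.1 hx
    change 0 ≤ φ S x.1
    rw [← h1, hc.combination_eq, hφ.apply_sum c hS']
    exact hc.nonneg S
  · change 0 < φ S (splitVector S)
    rw [hφ.self S hS']
    exact one_pos

/-! ### The balancing condition -/

lemma splitVector_mem_span {L : Finset (Finset (Fin N))} {B : Finset (Fin N)} (hB : B ∈ full o L) :
    splitVector B ∈ Submodule.span ℝ (hierarchyCone L) := by
  rcases IsHierarchy.mem_full.1 hB with rfl | hB | ⟨i, -, rfl⟩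
  · rw [splitVector_univ]
    exact Submodule.zero_mem _
  · exact Submodule.subset_span (splitVector_mem_hierarchyCone hB)
  · rw [splitVector_singleton]
    exact Submodule.zero_mem _

/-- The maximal cones around `L` resolve its four-valent vertex in three ways, all with weight one.
By `splitVector_union` their normal vectors add up to the vectors of the four edges or ends at that
vertex, which lie in the span of the cone. -/
lemma balanced_prodCone (hN : 3 ≤ N) {L : Finset (Finset (Fin N))} (hL : IsHierarchy o L)
    (hcard : L.card + 4 = N) :
    ∃ u : Set (Q N × (Fin r → ℝ)) → Q N × (Fin r → ℝ),
      (∀ σ ∈ ((m0Fan N).prod (WeightedFan.whole (Fin r → ℝ))).cones, coneDim σ = r + N - 3 →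
        IsFace ((latticeQ N).prod (intLattice r)) (prodCone r L) σ →
        IsNormalVector ((latticeQ N).prod (intLattice r)) (prodCone r L) σ (u σ)) ∧
      ∑ᶠ σ ∈ {σ | σ ∈ ((m0Fan N).prod (WeightedFan.whole (Fin r → ℝ))).cones ∧
          coneDim σ = r + N - 3 ∧
          IsFace ((latticeQ N).prod (intLattice r)) (prodCone r L) σ},
        ((m0Fan N).prod (WeightedFan.whole (Fin r → ℝ))).weight σ • u σ
        ∈ Submodule.span ℝ (prodCone r L) := by
  classical
  have hinj : ∀ S S', S ∉ L → IsHierarchy o (insert S L) → S' ∉ L → IsHierarchy o (insert S' L) →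
      prodCone r (insert S L) = prodCone r (insert S' L) → S = S' := by
    intro S S' hS hSL hS' hSL' h
    have h1 : insert S L = insert S' L := prodCone_injOn o r hN hSL hSL' h
    have h2 : S ∈ insert S' L := h1 ▸ Finset.mem_insert_self S L
    exact (Finset.mem_insert.1 h2).resolve_right hS
  let u : Set (Q N × (Fin r → ℝ)) → Q N × (Fin r → ℝ) := fun σ =>
    if h : ∃ S, S ∉ L ∧ IsHierarchy o (insert S L) ∧ σ = prodCone r (insert S L) then
      (splitVector h.choose, 0) else 0
  have hu : ∀ S, S ∉ L → IsHierarchy o (insert S L) →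
      u (prodCone r (insert S L)) = (splitVector S, 0) := by
    intro S hS hSL
    have h : ∃ S', S' ∉ L ∧ IsHierarchy o (insert S' L) ∧
      prodCone r (insert S L) = prodCone r (insert S' L) := ⟨S, hS, hSL, rfl⟩
    have h1 : h.choose = S := (hinj _ _ hS hSL h.choose_spec.1 h.choose_spec.2.1
      h.choose_spec.2.2).symm
    simp only [u]
    rw [dif_pos h, h1]
  have hface : ∀ σ, (σ ∈ ((m0Fan N).prod (WeightedFan.whole (Fin r → ℝ))).cones ∧
      coneDim σ = r + N - 3 ∧ IsFace ((latticeQ N).prod (intLattice r)) (prodCone r L) σ) ↔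
      ∃ S, (S ∉ L ∧ IsHierarchy o (insert S L)) ∧ prodCone r (insert S L) = σ := by
    intro σ
    rw [prod_cones o r hN]
    constructor
    · rintro ⟨⟨L', hL', rfl⟩, h1, h2⟩
      rw [coneDim_prodCone hN hL'] at h1
      obtain ⟨L0, h3, h4⟩ := exists_of_isFace h2
      obtain rfl : L = L0 := prodCone_injOn o r hN hL (hL'.mono h3) h4
      obtain ⟨S, hS, rfl⟩ := Finset.exists_eq_insert_iff.2 ⟨h3, by omega⟩
      exact ⟨S, ⟨hS, hL'⟩, rfl⟩
    · rintro ⟨S, ⟨hS, hSL⟩, rfl⟩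
      refine ⟨⟨_, hSL, rfl⟩, ?_, isFace_prodCone r hN hSL (Finset.subset_insert S L)⟩
      rw [coneDim_prodCone hN hSL, Finset.card_insert_of_notMem hS]
      omega
  refine ⟨u, fun σ h1 h2 h3 => ?_, ?_⟩
  · obtain ⟨S, ⟨hS, hSL⟩, rfl⟩ := (hface σ).1 ⟨h1, h2, h3⟩
    rw [hu S hS hSL]
    exact isNormalVector_prodCone hN hS hSL
  · obtain ⟨A, hA, B, C, D, hB, hC, hD, -, -, -, hBC, hBD, hCD, hunion, hne1, hne2, hne3, hthree⟩ :=
      hL.exists_three hN hcard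
    have hset : {σ | σ ∈ ((m0Fan N).prod (WeightedFan.whole (Fin r → ℝ))).cones ∧
        coneDim σ = r + N - 3 ∧
        IsFace ((latticeQ N).prod (intLattice r)) (prodCone r L) σ} =
        (fun S => prodCone r (insert S L)) ''
          (({B ∪ C, B ∪ D, C ∪ D} : Finset (Finset (Fin N))) : Set (Finset (Fin N))) := by
      ext σ
      rw [mem_ofPred_eq, hface]
      simp only [hthree]
      rfl
    have hinj' : InjOn (fun S => prodCone r (insert S L))
        (({B ∪ C, B ∪ D, C ∪ D} : Finset (Finset (Fin N))) : Set (Finset (Fin N))) := by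
      intro S hS S' hS' h
      have h1 := (hthree S).2 hS
      have h2 := (hthree S').2 hS'
      exact hinj S S' h1.1 h1.2 h2.1 h2.2 h
    rw [hset, finsum_mem_image hinj', finsum_mem_coe_finset]
    have hsum : ∑ S ∈ ({B ∪ C, B ∪ D, C ∪ D} : Finset (Finset (Fin N))),
        ((m0Fan N).prod (WeightedFan.whole (Fin r → ℝ))).weight (prodCone r (insert S L)) •
          u (prodCone r (insert S L)) =
        (splitVector (B ∪ C) + splitVector (B ∪ D) + splitVector (C ∪ D), 0) := by
      rw [Finset.sum_congr rfl fun S hS => by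
        have h := (hthree S).2 hS
        rw [weight_prodCone hN h.2, hu S h.1 h.2, one_smul],
        Finset.sum_insert (by simp [hne1, hne2]), Finset.sum_insert (by simp [hne3]),
        Finset.sum_singleton]
      simp [add_assoc]
    rw [hsum, splitVector_union hBC hBD hCD, ← hunion, mem_span_prodCone,
      ← mem_span_hierarchyCone]
    refine Submodule.add_mem _ (Submodule.add_mem _ (Submodule.add_mem _ ?_
      (splitVector_mem_span hB)) (splitVector_mem_span hC)) (splitVector_mem_span hD)
    -- The union of the three children is `A.erase o`: at the root it is the complement of `{o}`,
    -- whose class is zero, and elsewhere it is `A` itself.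
    rcases Finset.mem_insert.1 hA with rfl | hA
    · rw [splitVector_erase_univ]
      exact Submodule.zero_mem _
    · rw [Finset.erase_eq_of_notMem (hL.isCluster A hA).notMem]
      exact Submodule.subset_span (splitVector_mem_hierarchyCone hA)

/-- The product of the fan of rational curves with `ℝ^r` is a tropical fan. -/
theorem isTropical_prod (o : Fin N) (r : ℕ) (hN : 3 ≤ N) :
    ((m0Fan N).prod (WeightedFan.whole (Fin r → ℝ))).IsTropical
      ((latticeQ N).prod (intLattice r)) (r + N - 3) where
  isLattice := isLattice_prod o hN r
  isFan := isFan_prod o r hN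
  nonempty := by
    rw [prod_cones o r hN]
    exact ⟨_, ∅, isHierarchy_empty, rfl⟩
  pure := by
    rw [prod_cones o r hN]
    rintro _ ⟨L, hL, rfl⟩ hmax
    rw [coneDim_prodCone hN hL]
    have h1 := hL.card_add_three_le hN
    by_contra h2
    obtain ⟨S, hS, hSL⟩ := hL.exists_insert hN (by omega)
    have h3 := hmax (prodCone r (insert S L)) ⟨_, hSL, rfl⟩ fun x hx => by
      obtain ⟨c, hc, h⟩ := mem_prodCone.1 hx
      exact mem_prodCone.2 ⟨c, ⟨hc.nonneg, fun A hA => Finset.mem_insert_of_mem (hc.mem A hA)⟩, h⟩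
    have h4 : insert S L = L := prodCone_injOn o r hN hSL hL h3
    exact hS (h4 ▸ Finset.mem_insert_self S L)
  weight_pos := by
    rw [prod_cones o r hN]
    rintro _ ⟨L, hL, rfl⟩ -
    rw [weight_prodCone hN hL]
    exact one_pos
  balanced := by
    intro τ hτ hdim
    obtain ⟨L, hL, rfl⟩ : τ ∈ {P | ∃ L : Finset (Finset (Fin N)), IsHierarchy o L ∧
      P = prodCone r L} := prod_cones o r hN ▸ hτ
    rw [coneDim_prodCone hN hL] at hdim
    exact balanced_prodCone hN hL (by omega)

end TropModuli

end

noncomputable section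

namespace TropModuli

open TreeType

variable {r n s : ℕ} {Δ : Fin s → Fin r → ℤ} {o : Fin (n + s)}

/-! ### Directions of the bounded edges -/

variable (n Δ) in
/-- The sum of the directions of the ends with labels in `A`. -/
def dirSum (A : Finset (Fin (n + s))) : Fin r → ℤ := ∑ i ∈ A, endDir n Δ i

lemma dirSum_univ (hsum : ∑ i, Δ i = 0) : dirSum n Δ Finset.univ = 0 := by
  simp [dirSum, endDir, Fin.sum_univ_add, hsum]

lemma finsum_cond_eq_sum {ι M : Type*} [AddCommMonoid M] [Fintype ι] (p : ι → Prop)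
    [DecidablePred p] (f : ι → M) : ∑ᶠ (i) (_ : p i), f i = ∑ i, if p i then f i else 0 := by
  rw [finsum_eq_sum_of_fintype]
  exact Finset.sum_congr rfl fun i _ => finsum_eq_if

/-- The balancing condition determines the directions of the bounded edges. -/
lemma LabType.dir_eq (α : LabType n Δ) {d : α.G.Dart} (hd : d.snd ≠ α.leg o)
    (h : α.par o d.snd = d.fst) : α.dir d = dirSum n Δ (α.below o d.snd) := by
  classical
  have : Fintype α.V := Fintype.ofFinite _
  set v := d.snd
  -- Sum the balancing condition over the subtree at `v`. Edges inside occur in both orientations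
  -- and cancel, leaving the edge to the parent and the ends below `v`.
  have hbal : ∑ w ∈ Finset.univ.filter (α.IsAnc o v),
      ((∑ e : α.G.Dart, if e.fst = w then α.dir e else 0) +
        ∑ i, if α.leg i = w then endDir n Δ i else 0) = 0 :=
    Finset.sum_eq_zero fun w _ => by
      have := α.balanced w
      rwa [finsum_cond_eq_sum, finsum_cond_eq_sum] at this
  rw [Finset.sum_add_distrib, Finset.sum_comm,
    Finset.sum_comm (t := (Finset.univ : Finset (Fin (n + s))))] at hbal
  simp only [Finset.sum_ite_eq, Finset.mem_filter, Finset.mem_univ, true_and] at hbal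
  have h1 : (∑ i, if α.IsAnc o v (α.leg i) then endDir n Δ i else 0) =
      dirSum n Δ (α.below o v) := by
    rw [dirSum, below, Finset.sum_filter]
  have h2 : ∑ e : α.G.Dart, (if α.IsAnc o v e.fst ∧ α.IsAnc o v e.snd then α.dir e else 0) = 0 := by
    refine Finset.sum_involution (fun e _ => e.symm) (fun e _ => ?_) (fun e _ _ => e.symm_ne)
      (fun _ _ => Finset.mem_univ _) (fun e _ => e.symm_symm)
    rw [α.dir_symm]
    by_cases h3 : α.IsAnc o v e.fst <;> by_cases h4 : α.IsAnc o v e.snd <;> simp [h3, h4]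
  have h3 : ∑ e : α.G.Dart, (if α.IsAnc o v e.fst ∧ ¬ α.IsAnc o v e.snd then α.dir e else 0) =
      α.dir d.symm := by
    rw [Finset.sum_eq_single d.symm]
    · rw [if_pos]
      refine ⟨α.isAnc_refl o v, ?_⟩
      change ¬ α.IsAnc o v d.fst
      rw [← h]
      exact not_isAnc_par hd
    · intro e _ hne
      rw [if_neg]
      rintro ⟨h4, h5⟩
      have h6 : s(e.fst, e.snd) = s(α.par o v, v) := by
        by_contra h6
        exact h5 ((isAnc_iff_of_adj e.adj h6).1 h4)
      rw [Sym2.eq_iff] at h6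
      rcases h6 with ⟨h7, h8⟩ | ⟨h7, h8⟩
      · exact h5 (h8 ▸ α.isAnc_refl o v)
      · refine hne (SimpleGraph.Dart.ext _ _ (Prod.ext h7 ?_))
        exact h8.trans h
    · simp
  have h4 : ∑ e : α.G.Dart, (if α.IsAnc o v e.fst then α.dir e else 0) =
      ∑ e : α.G.Dart, (if α.IsAnc o v e.fst ∧ α.IsAnc o v e.snd then α.dir e else 0) +
      ∑ e : α.G.Dart, (if α.IsAnc o v e.fst ∧ ¬ α.IsAnc o v e.snd then α.dir e else 0) := by
    rw [← Finset.sum_add_distrib]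
    refine Finset.sum_congr rfl fun e _ => ?_
    by_cases h3 : α.IsAnc o v e.fst <;> by_cases h4 : α.IsAnc o v e.snd <;> simp [h3, h4]
  rw [h4, h1, h2, h3, zero_add, α.dir_symm] at hbal
  exact neg_add_eq_zero.1 hbal

lemma exists_child_isAnc {T : TreeType (n + s)} {u v : T.V} (h : T.IsAnc o v u) (huv : v ≠ u) :
    ∃ c, c ≠ T.leg o ∧ T.par o c = v ∧ T.IsAnc o c u := by
  induction u using T.par_induction o with
  | root => exact absurd ((isAnc_root_iff T o).1 h) huv
  | step u hu ih =>
    rcases (isAnc_iff T o hu).1 h with h1 | h1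
    · by_cases h2 : v = T.par o u
      · exact ⟨u, hu, h2.symm, T.isAnc_refl o u⟩
      · obtain ⟨c, hc, hcv, hcu⟩ := ih h1 h2
        exact ⟨c, hc, hcv, hcu.trans (par_isAnc hu)⟩
    · exact absurd h1 huv

lemma child_unique {T : TreeType (n + s)} {u c c' : T.V} (hc : c ≠ T.leg o) (hc' : c' ≠ T.leg o)
    (h : T.par o c = T.par o c') (hu : T.IsAnc o c u) (hu' : T.IsAnc o c' u) : c = c' := by
  rcases hu.total hu' with h1 | h1
  · rcases (isAnc_iff T o hc').1 h1 with h2 | h2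
    · rw [← h] at h2
      exact absurd h2 (not_isAnc_par hc)
    · exact h2
  · rcases (isAnc_iff T o hc).1 h1 with h2 | h2
    · rw [h] at h2
      exact absurd h2 (not_isAnc_par hc')
    · exact h2.symm

open Classical in
/-- The labels that lie beyond the oriented edge `d`. -/
def _root_.TropModuli.TreeType.beyond {N : ℕ} (T : TreeType N) (o : Fin N) (d : T.G.Dart) :
    Finset (Fin N) :=
  if T.IsAnc o d.fst d.snd then T.below o d.snd else (T.below o d.fst)ᶜ

lemma isAnc_dart_cases {T : TreeType (n + s)} (d : T.G.Dart) :
    (T.IsAnc o d.fst d.snd ∧ ¬ T.IsAnc o d.snd d.fst ∧ d.snd ≠ T.leg o ∧ T.par o d.snd = d.fst) ∨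
    (¬ T.IsAnc o d.fst d.snd ∧ T.IsAnc o d.snd d.fst ∧ d.fst ≠ T.leg o ∧
      T.par o d.fst = d.snd) := by
  rcases (adj_iff (o := o)).1 d.adj with ⟨h1, h2⟩ | ⟨h1, h2⟩
  · left
    exact ⟨h2 ▸ par_isAnc h1, fun h => not_isAnc_par h1 (h2 ▸ h), h1, h2⟩
  · right
    exact ⟨fun h => not_isAnc_par h1 (h2 ▸ h), h2 ▸ par_isAnc h1, h1, h2⟩

/-- The labels other than those at `v` lie beyond exactly one of the edges at `v`. -/
lemma existsUnique_beyond {T : TreeType (n + s)} {v : T.V} {i : Fin (n + s)} (h : T.leg i ≠ v) :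
    ∃ d : T.G.Dart, d.fst = v ∧ i ∈ T.beyond o d ∧
      ∀ d' : T.G.Dart, d'.fst = v → i ∈ T.beyond o d' → d' = d := by
  by_cases hi : i ∈ T.below o v
  · obtain ⟨c, hc, hcv, hci⟩ := exists_child_isAnc (mem_below.1 hi) h.symm
    have hadj : T.G.Adj v c := hcv ▸ T.adj_par o hc
    have hvc : T.IsAnc o v c := hcv ▸ par_isAnc hc
    refine ⟨⟨(v, c), hadj⟩, rfl, ?_, fun d hd hid => ?_⟩
    · rw [beyond, if_pos hvc]
      exact mem_below.2 hci
    · refine SimpleGraph.Dart.ext _ _ (Prod.ext hd ?_)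
      rcases isAnc_dart_cases (o := o) d with ⟨h1, -, h2, h3⟩ | ⟨h1, -, -, -⟩
      · rw [beyond, if_pos h1] at hid
        exact child_unique h2 hc (h3.trans (hd.trans hcv.symm)) (mem_below.1 hid) hci
      · rw [beyond, if_neg h1, hd] at hid
        exact absurd hi (Finset.mem_compl.1 hid)
  · have hv : v ≠ T.leg o := by
      rintro rfl
      exact hi (by simp [below_root])
    have hvp : ¬ T.IsAnc o v (T.par o v) := not_isAnc_par hv
    refine ⟨⟨(v, T.par o v), (T.adj_par o hv).symm⟩, rfl, ?_, fun d hd hid => ?_⟩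
    · rw [beyond, if_neg hvp]
      exact Finset.mem_compl.2 hi
    · refine SimpleGraph.Dart.ext _ _ (Prod.ext hd ?_)
      rcases isAnc_dart_cases (o := o) d with ⟨h1, -, h2, h3⟩ | ⟨-, -, -, h3⟩
      · rw [beyond, if_pos h1] at hid
        exact absurd (below_anti (hd ▸ h1) hid) hi
      · rw [hd] at h3
        exact h3.symm

lemma notMem_beyond {T : TreeType (n + s)} {i : Fin (n + s)} {d : T.G.Dart}
    (h : T.leg i = d.fst) : i ∉ T.beyond o d := by
  rcases isAnc_dart_cases (o := o) d with ⟨h1, h2, -, -⟩ | ⟨h1, -, -, -⟩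
  · rw [beyond, if_pos h1, mem_below, h]
    exact h2
  · rw [beyond, if_neg h1, Finset.mem_compl, mem_below, h, not_not]
    exact T.isAnc_refl o _

/-- The type of labeled curves with a given underlying tree. -/
def _root_.TropModuli.TreeType.toLabType (T : TreeType (n + s)) (o : Fin (n + s))
    (hsum : ∑ i, Δ i = 0) : LabType n Δ where
  toTreeType := T
  dir d := dirSum n Δ (T.beyond o d)
  dir_symm d := by
    have hneg : ∀ A, dirSum n Δ Aᶜ = - dirSum n Δ A := fun A => by
      rw [eq_neg_iff_add_eq_zero, add_comm, ← dirSum_univ hsum]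
      exact Finset.sum_add_sum_compl A _
    rcases isAnc_dart_cases (o := o) d with ⟨h1, h2, -, -⟩ | ⟨h1, h2, -, -⟩
    · rw [beyond, beyond, if_pos h1, if_neg (show ¬ T.IsAnc o d.symm.fst d.symm.snd from h2)]
      exact hneg _
    · rw [beyond, beyond, if_neg h1, if_pos (show T.IsAnc o d.symm.fst d.symm.snd from h2), hneg,
        neg_neg]
      rfl
  balanced v := by
    classical
    have : Fintype T.V := Fintype.ofFinite _
    rw [finsum_cond_eq_sum, finsum_cond_eq_sum]
    -- Each label is counted once at `v`, as an end attached there or beyond exactly one of the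
    -- edges, so the sum at `v` is that of all ends.
    refine Eq.trans ?_ (dirSum_univ (n := n) hsum)
    have h1 : ∑ d : T.G.Dart, (if d.fst = v then dirSum n Δ (T.beyond o d) else 0) =
        ∑ i, ∑ d : T.G.Dart, if d.fst = v ∧ i ∈ T.beyond o d then endDir n Δ i else 0 := by
      rw [Finset.sum_comm]
      refine Finset.sum_congr rfl fun d _ => ?_
      by_cases hd : d.fst = v
      · simp [hd, dirSum]
      · simp [hd]
    rw [h1, ← Finset.sum_add_distrib, dirSum]
    refine Finset.sum_congr rfl fun i _ => ?_
    by_cases hi : T.leg i = v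
    · rw [if_pos hi, Finset.sum_eq_zero, zero_add]
      intro d _
      rw [if_neg]
      rintro ⟨rfl, h2⟩
      exact notMem_beyond hi h2
    · obtain ⟨d, hd, hid, huniq⟩ := existsUnique_beyond (o := o) hi
      rw [if_neg hi, add_zero, Finset.sum_eq_single d]
      · rw [if_pos ⟨hd, hid⟩]
      · intro d' _ hne
        rw [if_neg]
        rintro ⟨h2, h3⟩
        exact hne (huniq d' h2 h3)
      · simp

/-! ### Positions of the vertices -/

variable (n Δ) in
/-- The position of a vertex above the labels in `B` relative to the position of the end `o`. -/
def posShift (c : Finset (Fin (n + s)) → ℝ) (B : Finset (Fin (n + s))) : Fin r → ℝ :=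
  ∑ A, (if B ⊆ A then c A else 0) • fun k => (dirSum n Δ A k : ℝ)

lemma posShift_root (T : TreeType (n + s)) (l : T.G.edgeSet → ℝ) :
    posShift n Δ (T.coef o l) (T.below o (T.leg o)) = 0 := by
  refine Finset.sum_eq_zero fun A _ => ?_
  split_ifs with h
  · rw [coef_eq_zero, zero_smul]
    intro hA
    obtain ⟨v, hv, rfl⟩ := mem_clusters.1 hA
    exact notMem_below hv (h (by simp [below_root]))
  · rw [zero_smul]

/-- The clusters containing the label set of a vertex are those of the edges between it and the
root; passing from the parent to `v` adds the cluster of `v`. -/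
lemma posShift_par (T : TreeType (n + s)) (l : T.G.edgeSet → ℝ) (v : {v : T.V // v ≠ T.leg o}) :
    posShift n Δ (T.coef o l) (T.below o v) = posShift n Δ (T.coef o l) (T.below o (T.par o v)) +
      l (T.edgeEquiv o v) • fun k => (dirSum n Δ (T.below o v) k : ℝ) := by
  classical
  have h : ∀ A, (if T.below o v ⊆ A then T.coef o l A else 0) =
      (if T.below o (T.par o v) ⊆ A then T.coef o l A else 0) +
        if A = T.below o v then l (T.edgeEquiv o v) else 0 := by
    intro A
    by_cases hA : A ∈ T.clusters o
    · obtain ⟨w, hw, rfl⟩ := mem_clusters.1 hA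
      have e1 : T.below o v ⊆ T.below o w ↔ T.IsAnc o w (T.par o v) ∨ w = v := by
        rw [← isAnc_iff_below_subset, isAnc_iff T o v.2]
      have e2 : T.below o (T.par o v) ⊆ T.below o w ↔ T.IsAnc o w (T.par o v) :=
        isAnc_iff_below_subset.symm
      have e3 : T.below o w = T.below o v ↔ w = v := below_injective.eq_iff
      by_cases hwv : w = v
      · subst hwv
        rw [if_pos (e1.2 (Or.inr rfl)), if_neg (mt e2.1 (not_isAnc_par v.2)), if_pos rfl,
          coef_below, zero_add]
      · rw [if_neg (mt e3.1 hwv), add_zero]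
        exact if_congr (e1.trans ((or_iff_left hwv).trans e2.symm)) rfl rfl
    · have h1 : A ≠ T.below o v := by
        rintro rfl
        exact hA (mem_clusters.2 ⟨v, v.2, rfl⟩)
      simp [coef_eq_zero hA, h1]
  simp only [posShift, h, add_smul, Finset.sum_add_distrib]
  congr 1
  rw [Finset.sum_eq_single (T.below o v)]
  · rw [if_pos rfl]
  · intro A _ hA
    rw [if_neg hA, zero_smul]
  · simp

/-- The subspace spanned by the closed cell of a combinatorial type. -/
def LabType.cellSpace (α : LabType n Δ) :
    Submodule ℝ ((α.G.edgeSet → ℝ) × (α.V → Fin r → ℝ)) where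
  carrier := {x | ∀ d : α.G.Dart,
    x.2 d.snd = x.2 d.fst + x.1 ⟨d.edge, d.edge_mem⟩ • fun k => (α.dir d k : ℝ)}
  add_mem' := by
    intro x y hx hy d
    have h1 := hx d
    have h2 := hy d
    simp only [Prod.fst_add, Prod.snd_add, Pi.add_apply, add_smul]
    rw [h1, h2]
    abel
  zero_mem' := fun d => by simp
  smul_mem' := by
    intro a x hx d
    have h1 := hx d
    simp only [Prod.smul_fst, Prod.smul_snd, Pi.smul_apply, smul_assoc]
    rw [h1, smul_add]

/-- The forced directions give the same increments as `posShift_par`, starting at the root. So the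
edge lengths and the image of `o` determine all positions. -/
lemma LabType.pos_eq (α : LabType n Δ) {x : (α.G.edgeSet → ℝ) × (α.V → Fin r → ℝ)}
    (hx : x ∈ α.cellSpace) (v : α.V) :
    x.2 v = x.2 (α.leg o) + posShift n Δ (α.coef o x.1) (α.below o v) := by
  induction v using α.par_induction o with
  | root => rw [posShift_root, add_zero]
  | step v hv ih =>
    have h1 := hx ⟨(α.par o v, v), α.adj_par o hv⟩
    rw [α.dir_eq (o := o) (d := ⟨(α.par o v, v), α.adj_par o hv⟩) hv rfl] at h1
    rw [posShift_par α.toTreeType x.1 ⟨v, hv⟩, ← add_assoc, ← ih]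
    exact h1

lemma LabType.posShift_mem_cellSpace (α : LabType n Δ) (o : Fin (n + s)) (l : α.G.edgeSet → ℝ)
    (y : Fin r → ℝ) :
    (l, fun v => y + posShift n Δ (α.coef o l) (α.below o v)) ∈ α.cellSpace := by
  have key : ∀ (d : α.G.Dart) (e : α.G.edgeSet), e.1 = d.edge → d.snd ≠ α.leg o →
      α.par o d.snd = d.fst → posShift n Δ (α.coef o l) (α.below o d.snd) =
        posShift n Δ (α.coef o l) (α.below o d.fst) + l e • fun k => (α.dir d k : ℝ) := by
    intro d e he h1 h2
    have h3 : α.edgeEquiv o ⟨d.snd, h1⟩ = e :=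
      Subtype.ext (by rw [edgeEquiv_coe, h2, he]; rfl)
    rw [posShift_par α.toTreeType l ⟨d.snd, h1⟩, h2, h3, α.dir_eq (o := o) h1 h2]
  intro d
  change y + posShift n Δ (α.coef o l) (α.below o d.snd) =
    y + posShift n Δ (α.coef o l) (α.below o d.fst) + l ⟨d.edge, d.edge_mem⟩ • _
  rcases isAnc_dart_cases (o := o) d with ⟨-, -, h1, h2⟩ | ⟨-, -, h1, h2⟩
  · rw [key d ⟨d.edge, d.edge_mem⟩ rfl h1 h2, add_assoc]
  · have h3 : posShift n Δ (α.coef o l) (α.below o d.fst) =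
        posShift n Δ (α.coef o l) (α.below o d.snd) +
          l ⟨d.edge, d.edge_mem⟩ • fun k => (α.dir d.symm k : ℝ) :=
      key d.symm ⟨d.edge, d.edge_mem⟩ d.edge_symm.symm h1 h2
    rw [h3, α.dir_symm]
    funext k
    simp
    ring

/-- The labeled curve with a given underlying abstract curve that maps the end `o` to a given
point. -/
def AbsCurve.toLabCurve (C : AbsCurve (n + s)) (o : Fin (n + s)) (hsum : ∑ i, Δ i = 0)
    (y : Fin r → ℝ) : LabCurve n Δ where
  toLabType := C.toTreeType.toLabType o hsum
  length := C.length
  length_pos := C.length_pos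
  pos v := y + posShift n Δ (C.coef o C.length) (C.below o v)
  pos_snd := (C.toTreeType.toLabType (Δ := Δ) o hsum).posShift_mem_cellSpace o C.length y

lemma LabCurve.mem_cellSpace (C : LabCurve n Δ) : (C.length, C.pos) ∈ C.toLabType.cellSpace :=
  C.pos_snd

lemma LabCurve.pos_eq (C : LabCurve n Δ) (v : C.V) :
    C.pos v = C.pos (C.leg o) + posShift n Δ (C.coef o C.length) (C.below o v) :=
  C.toLabType.pos_eq C.mem_cellSpace v

/-- A labeled curve is determined by its underlying abstract curve and the image of an end. -/
lemma LabCurve.isom_of_coef_eq {C D : LabCurve n Δ} (h : C.coef o C.length = D.coef o D.length)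
    (h' : C.pos (C.leg o) = D.pos (D.leg o)) : C.Isom D := by
  obtain ⟨f, h1, h2, h3⟩ := AbsCurve.exists_iso (C := C.toAbsCurve) (D := D.toAbsCurve) h
  refine ⟨f, h1, h2, fun v => ?_⟩
  have h4 := D.pos_eq (o := o) (f v)
  have h5 : D.below o (f v) = C.below o v := h3 v
  have h6 : posShift n Δ (D.coef o D.length) (D.below o (f v)) =
      posShift n Δ (C.coef o C.length) (C.below o v) := congrArg₂ (posShift n Δ) h.symm h5
  exact h4.trans ((congrArg₂ (· + ·) h'.symm h6).trans (C.pos_eq (o := o) v).symm)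

lemma isCoef_coef (T : TreeType (n + s)) {l : T.G.edgeSet → ℝ} (hl : ∀ e, 0 ≤ l e) :
    IsCoef (T.clusters o) (T.coef o l) :=
  ⟨coef_nonneg hl, fun A hA => by
    by_contra h
    exact hA (coef_eq_zero h)⟩

end TropModuli

end

noncomputable section

namespace TropModuli

open TreeType

variable {r n s : ℕ} {Δ : Fin s → Fin r → ℤ} {o : Fin (n + s)}

/-! ### The map on the closed cells -/

/-- The function `coef` as a linear map. -/
def TreeType.coefLin {N : ℕ} (T : TreeType N) (o : Fin N) :
    (T.G.edgeSet → ℝ) →ₗ[ℝ] (Finset (Fin N) → ℝ) where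
  toFun := T.coef o
  map_add' l l' := by
    funext A
    simp only [coef, Pi.add_apply]
    split_ifs <;> simp
  map_smul' a l := by
    funext A
    simp only [coef, Pi.smul_apply, RingHom.id_apply]
    split_ifs <;> simp

/-- The map to `Q_N × ℝ^r` in terms of the lengths of the edges and the positions of the
vertices. -/
def LabType.cellMap (α : LabType n Δ) (o : Fin (n + s)) :
    ((α.G.edgeSet → ℝ) × (α.V → Fin r → ℝ)) →ₗ[ℝ] Q (n + s) × (Fin r → ℝ) :=
  ((combination ∘ₗ α.coefLin o) ∘ₗ LinearMap.fst ℝ _ _).prod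
    (LinearMap.proj (α.leg o) ∘ₗ LinearMap.snd ℝ _ _)

lemma LabType.cellMap_apply (α : LabType n Δ) (x : (α.G.edgeSet → ℝ) × (α.V → Fin r → ℝ)) :
    α.cellMap o x = (combination (α.coef o x.1), x.2 (α.leg o)) := rfl

/-- Needed in order that injective linear maps into `Q N × ℝ^r` are closed embeddings. -/
instance (N : ℕ) : T2Space (Q N) := by
  have : IsClosed (LinearMap.range (Phi N) : Set (Pairs N → ℝ)) :=
    Submodule.closed_of_finiteDimensional _
  infer_instance

lemma LabType.eq_zero_of_combination_eq_zero (hN : 3 ≤ n + s) (α : LabType n Δ)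
    {l : α.G.edgeSet → ℝ} (h : combination (α.coef o l) = 0) : l = 0 := by
  obtain ⟨φ, hφ⟩ := (isHierarchy_clusters (T := α.toTreeType) (o := o)).exists_isDual hN
  have h1 : ∑ A ∈ α.clusters o, α.coef o l A • splitVector A = 0 := by
    rw [← h, combination_apply]
    refine Finset.sum_subset (Finset.subset_univ _) fun A _ hA => ?_
    rw [coef_eq_zero hA, zero_smul]
  funext e
  obtain ⟨v, rfl⟩ := (α.edgeEquiv o).surjective e
  rw [← coef_below (T := α.toTreeType) l v, ← hφ.apply_sum (α.coef o l) (mem_clusters.2 ⟨v, v.2, rfl⟩), h1, map_zero,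
    Pi.zero_apply]

lemma LabType.ker_cellMap_domRestrict (hN : 3 ≤ n + s) (α : LabType n Δ) :
    LinearMap.ker ((α.cellMap o).domRestrict α.cellSpace) = ⊥ := by
  rw [LinearMap.ker_eq_bot']
  rintro ⟨x, hx⟩ h
  have h' : (combination (α.coef o x.1), x.2 (α.leg o)) = 0 := h
  have h1 : x.1 = 0 := α.eq_zero_of_combination_eq_zero hN (congrArg Prod.fst h')
  have h2 : x.2 (α.leg o) = 0 := congrArg Prod.snd h'
  have h3 : α.coef o 0 = 0 := (α.coefLin o).map_zero
  refine Subtype.ext (Prod.ext h1 (funext fun v => ?_))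
  rw [α.pos_eq (o := o) hx v, h1, h2, h3]
  simp [posShift]

lemma LabType.isClosed_closedCell (α : LabType n Δ) : IsClosed α.closedCell := by
  have h : α.closedCell = {x | ∀ e, 0 ≤ x.1 e} ∩ α.cellSpace := rfl
  have h1 : IsClosed {x : (α.G.edgeSet → ℝ) × (α.V → Fin r → ℝ) | ∀ e, 0 ≤ x.1 e} := by
    simp only [ofPred_forall]
    exact isClosed_iInter fun e => isClosed_le continuous_const (by fun_prop)
  rw [h]
  exact h1.inter (Submodule.closed_of_finiteDimensional _)

/-- On the cell space the map is linear and injective, hence a closed embedding, and the closed cell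
is a closed subset. -/
lemma LabType.isClosed_cellMap_image (hN : 3 ≤ n + s) (α : LabType n Δ)
    {Z : Set ((α.G.edgeSet → ℝ) × (α.V → Fin r → ℝ))} (hZ : IsClosed Z) :
    IsClosed (α.cellMap o '' (Z ∩ α.closedCell)) := by
  have h := LinearMap.isClosedEmbedding_of_injective (α.ker_cellMap_domRestrict (o := o) hN)
  have h1 : α.cellMap o '' (Z ∩ α.closedCell) = (α.cellMap o).domRestrict α.cellSpace ''
      ((↑) ⁻¹' (Z ∩ α.closedCell)) := by
    ext y
    constructor
    · rintro ⟨x, hx, rfl⟩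
      exact ⟨⟨x, hx.2.2⟩, hx, rfl⟩
    · rintro ⟨x, hx, rfl⟩
      exact ⟨x, hx, rfl⟩
  rw [h1]
  exact h.isClosedMap _ ((hZ.inter α.isClosed_closedCell).preimage continuous_subtype_val)

/-! ### Contractions of labeled curves -/

lemma LabCurve.isContraction_self (C : LabCurve n Δ) :
    IsContraction C.toLabType C.length C.pos C := by
  refine ⟨id, Function.surjective_id, fun u v => ⟨?_, ?_⟩, fun e _ => ⟨e, by simp, rfl⟩,
    fun e => ⟨e, by simp⟩, fun i => rfl, fun v => rfl⟩
  · rintro rfl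
    exact SimpleGraph.Reachable.refl _
  · rintro ⟨p⟩
    cases p with
    | nil => rfl
    | cons h _ =>
      obtain ⟨e, -, he⟩ := h
      exact absurd he (C.length_pos e).ne'

lemma LabCurve.mem_cellGraph (C : LabCurve n Δ) :
    ((C.length, C.pos), (⟦C⟧ : MLab n Δ)) ∈ C.toLabType.cellGraph :=
  ⟨⟨fun e => (C.length_pos e).le, C.pos_snd⟩, C, C.isContraction_self, rfl⟩

/-- Contract the abstract tree and place its vertices by `posShift`. The positions agree because a
cluster of non-zero length contains the labels below `v` exactly when it contains those below `π v`.
-/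
lemma LabType.exists_isContraction (hN : 3 ≤ n + s) (o : Fin (n + s)) (hsum : ∑ i, Δ i = 0)
    (α : LabType n Δ) {x : (α.G.edgeSet → ℝ) × (α.V → Fin r → ℝ)} (hx : x ∈ α.closedCell) :
    ∃ C : LabCurve n Δ, IsContraction α x.1 x.2 C := by
  obtain ⟨C, π, hπ, h⟩ := exists_isTreeContraction hN o α.toTreeType hx.1
  refine ⟨C.toLabCurve o hsum (x.2 (α.leg o)), π, hπ.surjective, hπ.eq_iff, hπ.edge_of_pos,
    hπ.edge, hπ.leg, fun v => ?_⟩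
  rw [α.pos_eq (o := o) hx.2 v]
  change _ + posShift n Δ (C.coef o C.length) (C.below o (π v)) = _
  rw [hπ.coef_eq hx.1]
  congr 1
  refine Finset.sum_congr rfl fun A _ => ?_
  by_cases hA : α.coef o x.1 A = 0
  · simp [hA]
  · congr 1
    exact if_congr (h v A hA) rfl rfl

/-! ### The embedding -/

/-- The first contracted end. -/
abbrev firstEnd (s : ℕ) (hn : 0 < n) : Fin (n + s) := Fin.castAdd s ⟨0, hn⟩

/-- The map from the moduli space of labeled curves to `Q_N × ℝ^r`. -/
def evalMap (hn : 0 < n) (m : MLab n Δ) : Q (n + s) × (Fin r → ℝ) :=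
  (phi (n + s) (psi m), ev ⟨0, hn⟩ m)

lemma evalMap_mk (hn : 0 < n) (C : LabCurve n Δ) :
    evalMap hn ⟦C⟧ =
      (combination (C.coef (firstEnd s hn) C.length), C.pos (C.leg (firstEnd s hn))) :=
  Prod.ext (phi_mk (o := firstEnd s hn) C.toAbsCurve) rfl

lemma evalMap_injective (hn : 0 < n) (hN : 3 ≤ n + s) :
    Function.Injective (evalMap hn : MLab n Δ → Q (n + s) × (Fin r → ℝ)) := by
  intro m m'
  induction m using Quotient.ind with | _ C
  induction m' using Quotient.ind with | _ D
  intro h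
  rw [evalMap_mk, evalMap_mk, Prod.mk.injEq] at h
  refine Quotient.sound (LabCurve.isom_of_coef_eq (o := firstEnd s hn) ?_ h.2)
  exact eq_of_combination_eq hN isHierarchy_clusters isHierarchy_clusters
    (isCoef_coef _ fun e => (C.length_pos e).le) (isCoef_coef _ fun e => (D.length_pos e).le) h.1

lemma evalMap_of_mem_cellGraph (hn : 0 < n) {α : LabType n Δ}
    {x : ((α.G.edgeSet → ℝ) × (α.V → Fin r → ℝ)) × MLab n Δ} (hx : x ∈ α.cellGraph) :
    evalMap hn x.2 = α.cellMap (firstEnd s hn) x.1 := by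
  obtain ⟨⟨l, p⟩, m⟩ := x
  obtain ⟨⟨hl, -⟩, C, ⟨π, h1, h2, h3, h4, h5, h6⟩, rfl⟩ := hx
  have h : IsTreeContraction α.toTreeType l C.toAbsCurve π := ⟨h1, h2, h3, h4, h5⟩
  rw [evalMap_mk, α.cellMap_apply]
  refine Prod.ext (congrArg combination (h.coef_eq hl)) ?_
  change C.pos (C.leg _) = p (α.leg _)
  rw [h5, h6]

lemma continuous_evalMap (hn : 0 < n) :
    Continuous (evalMap hn : MLab n Δ → Q (n + s) × (Fin r → ℝ)) := by
  refine continuous_iSup_dom.2 fun α => continuous_coinduced_dom.2 ?_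
  have h : (evalMap hn ∘ fun x : α.cellGraph => x.1.2) =
      α.cellMap (firstEnd s hn) ∘ fun x : α.cellGraph => x.1.1 :=
    funext fun x => evalMap_of_mem_cellGraph hn x.2
  rw [h]
  exact @Continuous.comp _ _ _ (.induced (fun x : α.cellGraph => x.1.1) inferInstance) _ _ _ _
    (LinearMap.continuous_of_finiteDimensional _) continuous_induced_dom

/-- One tree for each of the finitely many hierarchies represents all curves. So the image of a
closed set is a finite union of images of closed subsets of cells. -/
lemma isClosedMap_evalMap (hn : 0 < n) (hN : 3 ≤ n + s) (hsum : ∑ i, Δ i = 0) :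
    IsClosedMap (evalMap hn : MLab n Δ → Q (n + s) × (Fin r → ℝ)) := by
  intro K hK
  have hZ : ∀ α : LabType n Δ, ∃ Z : Set ((α.G.edgeSet → ℝ) × (α.V → Fin r → ℝ)), IsClosed Z ∧
      ∀ x ∈ α.cellGraph, x.1 ∈ Z ↔ x.2 ∈ K := by
    intro α
    have h1 := isClosed_coinduced.1 (isClosed_iSup_iff.1 hK α)
    obtain ⟨Z, hZ, h2⟩ := isClosed_induced_iff.1 h1
    exact ⟨Z, hZ, fun x hx => Set.ext_iff.1 h2 ⟨x, hx⟩⟩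
  choose Z hZ hZK using hZ
  have hT : ∀ L : {L : Finset (Finset (Fin (n + s))) // IsHierarchy (firstEnd s hn) L},
      ∃ T : TreeType (n + s), T.clusters (firstEnd s hn) = L := fun L => exists_treeType hN L.2
  choose T hT using hT
  let α : {L : Finset (Finset (Fin (n + s))) // IsHierarchy (firstEnd s hn) L} → LabType n Δ :=
    fun L => (T L).toLabType (firstEnd s hn) hsum
  have key : evalMap hn '' K =
      ⋃ L, (α L).cellMap (firstEnd s hn) '' (Z (α L) ∩ (α L).closedCell) := by
    ext y
    simp only [mem_iUnion]
    constructor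
    · rintro ⟨m, hm, rfl⟩
      induction m using Quotient.ind with | _ C
      let L : {L : Finset (Finset (Fin (n + s))) // IsHierarchy (firstEnd s hn) L} :=
        ⟨C.clusters (firstEnd s hn), isHierarchy_clusters⟩
      obtain ⟨l, hl, hlC⟩ := exists_length (T L) (c := C.coef (firstEnd s hn) C.length)
        (coef_nonneg fun e => (C.length_pos e).le) (fun A => by
          rw [hT L, ← coef_pos_iff C.length_pos]
          exact ⟨fun h => (coef_nonneg (fun e => (C.length_pos e).le) A).lt_of_ne' h,
            fun h => h.ne'⟩)
      -- `C` is moved to the chosen tree with the same clusters. Lengths and image of `o` agree, so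
      -- it is the same point of the moduli space.
      let C' : LabCurve n Δ := (⟨T L, l, hl⟩ : AbsCurve (n + s)).toLabCurve (firstEnd s hn) hsum
        (C.pos (C.leg (firstEnd s hn)))
      have h1 : (⟦C'⟧ : MLab n Δ) = ⟦C⟧ := by
        refine Quotient.sound (LabCurve.isom_of_coef_eq (o := firstEnd s hn) hlC ?_)
        change _ + posShift n Δ ((T L).coef _ l) ((T L).below _ ((T L).leg _)) = _
        rw [posShift_root, add_zero]
      have h2 := C'.mem_cellGraph
      refine ⟨L, (C'.length, C'.pos), ⟨(hZK (α L) _ h2).2 ?_, h2.1⟩, ?_⟩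
      · change (⟦C'⟧ : MLab n Δ) ∈ K
        rw [h1]
        exact hm
      · rw [← h1]
        exact (evalMap_of_mem_cellGraph hn h2).symm
    · rintro ⟨L, x, ⟨hx, hx'⟩, rfl⟩
      -- Boundary points of the closed cell also represent curves, after contraction.
      obtain ⟨C, hC⟩ := (α L).exists_isContraction hN (firstEnd s hn) hsum hx'
      have h1 : (x, (⟦C⟧ : MLab n Δ)) ∈ (α L).cellGraph := ⟨hx', C, hC, rfl⟩
      exact ⟨⟦C⟧, (hZK (α L) _ h1).1 hx, evalMap_of_mem_cellGraph hn h1⟩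
  rw [key]
  exact isClosed_iUnion_of_finite fun L => (α L).isClosed_cellMap_image hN (hZ (α L))

lemma isEmbedding_evalMap (hn : 0 < n) (hN : 3 ≤ n + s) (hsum : ∑ i, Δ i = 0) :
    IsEmbedding (evalMap hn : MLab n Δ → Q (n + s) × (Fin r → ℝ)) :=
  (IsClosedEmbedding.of_continuous_injective_isClosedMap (continuous_evalMap hn)
    (evalMap_injective hn hN) (isClosedMap_evalMap hn hN hsum)).isEmbedding

lemma range_evalMap (hn : 0 < n) (hsum : ∑ i, Δ i = 0) :
    range (evalMap hn : MLab n Δ → Q (n + s) × (Fin r → ℝ)) =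
      range (phi (n + s)) ×ˢ univ := by
  ext ⟨q, y⟩
  constructor
  · rintro ⟨m, h⟩
    exact ⟨⟨psi m, congrArg Prod.fst h⟩, mem_univ _⟩
  · rintro ⟨⟨m, rfl⟩, -⟩
    induction m using Quotient.ind with | _ C
    refine ⟨⟦C.toLabCurve (firstEnd s hn) hsum y⟧, Prod.ext rfl ?_⟩
    change y + posShift n Δ (C.coef _ C.length) (C.below _ (C.leg _)) = y
    rw [posShift_root, add_zero]

/-- A boundary point of a closed cone is attained by the curve whose hierarchy consists of the
clusters with non-zero length. -/
lemma range_phi {N : ℕ} (o : Fin N) (hN : 3 ≤ N) : range (phi N) = ⋃ T : TreeType N, T.cone := by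
  classical
  ext q
  simp only [mem_iUnion]
  constructor
  · rintro ⟨m, rfl⟩
    induction m using Quotient.ind with | _ C
    exact ⟨C.toTreeType, C.length, fun e => (C.length_pos e).le, rfl⟩
  · rintro ⟨T, l, hl, rfl⟩
    obtain ⟨C, hC⟩ := exists_absCurve hN
      ((isHierarchy_clusters (T := T) (o := o)).mono
        (Finset.filter_subset (fun A => T.coef o l A ≠ 0) _))
      (coef_nonneg hl) (fun A => by
        rw [Finset.mem_filter]
        refine ⟨fun h => ⟨?_, h⟩, fun h => h.2⟩
        by_contra h'
        exact h (coef_eq_zero h'))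
    exact ⟨⟦C⟧, by rw [phi_mk (o := o), hC, distClass_eq (o := o)]⟩

lemma support_prod {N : ℕ} (r : ℕ) :
    ((m0Fan N).prod (WeightedFan.whole (Fin r → ℝ))).support =
      (⋃ T : TreeType N, T.cone) ×ˢ univ := by
  ext ⟨q, y⟩
  constructor
  · rintro ⟨_, ⟨_, ⟨T, rfl⟩, _, rfl, rfl⟩, h, -⟩
    exact ⟨mem_iUnion.2 ⟨T, h⟩, mem_univ _⟩
  · rintro ⟨h, -⟩
    obtain ⟨T, h⟩ := mem_iUnion.1 h
    exact ⟨_, ⟨_, ⟨T, rfl⟩, _, rfl, rfl⟩, h, mem_univ _⟩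

end TropModuli

end

/-! ### The theorem, with the first contracted end as root. -/

theorem proposition4p7 (r n s : ℕ) (hn : 0 < n) (hN : 3 ≤ n + s)
    (Δ : Fin s → Fin r → ℤ) (hΔ : ∀ i, Δ i ≠ 0) (hsum : ∑ i, Δ i = 0) :
    let F : TropModuli.MLab n Δ → TropModuli.Q (n + s) × (Fin r → ℝ) :=
      fun C => (TropModuli.phi (n + s) (TropModuli.psi C), TropModuli.ev ⟨0, hn⟩ C)
    let X : TropModuli.WeightedFan (TropModuli.Q (n + s) × (Fin r → ℝ)) :=
      (TropModuli.m0Fan (n + s)).prod (TropModuli.WeightedFan.whole (Fin r → ℝ))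
    Topology.IsEmbedding F ∧
      Set.range F = Set.range (TropModuli.phi (n + s)) ×ˢ Set.univ ∧
      Set.range F = X.support ∧
      X.IsTropical ((TropModuli.latticeQ (n + s)).prod (TropModuli.intLattice r))
        (r + (n + s) - 3) := by
  intro F X
  have hF : range F = range (TropModuli.phi (n + s)) ×ˢ univ := TropModuli.range_evalMap hn hsum
  refine ⟨TropModuli.isEmbedding_evalMap hn hN hsum, hF, ?_,
    TropModuli.isTropical_prod (TropModuli.firstEnd s hn) r hN⟩
  rw [hF, TropModuli.range_phi (TropModuli.firstEnd s hn) hN]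
  exact (TropModuli.support_prod r).symm
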